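/- Let $p\in\{2,3\}$ and let $\Omega\subset\mathbb R^p$ be a bounded polygonal (polyhedral) domain: open, connected, with $\partial\Omega$ contained in finitely many hyperplanes and $\Omega=\operatorname{int}\overline\Omega$. Let $\partial\Omega=\Gamma^D\cup\Gamma^N$ with $\Gamma^D\cap\Gamma^N=\emptyset$ and $\mathrm m(\Gamma^D)>0$, where $\mathrm m$ denotes both the Lebesgue measure and the $(p-1)$-dimensional Hausdorff measure (normalized to be length/area on hyperplanes), and let $\xi>0$. **Meshes.** An admissible mesh of $\Omega$ consists of finitely many nonempty open convex control volumes $K\in\mathcal T$, $K\subset\Omega$, finitely many edges (faces) $\sigma\in\mathcal E$ and points $(x_K)_{K\in\mathcal T}$, $x_K\in\overline K$, such that: the edges are pairwise disjoint, each is a relatively open subset of a hyperplane with positive $(p-1)$-measure and negligible relative boundary; $\overline{\bigcup_K K}=\overline\Omega$; $\partial K=\bigcup_{\sigma\in\mathcal E_K}\overline\sigma$ with $\mathcal E_K\subset\mathcal E$ the set of edges of $K$, and $\mathcal E=\bigcup_K\mathcal E_K$; for $K\ne L$ either $\mathrm m(\overline K\cap\overline L)=0$ (for the $(p-1)$-dimensional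 measure) or $\overline K\cap\overline L=\overline\sigma$ for some $\sigma\in\mathcal E_K\cap\mathcal E_L$, written $\sigma=K|L$; an edge is either such an interior edge ($\sigma\in\mathcal E_{int}$) or is contained in $\partial\Omega$ and is then an edge of only one cell; for $\sigma=K|L$, $x_K\neq x_L$ and the line $x_Kx_L$ is orthogonal to $\sigma$; for $\sigma\in\mathcal E_K$ with $\sigma\subset\partial\Omega$ the line through $x_K$ orthogonal to $\sigma$ meets $\overline\sigma$. Each edge $\sigma\subset\partial\Omega$ is included in $\Gamma^D$ ($\sigma\in\mathcal E^D$) or in $\Gamma^N$ ($\sigma\in\mathcal E^N$). Put $d_\sigma=|x_K-x_L|$ if $\sigma=K|L$ and $d_\sigma=\mathrm d(x_K,\sigma)$ if $\sigma\in\mathcal E_K$, $\sigma\subset\partial\Omega$; assume $d_\sigma>0$ for all $\sigma$, and put $\tau_\sigma=\mathrm m(\sigma)/d_\sigma$. Assume the regularity constraint $$\mathrm d(x_K,\sigma)\ge\xi\,d_\sigma\qquad\forall K\in\mathcal T,\ \forall\sigma\in\mathcal E_K,$$ where here $\mathrm d(x_K,\sigma)$ is the orthogonal distance, i.e. the distance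 from $x_K$ to the hyperplane containing $\sigma$. **Scheme.** Let $\mathbf U\in C(\overline\Omega)^p$, $b\in L^\infty(\Omega)$ with $b\ge0$ a.e., $f\in L^\infty(\Omega)$, $v^D\in L^\infty(\Gamma^D)$, and let $B:\mathbb R\to\mathbb R$ be Lipschitz continuous with $B(0)=1$, $B(s)>0$ and $B(s)-B(-s)=-s$ for all $s$. Let $f_K,b_K$ be the mean values of $f,b$ over $K$, $U_{K,\sigma}$ the mean value over $\sigma$ of $\mathbf U\cdot\mathbf n_{K,\sigma}$ ($\mathbf n_{K,\sigma}$ the unit normal to $\sigma$ outward $K$), and $v^D_\sigma$ the mean value of $v^D$ over $\sigma\in\mathcal E^D$. Let $\mathbf v=(v_K)_{K\in\mathcal T}$ solve $$\sum_{\sigma\in\mathcal E_K}\mathcal F_{K,\sigma}+\mathrm m(K)b_Kv_K=\mathrm m(K)f_K\qquad\forall K\in\mathcal T,$$ with $\mathcal F_{K,\sigma}=0$ if $\sigma\in\mathcal E^N$ and $\mathcal F_{K,\sigma}=\tau_\sigma\big(B(-U_{K,\sigma}d_\sigma)v_K-B(U_{K,\sigma}d_\sigma)v_{K,\sigma}\big)$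 otherwise, where $v_{K,\sigma}=v_L$ if $\sigma=K|L$ and $v_{K,\sigma}=v^D_\sigma$ if $\sigma\in\mathcal E^D$. Define $\beta_{\mathbf U}=\inf\{B(\operatorname{diam}(\Omega)\,x): |x|\le\|\mathbf U\|_{L^\infty}\}$ and, since the first truncation threshold is $C_1=1$, $$E_1=\sum_{\sigma\in\mathcal E_{int}\cup\mathcal E^D}\tau_\sigma\big[\log(1+(v_{K,\sigma}-1)^+)-\log(1+(v_K-1)^+)\big]^2,$$ where for each $\sigma$ the cell $K$ is one chosen cell having $\sigma$ as an edge. **Statement.** There is $\eta>0$ depending only on $\Omega$ (with its boundary decomposition $\Gamma^D,\Gamma^N$), $p$ and $\xi$ such that, for all meshes and data as above, if $f_K\ge0$ for all $K\in\mathcal T$ and $v^D_\sigma\in[0,1]$ for all $\sigma\in\mathcal E^D$, then $v_K\ge0$ for all $K\in\mathcal T$, and $$E_1\,\big(\|\mathbf U\|_{L^\infty}^2+\|f\|_{L^\infty}\big)^2\le\eta\,\beta_{\mathbf U}^4\quad\Longrightarrow\quad v_K\le2\quad\forall K\in\mathcal T$$ (for $(\mathbf U,f)\ne(0,0)$ the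 condition reads $E_1\le\eta\,\beta_{\mathbf U}^4/(\|\mathbf U\|_{L^\infty}^2+\|f\|_{L^\infty})^2$). -/

import Mathlib

open MeasureTheory
open scoped ENNReal

namespace TPFA

noncomputable section

/-- A nonempty bounded polygonal (`p = 2`) or polyhedral (`p = 3`) domain of `ℝ^p`: bounded, open,
connected, lying on one side of its boundary (`interior (closure Ω) = Ω`), and with boundary
contained in finitely many hyperplanes. -/
structure IsPolytopalDomain {p : ℕ} (Ω : Set (EuclideanSpace ℝ (Fin p))) : Prop where
  isOpen : IsOpen Ω
  isConnected : IsConnected Ω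
  isBounded : Bornology.IsBounded Ω
  interior_closure : interior (closure Ω) = Ω
  frontier_subset : ∃ H : Set (EuclideanSpace ℝ (Fin p) × ℝ), H.Finite ∧ (∀ q ∈ H, q.1 ≠ 0) ∧
    frontier Ω ⊆ ⋃ q ∈ H, {x | inner ℝ q.1 x = q.2}

/-- The `(p-1)`-dimensional Hausdorff measure on `ℝ^p`, normalized so that it is the usual
length (`p = 2`) or area (`p = 3`) on hyperplanes. -/
def surf (p : ℕ) : Measure (EuclideanSpace ℝ (Fin p)) := μHE[p - 1]

/-- The data of a finite volume mesh in `ℝ^p`: finitely many control volumes `vol K`, finitely many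
edges (faces) `face σ`, points `pt K = x_K`, the unit normals `normal K σ = n_{K,σ}`, and the
incidence of edges and cells: `side σ = K_σ` is the selected cell having `σ` as an edge, and
`opp σ` is the other cell (`some L` for an interior edge `σ = K_σ|L`, `none` for an exterior
edge). -/
structure Mesh (p : ℕ) where
  Cell : Type
  Edge : Type
  [fintypeCell : Fintype Cell]
  [fintypeEdge : Fintype Edge]
  vol : Cell → Set (EuclideanSpace ℝ (Fin p))
  face : Edge → Set (EuclideanSpace ℝ (Fin p))
  pt : Cell → EuclideanSpace ℝ (Fin p)
  normal : Cell → Edge → EuclideanSpace ℝ (Fin p)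
  side : Edge → Cell
  opp : Edge → Option Cell

attribute [instance] Mesh.fintypeCell Mesh.fintypeEdge

namespace Mesh

variable {p : ℕ} (M : Mesh p)

open Classical in
/-- The set `𝓔_K` of the edges of the cell `K`. -/
def edges (K : M.Cell) : Finset M.Edge :=
  Finset.univ.filter fun σ => M.side σ = K ∨ M.opp σ = some K

/-- `m(σ)`. -/
def faceMeas (σ : M.Edge) : ℝ := (surf p).real (M.face σ)

/-- `m(K)`. -/
def cellMeas (K : M.Cell) : ℝ := volume.real (M.vol K)

/-- `d_σ`: the distance `d(x_K, x_L)` if `σ = K|L` is interior, `d(x_K, σ)` if `σ` is an exterior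
edge of `K`. -/
def d (σ : M.Edge) : ℝ :=
  match M.opp σ with
  | some L => dist (M.pt (M.side σ)) (M.pt L)
  | none => Metric.infDist (M.pt (M.side σ)) (M.face σ)

/-- The transmissibility `τ_σ = m(σ) / d_σ`. -/
def tau (σ : M.Edge) : ℝ := M.faceMeas σ / M.d σ

/-- Admissible meshes of `Ω` (for two-point flux approximation). -/
structure IsAdmissible (Ω : Set (EuclideanSpace ℝ (Fin p))) : Prop where
  /-- control volumes are nonempty open convex subsets of `Ω` (their being polygonal follows from
  `frontier_vol`) -/
  vol_isOpen : ∀ K, IsOpen (M.vol K)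
  vol_convex : ∀ K, Convex ℝ (M.vol K)
  vol_nonempty : ∀ K, (M.vol K).Nonempty
  vol_subset : ∀ K, M.vol K ⊆ Ω
  /-- edges are pairwise disjoint, relatively open in their hyperplane, of positive measure, with
  negligible relative boundary -/
  face_isOpen : ∀ σ, ∃ O : Set (EuclideanSpace ℝ (Fin p)), IsOpen O ∧
    M.face σ = O ∩ (affineSpan ℝ (M.face σ) : Set (EuclideanSpace ℝ (Fin p)))
  face_pos : ∀ σ, 0 < surf p (M.face σ)
  face_boundary : ∀ σ, surf p (closure (M.face σ) \ M.face σ) = 0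
  face_disjoint : ∀ σ σ', σ ≠ σ' → Disjoint (M.face σ) (M.face σ')
  /-- `n_{K,σ}` is the unit normal to `σ` pointing out of `K`; in particular `σ` lies in a
  hyperplane -/
  normal_norm : ∀ K, ∀ σ ∈ M.edges K, ‖M.normal K σ‖ = 1
  normal_orth : ∀ K, ∀ σ ∈ M.edges K, ∀ x ∈ M.face σ, ∀ y ∈ M.face σ,
    inner ℝ (M.normal K σ) (x - y) = 0
  normal_outward : ∀ K, ∀ σ ∈ M.edges K, ∀ x ∈ M.vol K, ∀ y ∈ M.face σ,
    inner ℝ (M.normal K σ) (x - y) ≤ 0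
  /-- the cells cover the domain -/
  closure_iUnion : closure (⋃ K, M.vol K) = closure Ω
  /-- the boundary of a cell is the union of its closed edges -/
  frontier_vol : ∀ K, frontier (M.vol K) = ⋃ σ ∈ M.edges K, closure (M.face σ)
  /-- two distinct cells have a common edge `K|L` or meet in a negligible set -/
  inter : ∀ K L, K ≠ L → surf p (closure (M.vol K) ∩ closure (M.vol L)) = 0 ∨
    ∃ σ, (M.side σ = K ∧ M.opp σ = some L) ∨ (M.side σ = L ∧ M.opp σ = some K)
  /-- interior edges: `σ = K|L` -/
  interior_edge : ∀ σ L, M.opp σ = some L → L ≠ M.side σ ∧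
    closure (M.vol (M.side σ)) ∩ closure (M.vol L) = closure (M.face σ)
  /-- exterior edges are those contained in `∂Ω` -/
  exterior_edge : ∀ σ, M.opp σ = none ↔ M.face σ ⊆ frontier Ω
  pt_mem : ∀ K, M.pt K ∈ closure (M.vol K)
  /-- for `σ = K|L`, `x_K ≠ x_L` and the line through `x_K` and `x_L` is orthogonal to `σ` -/
  pt_ne : ∀ σ L, M.opp σ = some L → M.pt (M.side σ) ≠ M.pt L
  pt_orth : ∀ σ L, M.opp σ = some L → ∀ x ∈ M.face σ, ∀ y ∈ M.face σ,
    inner ℝ (M.pt (M.side σ) - M.pt L) (x - y) = 0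
  /-- for an exterior edge, the line through `x_K` orthogonal to `σ` meets the (closed) edge -/
  exterior_orth : ∀ σ, M.opp σ = none → ∃ y ∈ closure (M.face σ), ∀ x ∈ M.face σ,
    inner ℝ (M.pt (M.side σ) - y) (x - y) = 0
  /-- all transmissibilities are well defined (for interior edges this is `pt_ne`) -/
  d_pos : ∀ σ, 0 < M.d σ

/-- The regularity constraint `d(x_K, σ) ≥ ξ d_σ`; here `d(x_K, σ)` is the orthogonal distance, that
is, the distance from `x_K` to the hyperplane which contains `σ`. -/
def IsRegular (ξ : ℝ) : Prop :=
  ∀ K, ∀ σ ∈ M.edges K, ξ * M.d σ ≤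
    Metric.infDist (M.pt K) (affineSpan ℝ (M.face σ) : Set (EuclideanSpace ℝ (Fin p)))

/-- `σ ∈ 𝓔^D`: exterior edges included in `Γ^D`. -/
def IsDirichlet (ΓD : Set (EuclideanSpace ℝ (Fin p))) (σ : M.Edge) : Prop :=
  M.opp σ = none ∧ M.face σ ⊆ ΓD

/-- `σ ∈ 𝓔^N`: exterior edges included in `Γ^N`. -/
def IsNeumann (ΓN : Set (EuclideanSpace ℝ (Fin p))) (σ : M.Edge) : Prop :=
  M.opp σ = none ∧ M.face σ ⊆ ΓN

/-- The mesh is compatible with the splitting of the boundary: `𝓔_ext = 𝓔^D ∪ 𝓔^N`. -/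
def IsCompatible (ΓD ΓN : Set (EuclideanSpace ℝ (Fin p))) : Prop :=
  ∀ σ, M.opp σ = none → M.IsDirichlet ΓD σ ∨ M.IsNeumann ΓN σ

/-- The mean value `g_K` of `g` over the cell `K`. -/
def cellAvg (g : EuclideanSpace ℝ (Fin p) → ℝ) (K : M.Cell) : ℝ := ⨍ x in M.vol K, g x

/-- `U_{K,σ}`: the mean value over `σ` of `U · n_{K,σ}`. -/
def normalVel (U : EuclideanSpace ℝ (Fin p) → EuclideanSpace ℝ (Fin p)) (K : M.Cell)
    (σ : M.Edge) : ℝ :=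
  ⨍ x in M.face σ, inner ℝ (U x) (M.normal K σ) ∂(surf p)

/-- `v^D_σ`: the mean value of `v^D` over `σ`. -/
def faceAvg (vD : EuclideanSpace ℝ (Fin p) → ℝ) (σ : M.Edge) : ℝ := ⨍ x in M.face σ, vD x ∂(surf p)

open Classical in
/-- `v_{K,σ}`: the value in the cell on the other side if `σ` is interior, `v^D_σ` otherwise. -/
def otherVal (vD : EuclideanSpace ℝ (Fin p) → ℝ) (v : M.Cell → ℝ) (K : M.Cell)
    (σ : M.Edge) : ℝ :=
  match M.opp σ with
  | some L => if K = M.side σ then v L else v (M.side σ)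
  | none => M.faceAvg vD σ

open Classical in
/-- The numerical flux `𝓕_{K,σ}`. -/
def flux (ΓN : Set (EuclideanSpace ℝ (Fin p)))
    (U : EuclideanSpace ℝ (Fin p) → EuclideanSpace ℝ (Fin p))
    (vD : EuclideanSpace ℝ (Fin p) → ℝ) (B : ℝ → ℝ) (v : M.Cell → ℝ) (K : M.Cell)
    (σ : M.Edge) : ℝ :=
  if M.IsNeumann ΓN σ then 0
  else M.tau σ * (B (-(M.normalVel U K σ * M.d σ)) * v K
    - B (M.normalVel U K σ * M.d σ) * M.otherVal vD v K σ)

/-- `v = (v_K)` solves the `B`-scheme. -/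
def IsSolution (ΓN : Set (EuclideanSpace ℝ (Fin p)))
    (U : EuclideanSpace ℝ (Fin p) → EuclideanSpace ℝ (Fin p))
    (b f vD : EuclideanSpace ℝ (Fin p) → ℝ) (B : ℝ → ℝ) (v : M.Cell → ℝ) : Prop :=
  ∀ K, (∑ σ ∈ M.edges K, M.flux ΓN U vD B v K σ) + M.cellMeas K * M.cellAvg b K * v K
    = M.cellMeas K * M.cellAvg f K

/-- The truncation threshold `C_m = 2 (1 - 2^{-m})`. -/
def threshold (m : ℕ) : ℝ := 2 * (1 - (2 ^ m)⁻¹)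

open Classical in
/-- The energy `E_m(v)`, a sum over the interior and the Dirichlet edges. -/
def energy (ΓD : Set (EuclideanSpace ℝ (Fin p))) (vD : EuclideanSpace ℝ (Fin p) → ℝ)
    (v : M.Cell → ℝ) (m : ℕ) : ℝ :=
  ∑ σ with (M.opp σ ≠ none ∨ M.IsDirichlet ΓD σ), M.tau σ *
    (Real.log (1 + max (M.otherVal vD v (M.side σ) σ - threshold m) 0)
      - Real.log (1 + max (v (M.side σ) - threshold m) 0)) ^ 2

end Mesh

/-- The `L^∞(Ω)` norm (with the Euclidean norm on vector values). -/
def linftyNorm {p : ℕ} {F : Type*} [NormedAddCommGroup F] (Ω : Set (EuclideanSpace ℝ (Fin p)))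
    (g : EuclideanSpace ℝ (Fin p) → F) : ℝ :=
  (eLpNorm g ∞ (volume.restrict Ω)).toReal

/-- The assumptions on the function `B` of the scheme. -/
structure IsSchemeFunction (B : ℝ → ℝ) : Prop where
  lipschitz : ∃ C, LipschitzWith C B
  zero : B 0 = 1
  pos : ∀ s, 0 < B s
  sub_neg : ∀ s, B s - B (-s) = -s

/-- `β_U`, the infimum of `B(diam(Ω) x)` over `x ∈ [-‖U‖_∞, ‖U‖_∞]`. -/
def beta {p : ℕ} (Ω : Set (EuclideanSpace ℝ (Fin p)))
    (U : EuclideanSpace ℝ (Fin p) → EuclideanSpace ℝ (Fin p)) (B : ℝ → ℝ) : ℝ :=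
  sInf ((fun x => B (Metric.diam Ω * x)) '' Set.Icc (-linftyNorm Ω U) (linftyNorm Ω U))

end

end TPFA

/-!
The proof is De Giorgi's iteration on the superlevel sets `{v > C_m}`. It needs no Sobolev
embedding, only an isoperimetric inequality `|N|² ≤ C · Per(N)³` for unions of cells `N`, where
the perimeter `Mesh.perimeter` counts the edges inside the domain and the Dirichlet edges, and `C`
depends only on `Ω`, `ΓD` and `ΓN` (`exists_isoperimetric`).

*Isoperimetric inequality.* A segment from a cell of `N` to a cell outside of `N` crosses a common
edge of two such cells (`Mesh.mem_sweep_of_crossing`), except for a null set of segments. For a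
fixed vector `w`, the starting points `x` of the segments `[x, x + w]` which cross a given edge
form an oblique cylinder, of volume at most `‖w‖` times the measure of the edge (`volume_sweep`).
Integrating over `w` bounds the measure of the pairs of points separated by the boundary of `N`
(`Mesh.volume_inter_mul_le`). In a convex piece `P` of the domain, the pairs `(x, y)` with `y` in
the copy of `P` shrunk towards `x` by the factor `r` give `|N ∩ P| ≤ C · r · Per(N)`, as soon as
`N` fills at most half of each copy; the choice `r³ ∼ |N|` yields the inequality for small `N`.
For large `N` the linear inequality `|N| ≤ C · Per(N)` suffices. It follows by chaining balls
through the connected domain (`linked_of_convex`), starting from a cylinder with base on the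
Dirichlet boundary (`exists_dirichlet_collar`); the domain is a finite union of convex pieces up
to a null set, because its boundary lies in finitely many hyperplanes.

*Nonnegativity.* The scheme tested with the indicator function of `{v < 0}` shows that this set of
cells has no perimeter, hence it is empty.

*Upper bound.* The scheme tested with `a / (1 + a)`, `a = (v - C_m)⁺`, gives `β² E_m ≤ C (‖U‖² +
‖f‖) |{v > C_m}|` (`Mesh.IsSolution.energy_le`); the regularity constraint enters through `∑ m(σ)
d_σ ≤ C m(K)`, by comparison with the disjoint cones over the faces of `K`. The isoperimetric
inequality for all superlevel sets of `log (1 + a)`, combined with the coarea formula and the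
Cauchy-Schwarz inequality, gives `|{v > C_{m+1}}|⁴ ≤ C 64^m E_m³ |{v > C_m}|³`
(`Mesh.volume_region_succ_le`). If `E_1` is small, these two estimates force `|{v > C_m}| → 0`
geometrically, so that no cell satisfies `v > 2`.
-/

namespace TPFA

open Set Module

/-! ### Hyperplanes, oblique cylinders and cones -/

/-- The Euclidean space `ℝ^p`. -/
abbrev Pt (p : ℕ) := EuclideanSpace ℝ (Fin p)

variable {p : ℕ}

/-- The hyperplane `{x | ⟨ν, x⟩ = c}`. -/
def hyperplane (ν : Pt p) (c : ℝ) : Set (Pt p) := {x | inner ℝ ν x = c}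

/-- The set of the starting points `x` such that the segment `[x, x + w]` meets `S`. -/
def sweep (S : Set (Pt p)) (w : Pt p) : Set (Pt p) := {x | ∃ t ∈ Icc (0 : ℝ) 1, x + t • w ∈ S}

/-- The cone with apex `x₀` (excluded) and base `S`. -/
def cone (x₀ : Pt p) (S : Set (Pt p)) : Set (Pt p) :=
  {x | ∃ t ∈ Ioc (0 : ℝ) 1, ∃ y ∈ S, x = x₀ + t • (y - x₀)}

lemma isClosed_hyperplane (ν : Pt p) (c : ℝ) : IsClosed (hyperplane ν c) :=
  isClosed_eq (by fun_prop) (by fun_prop)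

lemma sweep_mono {S T : Set (Pt p)} (h : S ⊆ T) (w : Pt p) : sweep S w ⊆ sweep T w :=
  fun _ ⟨t, ht, hx⟩ => ⟨t, ht, h hx⟩

lemma volume_eq_lintegral_slices {ν : Pt p} (hν : ‖ν‖ = 1) {A : Set (Pt p)}
    (hA : MeasurableSet A) :
    volume A = ∫⁻ h : ℝ, surf p (A ∩ hyperplane ν h) := by
  have h0 : ν ≠ 0 := by rintro rfl; simp at hν
  have h := EuclideanGeometry.euclideanHausdorffMeasure_eq_lintegral (0 : Pt p) h0 hA
  rw [InnerProductSpace.euclideanHausdorffMeasure_eq_volume] at h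
  rw [h, enorm_eq_nnnorm, show ‖ν‖₊ = 1 from Subtype.ext hν]
  simp only [ENNReal.coe_one, one_mul, finrank_euclideanSpace, Fintype.card_fin]
  refine lintegral_congr fun t => ?_
  unfold surf
  congr 2
  ext x
  simp only [vadd_eq_add, add_zero, SetLike.mem_coe, AffineSubspace.mem_mk', vsub_eq_sub,
    Submodule.mem_orthogonal_singleton_iff_inner_right, hyperplane, mem_ofPred_eq, inner_sub_right,
    inner_smul_right, real_inner_self_eq_norm_sq, hν]
  constructor <;> intro h <;> linarith

lemma volume_hyperplane {ν : Pt p} (hν : ‖ν‖ = 1) (c : ℝ) : volume (hyperplane ν c) = 0 := by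
  rw [volume_eq_lintegral_slices hν (isClosed_hyperplane ν c).measurableSet,
    ← lintegral_zero (μ := (volume : Measure ℝ))]
  refine lintegral_congr_ae ?_
  filter_upwards [compl_mem_ae_iff.2 (Real.volume_singleton (a := c))] with h hh
  have : hyperplane ν c ∩ hyperplane ν h = ∅ := by
    ext x
    simp only [hyperplane, mem_inter_iff, mem_ofPred_eq, mem_empty_iff_false, iff_false, not_and]
    rintro rfl h'
    exact hh h'.symm
  simp [this]

/-- Sweeping a subset of a hyperplane along `w` produces an oblique cylinder. -/
lemma volume_sweep {ν : Pt p} (hν : ‖ν‖ = 1) {c : ℝ} {S : Set (Pt p)}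
    (hS : S ⊆ hyperplane ν c) (hSm : MeasurableSet S) (w : Pt p) :
    volume (sweep S w) = ENNReal.ofReal |inner ℝ ν w| * surf p S := by
  set k : ℝ := inner ℝ ν w with hk
  have key : ∀ x t, x + t • w ∈ S → inner ℝ ν x + t * k = c := by
    intro x t hx
    have := hS hx
    simpa [hyperplane, inner_add_right, inner_smul_right] using this
  by_cases hk0 : k = 0
  · rw [hk0]
    simp only [abs_zero, ENNReal.ofReal_zero, zero_mul]
    refine measure_mono_null ?_ (volume_hyperplane hν c)
    rintro x ⟨t, -, hx⟩
    have := key x t hx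
    rw [hk0] at this
    simpa [hyperplane] using this
  have hmeas : MeasurableSet (sweep S w) := by
    have : sweep S w = {x | (c - inner ℝ ν x) / k ∈ Icc (0 : ℝ) 1} ∩
        (fun x => x + ((c - inner ℝ ν x) / k) • w) ⁻¹' S := by
      ext x
      constructor
      · rintro ⟨t, ht, hx⟩
        have : (c - inner ℝ ν x) / k = t := by
          rw [div_eq_iff hk0]; linarith [key x t hx]
        simp only [mem_inter_iff, mem_ofPred_eq, mem_preimage, this]
        exact ⟨ht, hx⟩
      · rintro ⟨ht, hx⟩
        exact ⟨_, ht, hx⟩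
    rw [this]
    have h1 : Continuous fun x : Pt p => (c - inner ℝ ν x) / k := by fun_prop
    exact (h1.measurable measurableSet_Icc).inter
      ((by fun_prop : Continuous fun x : Pt p => x + ((c - inner ℝ ν x) / k) • w).measurable hSm)
  rw [volume_eq_lintegral_slices hν hmeas]
  have hslice : ∀ h : ℝ, surf p (sweep S w ∩ hyperplane ν h) =
      (uIcc (c - k) c).indicator (fun _ => surf p S) h := by
    intro h
    have hmem : h ∈ uIcc (c - k) c ↔ (c - h) / k ∈ Icc (0 : ℝ) 1 := by
      rcases lt_or_gt_of_ne hk0 with hneg | hpos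
      · rw [uIcc_of_ge (by linarith), mem_Icc, mem_Icc, le_div_iff_of_neg hneg,
          div_le_iff_of_neg hneg]
        constructor <;> rintro ⟨h1, h2⟩ <;> constructor <;> linarith
      · rw [uIcc_of_le (by linarith), mem_Icc, mem_Icc, le_div_iff₀ hpos, div_le_iff₀ hpos]
        constructor <;> rintro ⟨h1, h2⟩ <;> constructor <;> linarith
    by_cases hh : h ∈ uIcc (c - k) c
    · rw [indicator_of_mem hh]
      have : sweep S w ∩ hyperplane ν h = (fun x => x + ((c - h) / k) • w) ⁻¹' S := by
        ext x
        constructor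
        · rintro ⟨⟨t, ht, hx⟩, hx' : inner ℝ ν x = h⟩
          have : (c - h) / k = t := by
            rw [div_eq_iff hk0]; linarith [key x t hx]
          simpa only [mem_preimage, this] using hx
        · intro hx
          refine ⟨⟨_, hmem.1 hh, hx⟩, ?_⟩
          have := key x _ hx
          rw [div_mul_cancel₀ _ hk0] at this
          change inner ℝ ν x = h
          linarith
      rw [this]
      unfold surf
      exact measure_preimage_add_right _ _ _
    · rw [indicator_of_notMem hh]
      have : sweep S w ∩ hyperplane ν h = ∅ := by
        ext x
        simp only [mem_inter_iff, mem_empty_iff_false, iff_false, not_and]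
        rintro ⟨t, ht, hx⟩ (hx' : inner ℝ ν x = h)
        apply hh
        rw [hmem]
        have : (c - h) / k = t := by
          rw [div_eq_iff hk0]; linarith [key x t hx]
        rwa [this]
      simp [this]
  simp_rw [hslice]
  rw [lintegral_indicator measurableSet_uIcc, setLIntegral_const, Real.volume_interval, mul_comm,
    sub_sub_cancel]

lemma volume_sweep_le {ν : Pt p} (hν : ‖ν‖ = 1) {c : ℝ} {S : Set (Pt p)}
    (hS : S ⊆ hyperplane ν c) (hSm : MeasurableSet S) (w : Pt p) :
    volume (sweep S w) ≤ ENNReal.ofReal ‖w‖ * surf p S := by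
  rw [volume_sweep hν hS hSm]
  gcongr
  simpa [hν] using abs_real_inner_le_norm ν w

lemma surf_ne_top {ν : Pt p} (hν : ‖ν‖ = 1) {c : ℝ} {S : Set (Pt p)}
    (hS : S ⊆ hyperplane ν c) (hb : Bornology.IsBounded S) : surf p S ≠ ∞ := by
  have hb' : Bornology.IsBounded (closure S) := hb.closure
  have h := volume_sweep hν (closure_minimal hS (isClosed_hyperplane ν c))
    isClosed_closure.measurableSet ν
  rw [real_inner_self_eq_norm_sq, hν] at h
  simp only [one_pow, abs_one, ENNReal.ofReal_one, one_mul] at h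
  have h2 : Bornology.IsBounded (sweep (closure S) ν) := by
    obtain ⟨R, hR⟩ := hb'.exists_norm_le
    refine isBounded_iff_forall_norm_le.2 ⟨R + 1, ?_⟩
    rintro x ⟨t, ⟨ht0, ht1⟩, hx⟩
    have h3 := hR _ hx
    have h4 : ‖x‖ ≤ ‖x + t • ν‖ + ‖t • ν‖ := by
      simpa using norm_sub_le (x + t • ν) (t • ν)
    rw [norm_smul, hν, Real.norm_of_nonneg ht0] at h4
    linarith
  exact ((measure_mono subset_closure).trans_lt (h ▸ h2.measure_lt_top)).ne

/-- A surface null set in a hyperplane is hit by the segments `[x, x + w]` for almost no `x`. -/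
lemma volume_sweep_eq_zero {ν : Pt p} (hν : ‖ν‖ = 1) {c : ℝ} {S : Set (Pt p)}
    (hS : S ⊆ hyperplane ν c) (h0 : surf p S = 0) (w : Pt p) : volume (sweep S w) = 0 := by
  have hT : toMeasurable (surf p) S ∩ hyperplane ν c ⊆ hyperplane ν c := inter_subset_right
  refine measure_mono_null (sweep_mono (subset_inter (subset_toMeasurable (surf p) S) hS) w) ?_
  rw [volume_sweep hν hT ((measurableSet_toMeasurable _ _).inter
    (isClosed_hyperplane ν c).measurableSet),
    measure_mono_null inter_subset_left ((measure_toMeasurable S).trans h0), mul_zero]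

/-- A comparison of the volume of a cone with height times base; the constant `2 ^ p` is not
optimal. -/
lemma height_mul_surf_le_volume_cone {ν x₀ : Pt p} (hν : ‖ν‖ = 1) {h : ℝ} (hh : 0 < h)
    {S : Set (Pt p)} (hS : ∀ y ∈ S, inner ℝ ν (y - x₀) = h) (hSm : MeasurableSet S) :
    MeasurableSet (cone x₀ S) ∧
    ENNReal.ofReal h * surf p S ≤ 2 ^ p * volume (cone x₀ S) := by
  have hp : p ≠ 0 := by
    rintro rfl
    have : ν = 0 := Subsingleton.elim _ _
    simp [this] at hν
  have hmeas : MeasurableSet (cone x₀ S) := by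
    have : cone x₀ S = {x | inner ℝ ν (x - x₀) / h ∈ Ioc (0 : ℝ) 1} ∩
        (fun x => x₀ + (inner ℝ ν (x - x₀) / h)⁻¹ • (x - x₀)) ⁻¹' S := by
      ext x
      constructor
      · rintro ⟨t, ht, y, hy, rfl⟩
        have : inner ℝ ν (x₀ + t • (y - x₀) - x₀) / h = t := by
          rw [div_eq_iff hh.ne', add_sub_cancel_left, inner_smul_right, hS y hy]
        simp only [mem_inter_iff, mem_ofPred_eq, mem_preimage, this]
        refine ⟨ht, ?_⟩
        rwa [add_sub_cancel_left, smul_smul, inv_mul_cancel₀ ht.1.ne', one_smul,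
          add_sub_cancel]
      · rintro ⟨ht, hx⟩
        refine ⟨_, ht, _, hx, ?_⟩
        rw [add_sub_cancel_left, smul_smul, mul_inv_cancel₀ ht.1.ne', one_smul, add_sub_cancel]
    rw [this]
    have h1 : Continuous fun x : Pt p => inner ℝ ν (x - x₀) / h := by fun_prop
    have h2 : Measurable fun x : Pt p => x₀ + (inner ℝ ν (x - x₀) / h)⁻¹ • (x - x₀) := by
      have := h1.measurable.inv
      exact measurable_const.add (this.smul (measurable_id.sub_const _))
    exact (h1.measurable measurableSet_Ioc).inter (h2 hSm)
  refine ⟨hmeas, ?_⟩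
  rw [volume_eq_lintegral_slices hν hmeas]
  set a : ℝ := inner ℝ ν x₀ with ha
  have hslice : ∀ s ∈ Icc (a + h / 2) (a + h),
      (2 ^ (p - 1))⁻¹ * surf p S ≤ surf p (cone x₀ S ∩ hyperplane ν s) := by
    rintro s ⟨hs1, hs2⟩
    set t : ℝ := (s - a) / h with ht
    have ht1 : 1 / 2 ≤ t := by rw [ht, le_div_iff₀ hh]; linarith
    have ht2 : t ≤ 1 := by rw [ht, div_le_iff₀ hh]; linarith
    have hsub : AffineMap.homothety x₀ t '' S ⊆ cone x₀ S ∩ hyperplane ν s := by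
      rintro _ ⟨y, hy, rfl⟩
      rw [AffineMap.homothety_apply, vsub_eq_sub, vadd_eq_add]
      refine ⟨⟨t, ⟨by linarith, ht2⟩, y, hy, by rw [add_comm]⟩, ?_⟩
      have := hS y hy
      simp only [hyperplane, mem_ofPred_eq, inner_add_right, inner_smul_right, this]
      rw [ht, div_mul_cancel₀ _ hh.ne', ← ha]; ring
    refine le_trans ?_ (measure_mono hsub)
    unfold surf
    rw [euclideanHausdorffMeasure_homothety_image _ _ (by linarith : t ≠ 0),
      ENNReal.smul_def, smul_eq_mul]
    gcongr
    rw [ENNReal.inv_pow, ENNReal.coe_pow]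
    gcongr
    rw [← enorm_eq_nnnorm, Real.enorm_of_nonneg (by linarith),
      ← ENNReal.ofReal_ofNat 2, ← ENNReal.ofReal_inv_of_pos two_pos]
    exact ENNReal.ofReal_le_ofReal (by linarith)
  have hint : ∫⁻ _ in Icc (a + h / 2) (a + h), (2 ^ (p - 1))⁻¹ * surf p S ≤
      ∫⁻ s : ℝ, surf p (cone x₀ S ∩ hyperplane ν s) :=
    (setLIntegral_mono' measurableSet_Icc hslice).trans (setLIntegral_le_lintegral _ _)
  rw [setLIntegral_const, Real.volume_Icc, show a + h - (a + h / 2) = h / 2 by ring] at hint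
  refine le_trans (le_of_eq ?_) (mul_le_mul_right hint _)
  obtain ⟨q, rfl⟩ := Nat.exists_eq_succ_of_ne_zero hp
  simp only [Nat.succ_eq_add_one, Nat.add_sub_cancel]
  rw [pow_succ, ENNReal.ofReal_div_of_pos two_pos, ENNReal.ofReal_ofNat]
  calc ENNReal.ofReal h * surf (q + 1) S
      = (2 ^ q * (2 ^ q)⁻¹) * (2 * 2⁻¹) * (ENNReal.ofReal h * surf (q + 1) S) := by
        rw [ENNReal.mul_inv_cancel (by simp) (by simp),
          ENNReal.mul_inv_cancel (by simp) (by simp), one_mul, one_mul]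
    _ = _ := by rw [div_eq_mul_inv]; ring

/-- A subset of positive surface measure of a hyperplane spans that hyperplane. -/
lemma affineSpan_eq_hyperplane {ν : Pt p} (hν : ‖ν‖ = 1) {c : ℝ} {S : Set (Pt p)}
    (hS : S ⊆ hyperplane ν c) (hpos : surf p S ≠ 0) :
    (affineSpan ℝ S : Set (Pt p)) = hyperplane ν c := by
  obtain ⟨s, hs⟩ : S.Nonempty := by
    rw [nonempty_iff_ne_empty]; rintro rfl; simp at hpos
  set D := (affineSpan ℝ S).direction with hD
  have hsS : s ∈ affineSpan ℝ S := subset_affineSpan ℝ S hs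
  have hDν : ∀ d ∈ D, inner ℝ ν d = 0 := by
    intro d hd
    rw [hD, direction_affineSpan, vectorSpan_def] at hd
    induction hd using Submodule.span_induction with
    | mem x hx =>
      obtain ⟨a, ha, b, hb, rfl⟩ := hx
      have h1 : inner ℝ ν a = c := hS ha
      have h2 : inner ℝ ν b = c := hS hb
      simp [inner_sub_right, h1, h2]
    | zero => simp
    | add x y _ _ h1 h2 => rw [inner_add_right, h1, h2, add_zero]
    | smul a x _ h => rw [inner_smul_right, h, mul_zero]
  have hsc : inner ℝ ν s = c := hS hs
  apply Subset.antisymm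
  · intro x hx
    have := hDν _ (AffineSubspace.vsub_mem_direction hx hsS)
    rw [vsub_eq_sub, inner_sub_right, hsc] at this
    change inner ℝ ν x = c
    linarith
  · intro y hy
    by_contra hyS
    have hyD : y - s ∉ D := by
      intro h
      apply hyS
      have := AffineSubspace.vadd_mem_of_mem_direction h hsS
      simpa using this
    -- `μ` is a second normal to `S`, orthogonal to `ν`
    set μ : Pt p := (y - s) - D.starProjection (y - s) with hμ
    have hμD : ∀ d ∈ D, inner ℝ μ d = 0 := fun d hd => by
      rw [real_inner_comm]
      exact (Submodule.mem_orthogonal _ _).1 (D.sub_starProjection_mem_orthogonal (y - s)) d hd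
    have hμ0 : μ ≠ 0 := by
      intro h
      rw [hμ, sub_eq_zero] at h
      exact hyD (h ▸ D.starProjection_apply_mem _)
    have hνμ : inner ℝ ν μ = 0 := by
      rw [hμ, inner_sub_right, hDν _ (D.starProjection_apply_mem _), inner_sub_right, hsc,
        show inner ℝ ν y = c from hy]
      simp
    set μ' : Pt p := (‖μ‖⁻¹ : ℝ) • μ with hμ'
    have hn : ‖μ'‖ = 1 := by
      rw [hμ', norm_smul, norm_inv, norm_norm, inv_mul_cancel₀ (norm_ne_zero_iff.2 hμ0)]
    have hS' : S ⊆ hyperplane μ' (inner ℝ μ' s) := by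
      intro x hx
      have := hμD _ (AffineSubspace.vsub_mem_direction (subset_affineSpan ℝ S hx) hsS)
      rw [vsub_eq_sub, inner_sub_right] at this
      simp only [hyperplane, mem_ofPred_eq, hμ', inner_smul_left]
      congr 1
      linarith
    apply hpos
    have hcl := closure_minimal hS (isClosed_hyperplane ν c)
    have hcl' := closure_minimal hS' (isClosed_hyperplane _ _)
    have h1 := volume_sweep hν hcl isClosed_closure.measurableSet ν
    have h2 := volume_sweep hn hcl' isClosed_closure.measurableSet ν
    rw [h1, hμ', inner_smul_left, real_inner_comm ν μ, hνμ, real_inner_self_eq_norm_sq, hν] at h2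
    simp only [one_pow, abs_one, ENNReal.ofReal_one, one_mul, mul_zero, abs_zero,
      ENNReal.ofReal_zero, zero_mul] at h2
    exact measure_mono_null subset_closure h2

lemma infDist_hyperplane_le {ν : Pt p} (hν : ‖ν‖ = 1) (c : ℝ) (x : Pt p) :
    Metric.infDist x (hyperplane ν c) ≤ |c - inner ℝ ν x| := by
  have hmem : x + (c - inner ℝ ν x) • ν ∈ hyperplane ν c := by
    simp [hyperplane, inner_add_right, inner_smul_right, hν]
  refine (Metric.infDist_le_dist_of_mem hmem).trans ?_
  rw [dist_eq_norm]
  simp [norm_smul, hν]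

/-- If a closed convex set contains a relative neighbourhood of `y` in a hyperplane, and a point
`k` below this hyperplane, then it contains a half ball around `y`. -/
lemma eventually_mem_of_convex {C : Set (Pt p)} (hC : Convex ℝ C) {ν y k : Pt p}
    (hy : ∀ᶠ q in nhds y, inner ℝ ν (q - y) = 0 → q ∈ C) (hk : k ∈ C)
    (hneg : inner ℝ ν (k - y) < 0) :
    ∀ᶠ z in nhds y, inner ℝ ν (z - y) ≤ 0 → z ∈ C := by
  set t : Pt p → ℝ := fun z => inner ℝ ν (z - y) / inner ℝ ν (k - y) with ht
  have htc : Continuous t := by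
    have : Continuous fun z : Pt p => inner ℝ ν (z - y) := by fun_prop
    exact this.div_const _
  have hty : t y = 0 := by simp [ht]
  have h1 : ∀ᶠ z in nhds y, t z < 1 :=
    htc.continuousAt.eventually_lt continuousAt_const (by rw [hty]; norm_num)
  set q : Pt p → Pt p := fun z => (1 - t z)⁻¹ • (z - t z • k) with hq
  have hqc : ContinuousAt q y := by
    have : ContinuousAt (fun z => (1 - t z)⁻¹) y :=
      (continuousAt_const.sub htc.continuousAt).inv₀ (by simp [hty])
    exact this.smul (by fun_prop)
  have hqy : q y = y := by simp [hq, hty]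
  have h2 : ∀ᶠ z in nhds y, inner ℝ ν (q z - y) = 0 → q z ∈ C := by
    have := hqc.tendsto
    rw [hqy] at this
    exact this.eventually hy
  filter_upwards [h1, h2] with z hz1 hz2 hz
  have ht0 : 0 ≤ t z := div_nonneg_of_nonpos hz hneg.le
  have hne : (1 - t z) ≠ 0 := by linarith
  have hzq : z = (1 - t z) • q z + t z • k := by
    rw [hq]; simp only
    rw [smul_smul, mul_inv_cancel₀ hne, one_smul, sub_add_cancel]
  have hqz : inner ℝ ν (q z - y) = 0 := by
    have e1 : inner ℝ ν (z - y) = (1 - t z) * inner ℝ ν (q z - y) + t z * inner ℝ ν (k - y) := by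
      have : z - y = (1 - t z) • (q z - y) + t z • (k - y) := by
        conv_lhs => rw [hzq]
        module
      rw [this, inner_add_right, inner_smul_right, inner_smul_right]
    have e2 : t z * inner ℝ ν (k - y) = inner ℝ ν (z - y) := by
      simp only [ht]; rw [div_mul_cancel₀ _ hneg.ne]
    have e3 : (1 - t z) * inner ℝ ν (q z - y) = 0 := by linarith
    exact (mul_eq_zero.1 e3).resolve_left hne
  rw [hzq]
  exact hC (hz2 hqz) hk (by linarith) ht0 (by ring)

/-- The intersection of the closures of two disjoint nonempty open convex sets lies in a
hyperplane. -/
lemma exists_hyperplane_of_disjoint {A B : Set (Pt p)} (hA : IsOpen A) (hB : IsOpen B)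
    (hAc : Convex ℝ A) (hBc : Convex ℝ B) (hAn : A.Nonempty) (hBn : B.Nonempty)
    (hd : Disjoint A B) :
    ∃ ν : Pt p, ∃ c : ℝ, ‖ν‖ = 1 ∧ closure A ∩ closure B ⊆ hyperplane ν c := by
  obtain ⟨f, u, hf, hg⟩ := geometric_hahn_banach_open_open hAc hA hBc hB hd
  set μ := (InnerProductSpace.toDual ℝ (Pt p)).symm f with hμ
  have hμf : ∀ x, inner ℝ μ x = f x := fun x => by
    rw [hμ, InnerProductSpace.toDual_symm_apply]
  have hμ0 : μ ≠ 0 := by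
    intro h
    obtain ⟨a, ha⟩ := hAn
    obtain ⟨b, hb⟩ := hBn
    have h1 := hf a ha
    have h2 := hg b hb
    rw [← hμf, h, inner_zero_left] at h1 h2
    linarith
  refine ⟨(‖μ‖⁻¹ : ℝ) • μ, ‖μ‖⁻¹ * u, ?_, ?_⟩
  · rw [norm_smul, norm_inv, norm_norm, inv_mul_cancel₀ (norm_ne_zero_iff.2 hμ0)]
  · rintro x ⟨hxA, hxB⟩
    have h1 : f x ≤ u := closure_minimal (fun a ha => (hf a ha).le)
      (isClosed_le f.continuous continuous_const) hxA
    have h2 : u ≤ f x := closure_minimal (fun a ha => (hg a ha).le)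
      (isClosed_le continuous_const f.continuous) hxB
    simp only [hyperplane, mem_ofPred_eq, inner_smul_left, hμf]
    rw [le_antisymm h1 h2]
    simp

/-! ### Cells, faces and normals of an admissible mesh -/

namespace Mesh

variable {M : Mesh p} {Ω : Set (Pt p)}

lemma mem_edges {K : M.Cell} {σ : M.Edge} :
    σ ∈ M.edges K ↔ M.side σ = K ∨ M.opp σ = some K := by
  simp [edges]

lemma side_mem_edges (σ : M.Edge) : σ ∈ M.edges (M.side σ) := mem_edges.2 (Or.inl rfl)

lemma opp_mem_edges {σ : M.Edge} {L : M.Cell} (h : M.opp σ = some L) : σ ∈ M.edges L :=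
  mem_edges.2 (Or.inr h)

namespace IsAdmissible

lemma face_nonempty (hM : M.IsAdmissible Ω) (σ : M.Edge) : (M.face σ).Nonempty := by
  rw [nonempty_iff_ne_empty]
  intro h
  have := hM.face_pos σ
  simp [h] at this

lemma measurableSet_face (hM : M.IsAdmissible Ω) (σ : M.Edge) : MeasurableSet (M.face σ) := by
  obtain ⟨O, hO, h⟩ := hM.face_isOpen σ
  rw [h]
  exact hO.measurableSet.inter (AffineSubspace.closed_of_finiteDimensional _).measurableSet

lemma face_subset_hyperplane (hM : M.IsAdmissible Ω) {K : M.Cell} {σ : M.Edge}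
    (hσ : σ ∈ M.edges K) {y : Pt p} (hy : y ∈ M.face σ) :
    M.face σ ⊆ hyperplane (M.normal K σ) (inner ℝ (M.normal K σ) y) := by
  intro x hx
  have := hM.normal_orth K σ hσ x hx y hy
  rw [inner_sub_right] at this
  change inner ℝ _ x = _
  linarith

lemma closure_face_subset_hyperplane (hM : M.IsAdmissible Ω) {K : M.Cell} {σ : M.Edge}
    (hσ : σ ∈ M.edges K) {y : Pt p} (hy : y ∈ M.face σ) :
    closure (M.face σ) ⊆ hyperplane (M.normal K σ) (inner ℝ (M.normal K σ) y) :=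
  closure_minimal (hM.face_subset_hyperplane hσ hy) (isClosed_hyperplane _ _)

lemma affineSpan_face (hM : M.IsAdmissible Ω) {K : M.Cell} {σ : M.Edge}
    (hσ : σ ∈ M.edges K) {y : Pt p} (hy : y ∈ M.face σ) :
    (affineSpan ℝ (M.face σ) : Set (Pt p)) =
      hyperplane (M.normal K σ) (inner ℝ (M.normal K σ) y) :=
  affineSpan_eq_hyperplane (hM.normal_norm K σ hσ) (hM.face_subset_hyperplane hσ hy)
    (hM.face_pos σ).ne'

lemma closure_face_subset (hM : M.IsAdmissible Ω) {K : M.Cell} {σ : M.Edge}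
    (hσ : σ ∈ M.edges K) : closure (M.face σ) ⊆ closure (M.vol K) := by
  refine Subset.trans ?_ frontier_subset_closure
  rw [hM.frontier_vol K]
  exact subset_biUnion_of_mem (u := fun σ => closure (M.face σ)) hσ

lemma face_subset (hM : M.IsAdmissible Ω) {K : M.Cell} {σ : M.Edge}
    (hσ : σ ∈ M.edges K) : M.face σ ⊆ closure (M.vol K) :=
  subset_closure.trans (hM.closure_face_subset hσ)

lemma inner_normal_nonpos (hM : M.IsAdmissible Ω) {K : M.Cell} {σ : M.Edge}
    (hσ : σ ∈ M.edges K) {x y : Pt p} (hx : x ∈ closure (M.vol K)) (hy : y ∈ M.face σ) :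
    inner ℝ (M.normal K σ) (x - y) ≤ 0 :=
  closure_minimal (fun x hx => hM.normal_outward K σ hσ x hx y hy)
    (isClosed_le (f := fun x => inner ℝ (M.normal K σ) (x - y)) (by fun_prop) continuous_const) hx

lemma inner_normal_neg (hM : M.IsAdmissible Ω) {K : M.Cell} {σ : M.Edge}
    (hσ : σ ∈ M.edges K) {x y : Pt p} (hx : x ∈ M.vol K) (hy : y ∈ M.face σ) :
    inner ℝ (M.normal K σ) (x - y) < 0 := by
  have hn := hM.normal_norm K σ hσ
  have hc : ContinuousAt (fun t : ℝ => x + t • M.normal K σ) 0 := by fun_prop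
  have h1 : ∀ᶠ t : ℝ in nhds 0, x + t • M.normal K σ ∈ M.vol K :=
    hc.eventually (by simpa using (hM.vol_isOpen K).mem_nhds hx)
  obtain ⟨ε, hε, h2⟩ := Metric.eventually_nhds_iff.1 h1
  have h3 := hM.normal_outward K σ hσ _ (h2 (y := ε / 2) (by
    rw [Real.dist_eq, sub_zero, abs_of_pos (by linarith)]; linarith)) y hy
  rw [add_sub_right_comm, inner_add_right, inner_smul_right, real_inner_self_eq_norm_sq, hn] at h3
  linarith

lemma volume_inter_closure (hM : M.IsAdmissible Ω) (hp : 0 < p) {K L : M.Cell} (hKL : K ≠ L) :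
    volume (closure (M.vol K) ∩ closure (M.vol L)) = 0 := by
  have aux : ∀ σ K L, M.side σ = K → M.opp σ = some L →
      volume (closure (M.vol K) ∩ closure (M.vol L)) = 0 := by
    rintro σ K L rfl h
    rw [(hM.interior_edge σ L h).2]
    obtain ⟨y, hy⟩ := hM.face_nonempty σ
    exact measure_mono_null (hM.closure_face_subset_hyperplane (side_mem_edges σ) hy)
      (volume_hyperplane (hM.normal_norm _ _ (side_mem_edges σ)) _)
  rcases hM.inter K L hKL with h | ⟨σ, ⟨h1, h2⟩ | ⟨h1, h2⟩⟩
  · have hν : ‖(EuclideanSpace.single ⟨0, hp⟩ (1 : ℝ) : Pt p)‖ = 1 := by simp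
    rw [volume_eq_lintegral_slices hν (isClosed_closure.inter isClosed_closure).measurableSet,
      ← lintegral_zero (μ := (volume : Measure ℝ))]
    exact lintegral_congr fun t => measure_mono_null inter_subset_left h
  · exact aux σ K L h1 h2
  · rw [inter_comm]; exact aux σ L K h1 h2

lemma disjoint_vol (hM : M.IsAdmissible Ω) (hp : 0 < p) {K L : M.Cell} (hKL : K ≠ L) :
    Disjoint (M.vol K) (M.vol L) := by
  rw [disjoint_iff_inter_eq_empty]
  refine ((hM.vol_isOpen K).inter (hM.vol_isOpen L)).eq_empty_of_measure_zero
    (μ := volume) (measure_mono_null ?_ (hM.volume_inter_closure hp hKL))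
  exact inter_subset_inter subset_closure subset_closure

/-- A cell contains a half ball around each point of its faces. -/
lemma eventually_mem_closure_vol (hM : M.IsAdmissible Ω) {K : M.Cell} {σ : M.Edge}
    (hσ : σ ∈ M.edges K) {y : Pt p} (hy : y ∈ M.face σ) :
    ∀ᶠ z in nhds y, inner ℝ (M.normal K σ) (z - y) ≤ 0 → z ∈ closure (M.vol K) := by
  obtain ⟨k, hk⟩ := hM.vol_nonempty K
  refine eventually_mem_of_convex (hM.vol_convex K).closure ?_ (subset_closure hk)
    (hM.inner_normal_neg hσ hk hy)
  obtain ⟨O, hO, h⟩ := hM.face_isOpen σ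
  have hyO : y ∈ O := by rw [h] at hy; exact hy.1
  filter_upwards [hO.mem_nhds hyO] with q hq hqy
  apply hM.face_subset hσ
  rw [h, hM.affineSpan_face hσ hy]
  refine ⟨hq, ?_⟩
  rw [inner_sub_right] at hqy
  change inner ℝ _ q = _
  linarith

lemma normal_opp (hM : M.IsAdmissible Ω) (hp : 0 < p) {σ : M.Edge} {L : M.Cell}
    (h : M.opp σ = some L) : M.normal L σ = -M.normal (M.side σ) σ := by
  have hs := side_mem_edges σ
  have hL := opp_mem_edges h
  set n := M.normal (M.side σ) σ with hn
  set n' := M.normal L σ with hn'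
  have e1 : ‖n‖ = 1 := hM.normal_norm _ _ hs
  have e2 : ‖n'‖ = 1 := hM.normal_norm _ _ hL
  obtain ⟨y, hy⟩ := hM.face_nonempty σ
  -- both hyperplanes are spanned by the face, so that the normals are parallel
  have hH := (hM.affineSpan_face hs hy).symm.trans (hM.affineSpan_face hL hy)
  rw [← hn, ← hn'] at hH
  set a : ℝ := inner ℝ n n' with ha
  have hmem : y + (n' - a • n) ∈ hyperplane n (inner ℝ n y) := by
    simp [hyperplane, inner_add_right, inner_sub_right, inner_smul_right, e1, ← ha]
  rw [hH] at hmem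
  have ha2 : a * a = 1 := by
    have : inner ℝ n' (y + (n' - a • n)) = inner ℝ n' y := hmem
    rw [inner_add_right, inner_sub_right, inner_smul_right, real_inner_self_eq_norm_sq, e2,
      real_inner_comm n n', ← ha] at this
    linarith
  have hpar : n' = a • n := by
    rw [← sub_eq_zero, ← norm_eq_zero, ← sq_eq_zero_iff, norm_sub_sq_real, norm_smul, e1, e2,
      inner_smul_right, real_inner_comm n n', ← ha, mul_one, Real.norm_eq_abs, sq_abs]
    linarith
  rcases mul_self_eq_one_iff.1 ha2 with h1 | h1
  · exfalso
    -- otherwise both cells contain the same half ball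
    rw [h1, one_smul] at hpar
    have hb1 := hM.eventually_mem_closure_vol hs hy
    have hb2 := hM.eventually_mem_closure_vol hL hy
    rw [← hn', hpar] at hb2
    obtain ⟨ε, hε, hball⟩ := Metric.eventually_nhds_iff_ball.1 (hb1.and hb2)
    have hopen : IsOpen (Metric.ball y ε ∩ {z | inner ℝ n (z - y) < 0}) :=
      Metric.isOpen_ball.inter (isOpen_lt (by fun_prop) continuous_const)
    have hne := (hM.interior_edge σ L h).1
    have hnull := hopen.eq_empty_of_measure_zero (μ := volume)
      (measure_mono_null (t := closure (M.vol (M.side σ)) ∩ closure (M.vol L))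
        (fun z hz => ⟨(hball z hz.1).1 (le_of_lt hz.2), (hball z hz.1).2 (le_of_lt hz.2)⟩)
        (hM.volume_inter_closure hp hne.symm))
    have : y - (ε / 2) • n ∈ (∅ : Set (Pt p)) := by
      rw [← hnull]
      constructor
      · rw [Metric.mem_ball, dist_eq_norm]
        simp [norm_smul, e1, abs_of_pos hε]
        linarith
      · simp [inner_smul_right, e1]
        linarith
    exact this
  · rw [hpar, h1, neg_one_smul]

/-- An interior face does not touch the boundary of the domain, except by its relative boundary. -/
lemma face_subset_interior (hM : M.IsAdmissible Ω) (hp : 0 < p) {σ : M.Edge} {L : M.Cell}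
    (h : M.opp σ = some L) : M.face σ ⊆ interior (closure Ω) := by
  intro y hy
  rw [mem_interior_iff_mem_nhds]
  have hcl : ∀ K, closure (M.vol K) ⊆ closure Ω := fun K => closure_mono (hM.vol_subset K)
  filter_upwards [hM.eventually_mem_closure_vol (side_mem_edges σ) hy,
    hM.eventually_mem_closure_vol (opp_mem_edges h) hy] with z h1 h2
  rw [hM.normal_opp hp h, inner_neg_left] at h2
  rcases le_total (inner ℝ (M.normal (M.side σ) σ) (z - y)) 0 with h3 | h3
  · exact hcl _ (h1 h3)
  · exact hcl _ (h2 (by linarith))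

lemma iUnion_closure_vol (hM : M.IsAdmissible Ω) : ⋃ K, closure (M.vol K) = closure Ω := by
  rw [← hM.closure_iUnion, closure_iUnion_of_finite]

lemma volume_closure_vol_diff (hM : M.IsAdmissible Ω) (K : M.Cell) :
    volume (closure (M.vol K) \ M.vol K) = 0 := by
  rw [← (hM.vol_isOpen K).frontier_eq]
  exact (hM.vol_convex K).addHaar_frontier volume

lemma volume_diff_iUnion (hM : M.IsAdmissible Ω) : volume (closure Ω \ ⋃ K, M.vol K) = 0 := by
  rw [← hM.iUnion_closure_vol]
  refine measure_mono_null (t := ⋃ K, closure (M.vol K) \ M.vol K) ?_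
    (measure_iUnion_null hM.volume_closure_vol_diff)
  rintro x ⟨hx, hx'⟩
  obtain ⟨K, hK⟩ := mem_iUnion.1 hx
  exact mem_iUnion.2 ⟨K, hK, fun h => hx' (mem_iUnion.2 ⟨K, h⟩)⟩

end IsAdmissible

end Mesh

/-! ### Perimeter of a union of cells and crossing segments -/

namespace Mesh

variable {M : Mesh p} {Ω ΓD ΓN : Set (Pt p)}

/-- The union of the cells in `S`. -/
def region (M : Mesh p) (S : Set M.Cell) : Set (Pt p) := ⋃ K ∈ S, M.vol K

open Classical in
/-- The measure of the part of the boundary of `region S` which lies inside the domain: the edges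
`K|L` with exactly one of `K`, `L` in `S`. -/
noncomputable def innerPerimeter (M : Mesh p) (S : Set M.Cell) : ℝ :=
  ∑ σ with (∃ L, M.opp σ = some L ∧ ¬(M.side σ ∈ S ↔ L ∈ S)), M.faceMeas σ

open Classical in
/-- The measure of the part of the boundary of `region S` which lies inside the domain or on
Dirichlet edges. -/
noncomputable def perimeter (M : Mesh p) (ΓD : Set (Pt p)) (S : Set M.Cell) : ℝ :=
  ∑ σ with ((∃ L, M.opp σ = some L ∧ ¬(M.side σ ∈ S ↔ L ∈ S)) ∨
    (M.IsDirichlet ΓD σ ∧ M.side σ ∈ S)), M.faceMeas σ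

lemma faceMeas_nonneg (σ : M.Edge) : 0 ≤ M.faceMeas σ := measureReal_nonneg

lemma innerPerimeter_nonneg (S : Set M.Cell) : 0 ≤ M.innerPerimeter S :=
  Finset.sum_nonneg fun _ _ => faceMeas_nonneg _

lemma perimeter_nonneg (S : Set M.Cell) : 0 ≤ M.perimeter ΓD S :=
  Finset.sum_nonneg fun _ _ => faceMeas_nonneg _

lemma innerPerimeter_le_perimeter (S : Set M.Cell) :
    M.innerPerimeter S ≤ M.perimeter ΓD S := by
  classical
  refine Finset.sum_le_sum_of_subset_of_nonneg ?_ fun _ _ _ => faceMeas_nonneg _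
  intro σ hσ
  simp only [Finset.mem_filter, Finset.mem_univ, true_and] at hσ ⊢
  exact Or.inl hσ

lemma sweep_smul_subset (A : Set (Pt p)) (w : Pt p) {t : ℝ} (ht : t ∈ Icc (0 : ℝ) 1) :
    sweep A (t • w) ⊆ sweep A w := by
  rintro x ⟨s, hs, hx⟩
  exact ⟨s * t, ⟨mul_nonneg hs.1 ht.1, mul_le_one₀ hs.2 ht.1 ht.2⟩, by rwa [mul_smul]⟩

/-- The starting points `x` of the segments `[x, x + w]` which pass through the intersection of two
closed cells when this intersection is a null set for the surface measure. -/
def exceptional (M : Mesh p) (w : Pt p) : Set (Pt p) :=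
  ⋃ (K : M.Cell) (L : M.Cell)
    (_ : K ≠ L ∧ surf p (closure (M.vol K) ∩ closure (M.vol L)) = 0),
    sweep (closure (M.vol K) ∩ closure (M.vol L)) w

lemma isOpen_region (hM : M.IsAdmissible Ω) (S : Set M.Cell) : IsOpen (M.region S) :=
  isOpen_biUnion fun K _ => hM.vol_isOpen K

lemma region_subset (hM : M.IsAdmissible Ω) (S : Set M.Cell) : M.region S ⊆ Ω :=
  iUnion₂_subset fun K _ => hM.vol_subset K

lemma region_union_compl (S : Set M.Cell) : M.region S ∪ M.region Sᶜ = ⋃ K, M.vol K := by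
  ext x
  simp only [region, mem_union, mem_iUnion, mem_compl_iff, exists_prop]
  constructor
  · rintro (⟨K, -, h⟩ | ⟨K, -, h⟩) <;> exact ⟨K, h⟩
  · rintro ⟨K, h⟩
    by_cases hK : K ∈ S
    exacts [Or.inl ⟨K, hK, h⟩, Or.inr ⟨K, hK, h⟩]

/-- Up to a null set, a subset of the domain is covered by the cells in `S` and in `Sᶜ`. -/
lemma volume_le_add (hM : M.IsAdmissible Ω) (S : Set M.Cell) {A : Set (Pt p)}
    (hA : A ⊆ closure Ω) :
    volume A ≤ volume (A ∩ M.region S) + volume (A ∩ M.region Sᶜ) := by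
  calc volume A ≤ volume ((A ∩ M.region S) ∪ (A ∩ M.region Sᶜ) ∪
        (closure Ω \ ⋃ K, M.vol K)) := by
        apply measure_mono
        intro x hx
        by_cases h : x ∈ ⋃ K, M.vol K
        · rw [← region_union_compl S] at h
          rcases h with h | h
          exacts [Or.inl (Or.inl ⟨hx, h⟩), Or.inl (Or.inr ⟨hx, h⟩)]
        · exact Or.inr ⟨hA hx, h⟩
    _ ≤ _ := by
        refine (measure_union_le _ _).trans ?_
        rw [hM.volume_diff_iUnion, add_zero]
        exact measure_union_le _ _

lemma volume_exceptional (hM : M.IsAdmissible Ω) (hp : 0 < p) (w : Pt p) :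
    volume (M.exceptional w) = 0 := by
  refine measure_iUnion_null fun K => measure_iUnion_null fun L =>
    measure_iUnion_null fun ⟨hKL, h0⟩ => ?_
  obtain ⟨ν, c, hν, hsub⟩ := exists_hyperplane_of_disjoint (hM.vol_isOpen K) (hM.vol_isOpen L)
    (hM.vol_convex K) (hM.vol_convex L) (hM.vol_nonempty K) (hM.vol_nonempty L)
    (hM.disjoint_vol hp hKL)
  exact volume_sweep_eq_zero hν hsub h0 w

/-- A segment which starts in a cell of `S` and meets a cell outside of `S` crosses the boundary of
`region S`. -/
lemma mem_sweep_of_crossing (hM : M.IsAdmissible Ω) {S : Set M.Cell} {x w : Pt p}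
    (hx : x ∈ M.region S) (hseg : ∀ t ∈ Icc (0 : ℝ) 1, x + t • w ∈ closure Ω)
    (hcross : ∃ t ∈ Icc (0 : ℝ) 1, ∃ L ∉ S, x + t • w ∈ closure (M.vol L)) :
    x ∈ M.exceptional w ∨ ∃ σ, (∃ L, M.opp σ = some L ∧ ¬(M.side σ ∈ S ↔ L ∈ S)) ∧
      x ∈ sweep (closure (M.face σ)) w := by
  set A : Set (Pt p) := ⋃ K ∈ S, closure (M.vol K) with hA
  set B : Set (Pt p) := ⋃ K ∈ Sᶜ, closure (M.vol K) with hB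
  have hAc : IsClosed A := S.toFinite.isClosed_biUnion fun _ _ => isClosed_closure
  have hBc : IsClosed B := (Sᶜ).toFinite.isClosed_biUnion fun _ _ => isClosed_closure
  set γ : ℝ → Pt p := fun t => x + t • w with hγ
  have hγc : Continuous γ := by fun_prop
  have hpre : IsPreconnected (γ '' Icc (0 : ℝ) 1) :=
    isPreconnected_Icc.image _ hγc.continuousOn
  have hcov : γ '' Icc (0 : ℝ) 1 ⊆ A ∪ B := by
    rintro _ ⟨t, ht, rfl⟩
    have h := hseg t ht
    rw [← hM.iUnion_closure_vol] at h
    obtain ⟨K, hK⟩ := mem_iUnion.1 h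
    by_cases hKS : K ∈ S
    · exact Or.inl (mem_biUnion hKS hK)
    · exact Or.inr (mem_biUnion (show K ∈ Sᶜ from hKS) hK)
  have h1 : (γ '' Icc (0 : ℝ) 1 ∩ A).Nonempty := by
    obtain ⟨K, hKS, hK⟩ := mem_iUnion₂.1 hx
    refine ⟨γ 0, ⟨0, by simp, rfl⟩, mem_biUnion hKS ?_⟩
    simpa [hγ] using subset_closure hK
  have h2 : (γ '' Icc (0 : ℝ) 1 ∩ B).Nonempty := by
    obtain ⟨t, ht, L, hL, h⟩ := hcross
    exact ⟨γ t, ⟨t, ht, rfl⟩, mem_biUnion (show L ∈ Sᶜ from hL) h⟩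
  obtain ⟨_, ⟨t, ht, rfl⟩, hzA, hzB⟩ := isPreconnected_closed_iff.1 hpre A B hAc hBc hcov h1 h2
  obtain ⟨K, hKS, hK⟩ := mem_iUnion₂.1 hzA
  obtain ⟨L, hLS, hL⟩ := mem_iUnion₂.1 hzB
  have hLS' : L ∉ S := hLS
  have hKL : K ≠ L := by rintro rfl; exact hLS hKS
  rcases hM.inter K L hKL with h | ⟨σ, ⟨h1, h2⟩ | ⟨h1, h2⟩⟩
  · left
    exact mem_iUnion.2 ⟨K, mem_iUnion.2 ⟨L, mem_iUnion.2 ⟨⟨hKL, h⟩, t, ht, hK, hL⟩⟩⟩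
  · right
    have he := (hM.interior_edge σ L h2).2
    rw [h1] at he
    refine ⟨σ, ⟨L, h2, ?_⟩, t, ht, ?_⟩
    · rw [h1]; tauto
    · rw [← he]; exact ⟨hK, hL⟩
  · right
    have he := (hM.interior_edge σ K h2).2
    rw [h1] at he
    refine ⟨σ, ⟨K, h2, ?_⟩, t, ht, ?_⟩
    · rw [h1]; tauto
    · rw [← he]; exact ⟨hL, hK⟩

lemma surf_closure_face (hM : M.IsAdmissible Ω) (hΩ : Bornology.IsBounded Ω) (σ : M.Edge) :
    surf p (closure (M.face σ)) = ENNReal.ofReal (M.faceMeas σ) := by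
  obtain ⟨y, hy⟩ := hM.face_nonempty σ
  have hs := side_mem_edges (M := M) σ
  have hb : Bornology.IsBounded (M.face σ) :=
    (hΩ.closure).subset ((hM.face_subset hs).trans (closure_mono (hM.vol_subset _)))
  have hfin := surf_ne_top (hM.normal_norm _ _ hs) (hM.face_subset_hyperplane hs hy) hb
  rw [faceMeas, ofReal_measureReal hfin]
  refine le_antisymm ?_ (measure_mono subset_closure)
  calc surf p (closure (M.face σ))
      ≤ surf p (closure (M.face σ) \ M.face σ) + surf p (M.face σ) := by
        refine (measure_mono ?_).trans (measure_union_le _ _)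
        rw [sdiff_union_self]; exact subset_union_left
    _ = _ := by rw [hM.face_boundary, zero_add]

lemma volume_sweep_closure_face_le (hM : M.IsAdmissible Ω) (hΩ : Bornology.IsBounded Ω)
    (σ : M.Edge) (w : Pt p) :
    volume (sweep (closure (M.face σ)) w) ≤ ENNReal.ofReal (‖w‖ * M.faceMeas σ) := by
  obtain ⟨y, hy⟩ := hM.face_nonempty σ
  have hs := side_mem_edges (M := M) σ
  rw [ENNReal.ofReal_mul (norm_nonneg _), ← surf_closure_face hM hΩ]
  exact volume_sweep_le (hM.normal_norm _ _ hs) (hM.closure_face_subset_hyperplane hs hy)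
    isClosed_closure.measurableSet w

/-- The segments `[x, x + w]` which cross the boundary of `region S` fill at most an oblique
cylinder over this boundary. -/
lemma volume_crossing_le (hM : M.IsAdmissible Ω) (hp : 0 < p) (hΩ : Bornology.IsBounded Ω)
    {S : Set M.Cell} {X : Set (Pt p)} {w : Pt p} (hX : X ⊆ M.region S)
    (hseg : ∀ x ∈ X, ∀ t ∈ Icc (0 : ℝ) 1, x + t • w ∈ closure Ω)
    (hcross : ∀ x ∈ X, x + w ∈ M.region Sᶜ) :
    volume X ≤ ENNReal.ofReal (‖w‖ * M.innerPerimeter S) := by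
  classical
  have hsub : X ⊆ M.exceptional w ∪ ⋃ σ ∈ Finset.univ.filter
      (fun σ => ∃ L, M.opp σ = some L ∧ ¬(M.side σ ∈ S ↔ L ∈ S)),
      sweep (closure (M.face σ)) w := by
    intro x hx
    obtain ⟨L, hL, h⟩ := mem_iUnion₂.1 (hcross x hx)
    rcases mem_sweep_of_crossing hM (hX hx) (hseg x hx)
      ⟨1, by simp, L, hL, by simpa using subset_closure h⟩ with h | ⟨σ, hσ, h⟩
    · exact Or.inl h
    · exact Or.inr (mem_biUnion (by simpa using hσ) h)
  refine (measure_mono hsub).trans ((measure_union_le _ _).trans ?_)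
  rw [volume_exceptional hM hp, zero_add]
  refine (measure_biUnion_finset_le _ _).trans ?_
  rw [innerPerimeter, Finset.mul_sum, ENNReal.ofReal_sum_of_nonneg
    fun σ _ => mul_nonneg (norm_nonneg _) (faceMeas_nonneg _)]
  exact Finset.sum_le_sum fun σ _ => volume_sweep_closure_face_le hM hΩ σ w

/-- The same bound for the segments which reach the Dirichlet boundary. -/
lemma volume_inter_sweep_le (hM : M.IsAdmissible Ω) (hC : M.IsCompatible ΓD ΓN) (hp : 0 < p)
    (hΩ : IsPolytopalDomain Ω) (hdisj : Disjoint ΓD ΓN) {S : Set M.Cell} {Γ : Set (Pt p)}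
    {w : Pt p} (hΓD : Γ ⊆ ΓD) (hΓ : Γ ⊆ frontier Ω)
    (hseg : ∀ x, ∀ t ∈ Icc (0 : ℝ) 1, x + t • w ∈ Γ →
      ∀ s ∈ Icc (0 : ℝ) 1, x + s • t • w ∈ closure Ω) :
    volume (sweep Γ w ∩ M.region S) ≤ ENNReal.ofReal (‖w‖ * M.perimeter ΓD S) := by
  classical
  have hnull : volume (⋃ σ, sweep (closure (M.face σ) \ M.face σ) w) = 0 := by
    refine measure_iUnion_null fun σ => ?_
    obtain ⟨y, hy⟩ := hM.face_nonempty σ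
    have hs := side_mem_edges (M := M) σ
    exact volume_sweep_eq_zero (hM.normal_norm _ _ hs)
      (sdiff_subset.trans (hM.closure_face_subset_hyperplane hs hy)) (hM.face_boundary σ) w
  have hsub : sweep Γ w ∩ M.region S ⊆ (M.exceptional w ∪
      ⋃ σ, sweep (closure (M.face σ) \ M.face σ) w) ∪ ⋃ σ ∈ Finset.univ.filter
      (fun σ => (∃ L, M.opp σ = some L ∧ ¬(M.side σ ∈ S ↔ L ∈ S)) ∨
        (M.IsDirichlet ΓD σ ∧ M.side σ ∈ S)),
      sweep (closure (M.face σ)) w := by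
    rintro x ⟨hx, hxS⟩
    obtain ⟨t, ht, hy⟩ := hx
    by_cases hcr : ∃ s ∈ Icc (0 : ℝ) 1, ∃ L ∉ S, x + s • t • w ∈ closure (M.vol L)
    · rcases mem_sweep_of_crossing hM hxS (hseg x t ht hy) hcr with h | ⟨σ, hσ, h⟩
      · refine Or.inl (Or.inl ?_)
        simp only [exceptional, mem_iUnion] at h ⊢
        obtain ⟨K, L, hKL, h⟩ := h
        exact ⟨K, L, hKL, sweep_smul_subset _ _ ht h⟩
      · refine Or.inr (mem_biUnion ?_ (sweep_smul_subset _ _ ht h))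
        simp only [Finset.coe_filter, Finset.mem_univ, true_and, mem_ofPred_eq]
        exact Or.inl hσ
    · push Not at hcr
      have hcl := hseg x t ht hy 1 (by simp)
      rw [one_smul] at hcl
      rw [← hM.iUnion_closure_vol] at hcl
      obtain ⟨L, hL⟩ := mem_iUnion.1 hcl
      have hLS : L ∈ S := by
        by_contra h
        exact hcr 1 (by simp) L h (by rwa [one_smul])
      have hyΩ : x + t • w ∉ Ω := by
        have := hΓ hy
        rw [hΩ.isOpen.frontier_eq] at this
        exact this.2
      have hfr : x + t • w ∈ frontier (M.vol L) := by
        rw [(hM.vol_isOpen L).frontier_eq]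
        exact ⟨hL, fun h => hyΩ (hM.vol_subset L h)⟩
      rw [hM.frontier_vol L] at hfr
      obtain ⟨σ, hσ, hyσ⟩ := mem_iUnion₂.1 hfr
      by_cases hface : x + t • w ∈ M.face σ
      · right
        have hnone : M.opp σ = none := by
          rcases h : M.opp σ with _ | L'
          · rfl
          · exfalso
            apply hyΩ
            rw [← hΩ.interior_closure]
            exact hM.face_subset_interior hp h hface
        have hside : M.side σ = L := by
          rcases mem_edges.1 hσ with h | h
          · exact h
          · rw [hnone] at h; cases h
        refine mem_biUnion ?_ ⟨t, ht, hyσ⟩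
        simp only [Finset.coe_filter, Finset.mem_univ, true_and, mem_ofPred_eq]
        right
        refine ⟨?_, hside ▸ hLS⟩
        rcases hC σ hnone with h | h
        · exact h
        · exact absurd (h.2 hface) (disjoint_left.1 hdisj (hΓD hy))
      · exact Or.inl (Or.inr (mem_iUnion.2 ⟨σ, t, ht, hyσ, hface⟩))
  refine (measure_mono hsub).trans ((measure_union_le _ _).trans ?_)
  rw [measure_union_null (volume_exceptional hM hp w) hnull, zero_add]
  refine (measure_biUnion_finset_le _ _).trans ?_
  rw [perimeter, Finset.mul_sum, ENNReal.ofReal_sum_of_nonneg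
    fun σ _ => mul_nonneg (norm_nonneg _) (faceMeas_nonneg _)]
  exact Finset.sum_le_sum fun σ _ => volume_sweep_closure_face_le hM hΩ.isBounded σ w

/-- Counting the pairs `(x, y)` such that `x` lies in `region S ∩ P` and `y` in its complement
and in the copy of the convex set `P` shrunk towards `x` by the factor `r`: the segment `[x, y]`
crosses the boundary of `region S`. -/
lemma volume_inter_mul_le (hM : M.IsAdmissible Ω) (hp : 0 < p) (hΩ : Bornology.IsBounded Ω)
    (S : Set M.Cell) {P : Set (Pt p)} (hPo : IsOpen P) (hPc : Convex ℝ P) (hPΩ : P ⊆ Ω)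
    {R : ℝ} (hR : ∀ x ∈ P, ∀ y ∈ P, ‖y - x‖ ≤ R) {r : ℝ} (hr0 : 0 < r) (hr1 : r ≤ 1)
    {c : ℝ≥0∞} (hc : ∀ x ∈ P, c ≤ volume (AffineMap.homothety x r '' P ∩ M.region Sᶜ)) :
    volume (P ∩ M.region S) * c ≤
      ENNReal.ofReal (r * R * M.innerPerimeter S) *
        volume (Metric.closedBall (0 : Pt p) (r * R)) := by
  set T : Set (Pt p × Pt p) := {q | q.1 ∈ P ∩ M.region S ∧ q.1 + q.2 ∈ M.region Sᶜ ∧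
    q.1 + r⁻¹ • q.2 ∈ P} with hT
  have hTo : IsOpen T := by
    have h1 : IsOpen {q : Pt p × Pt p | q.1 ∈ P ∩ M.region S} :=
      (hPo.inter (isOpen_region hM S)).preimage continuous_fst
    have h2 : IsOpen {q : Pt p × Pt p | q.1 + q.2 ∈ M.region Sᶜ} :=
      (isOpen_region hM Sᶜ).preimage (by fun_prop)
    have h3 : IsOpen {q : Pt p × Pt p | q.1 + r⁻¹ • q.2 ∈ P} := hPo.preimage (by fun_prop)
    exact h1.inter (h2.inter h3)
  have hnorm : ∀ x w, x ∈ P → x + r⁻¹ • w ∈ P → ‖w‖ ≤ r * R := by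
    intro x w hx hw
    have := hR x hx _ hw
    rw [add_sub_cancel_left, norm_smul, norm_inv, Real.norm_of_nonneg hr0.le,
      inv_mul_le_iff₀ hr0] at this
    exact this
  have hlow : volume (P ∩ M.region S) * c ≤ (volume.prod volume) T := by
    rw [Measure.prod_apply hTo.measurableSet]
    calc volume (P ∩ M.region S) * c = ∫⁻ _ in P ∩ M.region S, c := by
          rw [setLIntegral_const, mul_comm]
      _ ≤ ∫⁻ x in P ∩ M.region S, volume (Prod.mk x ⁻¹' T) := by
          refine setLIntegral_mono' (hPo.inter (isOpen_region hM S)).measurableSet fun x hx => ?_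
          refine (hc x hx.1).trans ?_
          rw [← measure_preimage_add volume x]
          apply measure_mono
          rintro w ⟨⟨y, hy, hyw⟩, hw⟩
          refine ⟨hx, hw, ?_⟩
          have : w = r • (y - x) := by
            rw [AffineMap.homothety_apply, vsub_eq_sub, vadd_eq_add, add_comm] at hyw
            exact (add_left_cancel hyw).symm
          change x + r⁻¹ • w ∈ P
          rw [this, smul_smul, inv_mul_cancel₀ hr0.ne', one_smul, add_sub_cancel]
          exact hy
      _ ≤ _ := setLIntegral_le_lintegral _ _
  refine hlow.trans ?_
  rw [Measure.prod_apply_symm hTo.measurableSet]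
  calc ∫⁻ w, volume ((fun x => (x, w)) ⁻¹' T)
      ≤ ∫⁻ w, (Metric.closedBall (0 : Pt p) (r * R)).indicator
          (fun _ => ENNReal.ofReal (r * R * M.innerPerimeter S)) w := by
        refine lintegral_mono fun w => ?_
        by_cases hw : w ∈ Metric.closedBall (0 : Pt p) (r * R)
        · rw [indicator_of_mem hw]
          refine (volume_crossing_le (w := w) hM hp hΩ (S := S) (fun x hx => hx.1.2) ?_
            (fun x hx => hx.2.1)).trans ?_
          · rintro x ⟨hx1, hx2, hx3⟩ t ht
            apply subset_closure
            apply hPΩ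
            have e : x + t • w = (1 - t * r) • x + (t * r) • (x + r⁻¹ • w) := by
              rw [smul_add, smul_smul, mul_assoc, mul_inv_cancel₀ hr0.ne']
              module
            change x + t • w ∈ P
            rw [e]
            exact hPc hx1.1 hx3 (by nlinarith [ht.1, ht.2]) (mul_nonneg ht.1 hr0.le) (by ring)
          · apply ENNReal.ofReal_le_ofReal
            gcongr
            · exact innerPerimeter_nonneg S
            · simpa using hw
        · rw [indicator_of_notMem hw]
          simp only [nonpos_iff_eq_zero]
          have : (fun x => (x, w)) ⁻¹' T = ∅ := by
            ext x
            simp only [mem_empty_iff_false, iff_false]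
            rintro ⟨hx1, -, hx3⟩
            exact hw (by simpa using hnorm x w hx1.1 hx3)
          rw [this, measure_empty]
    _ = _ := by
        rw [lintegral_indicator Metric.isClosed_closedBall.measurableSet, setLIntegral_const]

end Mesh

/-! ### The isoperimetric inequality -/

/-- Two parts `X`, `Y` of the domain are linked if they satisfy a relative isoperimetric
inequality, uniformly in the mesh: a union of cells cannot fill a part of `X` and leave out a part
of `Y` without having some perimeter inside the domain. -/
def Linked (Ω X Y : Set (Pt p)) : Prop :=
  ∃ C : ℝ, 0 ≤ C ∧ ∀ M : Mesh p, M.IsAdmissible Ω → ∀ S : Set M.Cell,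
    volume.real (X ∩ M.region S) * volume.real (Y ∩ M.region Sᶜ) ≤ C * M.innerPerimeter S

lemma volume_ne_top {Ω A : Set (Pt p)} (hΩ : Bornology.IsBounded Ω) (hA : A ⊆ closure Ω) :
    volume A ≠ ∞ := (hΩ.closure.subset hA).measure_lt_top.ne

lemma volume_real_mono {Ω A B : Set (Pt p)} (hΩ : Bornology.IsBounded Ω) (hB : B ⊆ closure Ω)
    (h : A ⊆ B) : volume.real A ≤ volume.real B :=
  measureReal_mono h (volume_ne_top hΩ hB)

lemma Mesh.volume_real_le_add {Ω : Set (Pt p)} {M : Mesh p} (hM : M.IsAdmissible Ω)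
    (hΩ : Bornology.IsBounded Ω) (S : Set M.Cell) {A : Set (Pt p)} (hA : A ⊆ closure Ω) :
    volume.real A ≤ volume.real (A ∩ M.region S) + volume.real (A ∩ M.region Sᶜ) := by
  have h := Mesh.volume_le_add hM S hA
  have h1 := volume_ne_top hΩ (inter_subset_left.trans hA : A ∩ M.region S ⊆ _)
  have h2 := volume_ne_top hΩ (inter_subset_left.trans hA : A ∩ M.region Sᶜ ⊆ _)
  rw [Measure.real, Measure.real, Measure.real, ← ENNReal.toReal_add h1 h2]
  exact ENNReal.toReal_mono (ENNReal.add_ne_top.2 ⟨h1, h2⟩) h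

/-- A bounded convex part of the domain is linked with itself. -/
lemma linked_self {Ω P : Set (Pt p)} (hp : 0 < p) (hΩ : Bornology.IsBounded Ω) (hPo : IsOpen P)
    (hPc : Convex ℝ P) (hPΩ : P ⊆ Ω) : Linked Ω P P := by
  have hb : Bornology.IsBounded P := hΩ.subset hPΩ
  set R := Metric.diam P
  refine ⟨R * volume.real (Metric.closedBall (0 : Pt p) R), by positivity, fun M hM S => ?_⟩
  have h := Mesh.volume_inter_mul_le hM hp hΩ S hPo hPc hPΩ (R := R) (r := 1)
    (c := volume (P ∩ M.region Sᶜ))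
    (fun x hx y hy => by rw [← dist_eq_norm]; exact Metric.dist_le_diam_of_mem hb hy hx)
    one_pos le_rfl (fun x _ => by simp)
  rw [one_mul] at h
  have h2 := ENNReal.toReal_mono (ENNReal.mul_ne_top ENNReal.ofReal_ne_top
    Metric.isBounded_closedBall.measure_lt_top.ne) h
  rw [ENNReal.toReal_mul, ENNReal.toReal_mul, ENNReal.toReal_ofReal
    (mul_nonneg Metric.diam_nonneg (Mesh.innerPerimeter_nonneg S))] at h2
  calc _ ≤ _ := h2
    _ = _ := by simp only [Measure.real]; ring

lemma Linked.mono {Ω X Y X' Y' : Set (Pt p)} (h : Linked Ω X Y) (hΩ : Bornology.IsBounded Ω)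
    (hX : X ⊆ Ω) (hY : Y ⊆ Ω) (hX' : X' ⊆ X) (hY' : Y' ⊆ Y) : Linked Ω X' Y' := by
  obtain ⟨C, hC, h⟩ := h
  refine ⟨C, hC, fun M hM S => le_trans ?_ (h M hM S)⟩
  gcongr
  · exact volume_ne_top hΩ (inter_subset_left.trans (hX.trans subset_closure))
  · exact volume_ne_top hΩ (inter_subset_left.trans (hY.trans subset_closure))

/-- At least half of the middle set `Y` is in `region S`, or at least half of it is outside. -/
lemma Linked.trans {Ω X Y Z : Set (Pt p)} (h1 : Linked Ω X Y) (h2 : Linked Ω Y Z)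
    (hΩ : Bornology.IsBounded Ω) (hX : X ⊆ Ω) (hY : Y ⊆ Ω) (hZ : Z ⊆ Ω)
    (hpos : 0 < volume.real Y) : Linked Ω X Z := by
  obtain ⟨C, hC, h1⟩ := h1
  obtain ⟨D, hD, h2⟩ := h2
  set V := volume.real Ω with hV
  have hV0 : 0 ≤ V := measureReal_nonneg
  refine ⟨V * (C + D) / volume.real Y, by positivity, fun M hM S => ?_⟩
  have e1 := h1 M hM S
  have e2 := h2 M hM S
  have e3 := Mesh.volume_real_le_add hM hΩ S (hY.trans subset_closure)
  set a := volume.real (X ∩ M.region S)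
  set b := volume.real (Y ∩ M.region Sᶜ)
  set b' := volume.real (Y ∩ M.region S)
  set c := volume.real (Z ∩ M.region Sᶜ)
  set q := M.innerPerimeter S
  have hq : 0 ≤ q := Mesh.innerPerimeter_nonneg S
  have ha : a ≤ V := volume_real_mono hΩ subset_closure (inter_subset_left.trans hX)
  have hc : c ≤ V := volume_real_mono hΩ subset_closure (inter_subset_left.trans hZ)
  have ha0 : 0 ≤ a := measureReal_nonneg
  have hc0 : 0 ≤ c := measureReal_nonneg
  rw [div_mul_eq_mul_div, le_div_iff₀ hpos]
  calc a * c * volume.real Y ≤ a * c * (b' + b) := by gcongr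
    _ = c * (a * b) + a * (b' * c) := by ring
    _ ≤ c * (C * q) + a * (D * q) := by gcongr
    _ ≤ V * (C * q) + V * (D * q) := by gcongr
    _ = _ := by ring

lemma volume_real_pos {Ω A : Set (Pt p)} (hΩ : Bornology.IsBounded Ω) (hA : A ⊆ Ω)
    (ho : IsOpen A) (hn : A.Nonempty) : 0 < volume.real A :=
  ENNReal.toReal_pos (ho.measure_pos volume hn).ne'
    (volume_ne_top hΩ (hA.trans subset_closure))

/-- In a connected domain, all open convex parts are linked. -/
lemma linked_of_convex {Ω P Q : Set (Pt p)} (hp : 0 < p) (hΩ : IsPolytopalDomain Ω)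
    (hPo : IsOpen P) (hPc : Convex ℝ P) (hPΩ : P ⊆ Ω) (hPn : P.Nonempty)
    (hQo : IsOpen Q) (hQc : Convex ℝ Q) (hQΩ : Q ⊆ Ω) (hQn : Q.Nonempty) : Linked Ω P Q := by
  have hb := hΩ.isBounded
  have hlocal : ∀ {X Y : Set (Pt p)}, ∀ z r, X ⊆ Ω → Metric.ball z r ⊆ Ω → Linked Ω X Y → Y ⊆ Ω →
      z ∈ Y → IsOpen Y → 0 < r → Linked Ω X (Metric.ball z r) := by
    intro X Y z r hX hr hXY hY hz hYo hr0
    have hself := linked_self hp hb Metric.isOpen_ball (convex_ball z r) hr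
    have hsub : Metric.ball z r ∩ Y ⊆ Ω := inter_subset_left.trans hr
    refine (hXY.mono hb hX hY Subset.rfl inter_subset_right).trans
      (hself.mono hb hr hr inter_subset_left Subset.rfl) hb hX hsub hr ?_
    exact volume_real_pos hb hsub (Metric.isOpen_ball.inter hYo) ⟨z, Metric.mem_ball_self hr0, hz⟩
  -- the relation of points having linked balls is transitive, and its classes are open
  have hball : ∀ x ∈ Ω, ∀ y ∈ Ω, ∃ r > 0, ∃ s > 0, Metric.ball x r ⊆ Ω ∧ Metric.ball y s ⊆ Ω ∧
      Linked Ω (Metric.ball x r) (Metric.ball y s) := by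
    intro x hx y hy
    refine hΩ.isConnected.isPreconnected.induction₂' (fun x y => ∃ r > 0, ∃ s > 0,
      Metric.ball x r ⊆ Ω ∧ Metric.ball y s ⊆ Ω ∧ Linked Ω (Metric.ball x r) (Metric.ball y s))
      ?_ ?_ hx hy
    · intro x hx
      obtain ⟨r, hr, hrΩ⟩ := Metric.isOpen_iff.1 hΩ.isOpen x hx
      have hself := linked_self hp hb Metric.isOpen_ball (convex_ball x r) hrΩ
      filter_upwards [mem_nhdsWithin_of_mem_nhds (Metric.ball_mem_nhds x hr)] with y hy
      obtain ⟨s, hs, hsr⟩ := Metric.isOpen_iff.1 Metric.isOpen_ball y hy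
      exact ⟨⟨r, hr, s, hs, hrΩ, hsr.trans hrΩ, hself.mono hb hrΩ hrΩ Subset.rfl hsr⟩,
        ⟨s, hs, r, hr, hsr.trans hrΩ, hrΩ, hself.mono hb hrΩ hrΩ hsr Subset.rfl⟩⟩
    · rintro x y z - - - ⟨r, hr, s, hs, hrΩ, hsΩ, h1⟩ ⟨s', hs', t, ht, hsΩ', htΩ, h2⟩
      refine ⟨r, hr, t, ht, hrΩ, htΩ, ?_⟩
      have h3 := hlocal y s' hrΩ hsΩ' h1 hsΩ (Metric.mem_ball_self hs) Metric.isOpen_ball hs'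
      exact h3.trans h2 hb hrΩ hsΩ' htΩ
        (volume_real_pos hb hsΩ' Metric.isOpen_ball ⟨y, Metric.mem_ball_self hs'⟩)
  obtain ⟨x, hx⟩ := hPn
  obtain ⟨y, hy⟩ := hQn
  obtain ⟨r, hr, s, hs, hrΩ, hsΩ, h⟩ := hball x (hPΩ hx) y (hQΩ hy)
  have h1 := hlocal x r hPΩ hrΩ (linked_self hp hb hPo hPc hPΩ) hPΩ hx hPo hr
  have h2 := h1.trans h hb hPΩ hrΩ hsΩ
    (volume_real_pos hb hrΩ Metric.isOpen_ball ⟨x, Metric.mem_ball_self hr⟩)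
  have hsub : Metric.ball y s ∩ Q ⊆ Ω := inter_subset_left.trans hsΩ
  refine (h2.mono hb hPΩ hsΩ Subset.rfl inter_subset_left).trans
    ((linked_self hp hb hQo hQc hQΩ).mono hb hQΩ hQΩ inter_subset_right Subset.rfl)
    hb hPΩ hsub hQΩ ?_
  exact volume_real_pos hb hsub (Metric.isOpen_ball.inter hQo) ⟨y, Metric.mem_ball_self hs, hy⟩

/-- The hyperplanes containing the boundary cut a polytopal domain into finitely many open convex
pieces. -/
lemma IsPolytopalDomain.exists_convex_pieces {Ω : Set (Pt p)} (hΩ : IsPolytopalDomain Ω) :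
    ∃ 𝒞 : Finset (Set (Pt p)), (∀ P ∈ 𝒞, IsOpen P ∧ Convex ℝ P ∧ P ⊆ Ω ∧ P.Nonempty) ∧
      volume (Ω \ ⋃ P ∈ 𝒞, P) = 0 := by
  obtain ⟨H, hHf, hH0, hH⟩ := hΩ.frontier_subset
  set cell : Set (Pt p × ℝ) → Set (Pt p) := fun s =>
    ⋂ q ∈ H, {x | (q ∈ s → q.2 < inner ℝ q.1 x) ∧ (q ∉ s → inner ℝ q.1 x < q.2)} with hcell
  have hopen : ∀ s, IsOpen (cell s) := fun s => hHf.isOpen_biInter fun q _ => by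
    by_cases hq : q ∈ s
    · simp only [hq, true_imp_iff, not_true_eq_false, false_imp_iff, and_true]
      exact isOpen_lt continuous_const (by fun_prop)
    · simp only [hq, false_imp_iff, true_and, not_false_eq_true, true_imp_iff]
      exact isOpen_lt (by fun_prop) continuous_const
  have hconv : ∀ s, Convex ℝ (cell s) := fun s => convex_iInter₂ fun q _ => by
    have hlin : IsLinearMap ℝ fun x : Pt p => (inner ℝ q.1 x : ℝ) :=
      ⟨fun x y => inner_add_right _ _ _, fun c x => by simp [inner_smul_right]⟩
    by_cases hq : q ∈ s
    · simp only [hq, true_imp_iff, not_true_eq_false, false_imp_iff, and_true]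
      exact convex_halfSpace_gt hlin _
    · simp only [hq, false_imp_iff, true_and, not_false_eq_true, true_imp_iff]
      exact convex_halfSpace_lt hlin _
  have hfin : (cell '' 𝒫 H ∩ {P | P ⊆ Ω ∧ P.Nonempty}).Finite :=
    (hHf.finite_subsets.image cell).inter_of_left _
  refine ⟨hfin.toFinset, ?_, ?_⟩
  · intro P hP
    obtain ⟨⟨s, -, rfl⟩, h1, h2⟩ := hfin.mem_toFinset.1 hP
    exact ⟨hopen s, hconv s, h1, h2⟩
  · refine measure_mono_null (t := ⋃ q ∈ H, {x | inner ℝ q.1 x = q.2}) ?_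
      ((measure_biUnion_null_iff hHf.countable).2 fun q hq => ?_)
    · rintro x ⟨hxΩ, hx⟩
      by_contra hxH
      simp only [mem_iUnion, not_exists, mem_ofPred_eq] at hxH
      apply hx
      set s : Set (Pt p × ℝ) := {q ∈ H | q.2 < inner ℝ q.1 x} with hs
      have hxs : x ∈ cell s := by
        simp only [hcell, mem_iInter]
        intro q hq
        refine ⟨fun h => h.2, fun h => ?_⟩
        have h3 : ¬ q.2 < inner ℝ q.1 x := fun h' => h ⟨hq, h'⟩
        exact lt_of_le_of_ne (not_lt.1 h3) (hxH q hq)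
      have hsub : cell s ⊆ Ω := by
        refine (hconv s).isPreconnected.subset_left_of_subset_union (v := (closure Ω)ᶜ)
          hΩ.isOpen isClosed_closure.isOpen_compl
          (disjoint_compl_right.mono_right (compl_subset_compl.2 subset_closure)) ?_ ⟨x, hxs, hxΩ⟩
        intro y hy
        by_contra hyn
        have hyf : y ∈ frontier Ω := by
          rw [hΩ.isOpen.frontier_eq]
          constructor
          · by_contra h; exact hyn (Or.inr h)
          · exact fun h => hyn (Or.inl h)
        obtain ⟨q, hq, hyq⟩ := mem_iUnion₂.1 (hH hyf)
        have h4 := mem_iInter₂.1 hy q hq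
        have h5 : inner ℝ q.1 y = q.2 := hyq
        by_cases hqs : q ∈ s
        · exact absurd h5 (h4.1 hqs).ne'
        · exact absurd h5 (h4.2 hqs).ne
      exact mem_biUnion (hfin.mem_toFinset.2 ⟨⟨s, sep_subset _ _, rfl⟩, hsub, x, hxs⟩) hxs
    · have hq0 : ‖q.1‖ ≠ 0 := norm_ne_zero_iff.2 (hH0 q hq)
      refine measure_mono_null (t := hyperplane ((‖q.1‖⁻¹ : ℝ) • q.1) (‖q.1‖⁻¹ * q.2)) ?_
        (volume_hyperplane ?_ _)
      · rintro x (hx : inner ℝ q.1 x = q.2)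
        simp [hyperplane, inner_smul_left, hx]
      · rw [norm_smul, norm_inv, norm_norm, inv_mul_cancel₀ hq0]

lemma volume_real_inter_le_sum {Ω : Set (Pt p)} (hΩ : Bornology.IsBounded Ω)
    {𝒞 : Finset (Set (Pt p))} (h𝒞 : ∀ P ∈ 𝒞, P ⊆ Ω) (hnull : volume (Ω \ ⋃ P ∈ 𝒞, P) = 0)
    (A : Set (Pt p)) : volume.real (Ω ∩ A) ≤ ∑ P ∈ 𝒞, volume.real (P ∩ A) := by
  have hfin : ∀ P ∈ 𝒞, volume (P ∩ A) ≠ ∞ := fun P hP =>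
    volume_ne_top hΩ (inter_subset_left.trans ((h𝒞 P hP).trans subset_closure))
  simp only [Measure.real]
  rw [← ENNReal.toReal_sum hfin]
  refine ENNReal.toReal_mono (ENNReal.sum_ne_top.2 hfin) ?_
  calc volume (Ω ∩ A) ≤ volume ((Ω \ ⋃ P ∈ 𝒞, P) ∪ ⋃ P ∈ 𝒞, P ∩ A) := by
        apply measure_mono
        rintro x ⟨hx, hxA⟩
        by_cases h : x ∈ ⋃ P ∈ 𝒞, P
        · obtain ⟨P, hP, hxP⟩ := mem_iUnion₂.1 h
          exact Or.inr (mem_biUnion (t := fun P => P ∩ A) hP ⟨hxP, hxA⟩)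
        · exact Or.inl ⟨hx, h⟩
    _ ≤ _ := by
        refine (measure_union_le _ _).trans ?_
        rw [hnull, zero_add]
        exact measure_biUnion_finset_le _ _

/-- The whole domain is linked with itself. -/
lemma linked_domain {Ω : Set (Pt p)} (hp : 0 < p) (hΩ : IsPolytopalDomain Ω) : Linked Ω Ω Ω := by
  obtain ⟨𝒞, h𝒞, hnull⟩ := hΩ.exists_convex_pieces
  have hb := hΩ.isBounded
  have hlink : ∀ P Q, ∃ C : ℝ, 0 ≤ C ∧ (P ∈ 𝒞 → Q ∈ 𝒞 → ∀ M : Mesh p, M.IsAdmissible Ω →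
      ∀ S : Set M.Cell, volume.real (P ∩ M.region S) * volume.real (Q ∩ M.region Sᶜ) ≤
        C * M.innerPerimeter S) := by
    intro P Q
    by_cases hPQ : P ∈ 𝒞 ∧ Q ∈ 𝒞
    · obtain ⟨h1, h2, h3, h4⟩ := h𝒞 P hPQ.1
      obtain ⟨k1, k2, k3, k4⟩ := h𝒞 Q hPQ.2
      obtain ⟨C, hC, h⟩ := linked_of_convex hp hΩ h1 h2 h3 h4 k1 k2 k3 k4
      exact ⟨C, hC, fun _ _ => h⟩
    · exact ⟨0, le_rfl, fun h1 h2 => absurd ⟨h1, h2⟩ hPQ⟩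
  choose C hC hlink using hlink
  refine ⟨∑ P ∈ 𝒞, ∑ Q ∈ 𝒞, C P Q,
    Finset.sum_nonneg fun P _ => Finset.sum_nonneg fun Q _ => hC P Q, fun M hM S => ?_⟩
  have hsum := volume_real_inter_le_sum hb (fun P hP => (h𝒞 P hP).2.2.1) hnull
  calc volume.real (Ω ∩ M.region S) * volume.real (Ω ∩ M.region Sᶜ)
      ≤ (∑ P ∈ 𝒞, volume.real (P ∩ M.region S)) * ∑ Q ∈ 𝒞, volume.real (Q ∩ M.region Sᶜ) := by
        gcongr
        · exact hsum _
        · exact hsum _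
    _ = ∑ P ∈ 𝒞, ∑ Q ∈ 𝒞, volume.real (P ∩ M.region S) * volume.real (Q ∩ M.region Sᶜ) :=
        Finset.sum_mul_sum _ _ _ _
    _ ≤ ∑ P ∈ 𝒞, ∑ Q ∈ 𝒞, C P Q * M.innerPerimeter S :=
        Finset.sum_le_sum fun P hP => Finset.sum_le_sum fun Q hQ => hlink P Q hP hQ M hM S
    _ = _ := by simp only [Finset.sum_mul]

/-- Near a part of the Dirichlet boundary with positive measure, a union of cells is controlled by
its perimeter. -/
lemma exists_dirichlet_collar {Ω ΓD ΓN : Set (Pt p)} (hp : 0 < p) (hΩ : IsPolytopalDomain Ω)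
    (hΓ : frontier Ω = ΓD ∪ ΓN) (hdisj : Disjoint ΓD ΓN) (hΓD : MeasurableSet ΓD)
    (hpos : 0 < surf p ΓD) :
    ∃ X ⊆ closure Ω, 0 < volume.real X ∧ ∃ C : ℝ, 0 ≤ C ∧ ∀ M : Mesh p, M.IsAdmissible Ω →
      M.IsCompatible ΓD ΓN → ∀ S : Set M.Cell,
      volume.real (X ∩ M.region S) ≤ C * M.perimeter ΓD S := by
  obtain ⟨𝒞, h𝒞, hnull⟩ := hΩ.exists_convex_pieces
  obtain ⟨H, hHf, hH0, hH⟩ := hΩ.frontier_subset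
  have hcl : closure Ω ⊆ ⋃ P ∈ 𝒞, closure P := by
    rw [← Finset.closure_biUnion]
    refine closure_minimal ?_ isClosed_closure
    intro x hx
    rw [mem_closure_iff]
    intro o ho hxo
    by_contra hne
    have hpos := (ho.inter hΩ.isOpen).measure_pos volume ⟨x, hxo, hx⟩
    refine hpos.ne' (measure_mono_null ?_ hnull)
    rintro y ⟨hyo, hyΩ⟩
    exact ⟨hyΩ, fun h => hne ⟨y, hyo, h⟩⟩
  have hΓΩ : ΓD ⊆ frontier Ω := hΓ ▸ subset_union_left
  -- the relevant part of the boundary, in one hyperplane and adjacent to one convex piece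
  obtain ⟨q, hq, P, hP, hqP⟩ : ∃ q ∈ H, ∃ P ∈ 𝒞,
      surf p (ΓD ∩ {x | inner ℝ q.1 x = q.2} ∩ closure P) ≠ 0 := by
    by_contra hcon
    push Not at hcon
    refine hpos.ne' (measure_mono_null (t := ⋃ q ∈ H, ⋃ P ∈ 𝒞,
      ΓD ∩ {x | inner ℝ q.1 x = q.2} ∩ closure P) ?_
      ((measure_biUnion_null_iff hHf.countable).2 fun q hq =>
        (measure_biUnion_null_iff 𝒞.countable_toSet).2 fun P hP => hcon q hq P hP))
    intro x hx
    obtain ⟨q, hq, hxq⟩ := mem_iUnion₂.1 (hH (hΓΩ hx))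
    obtain ⟨P, hP, hxP⟩ := mem_iUnion₂.1 (hcl (frontier_subset_closure (hΓΩ hx)))
    exact mem_biUnion hq (mem_biUnion (t := fun P => ΓD ∩ {x | inner ℝ q.1 x = q.2} ∩ closure P)
      hP ⟨⟨hx, hxq⟩, hxP⟩)
  obtain ⟨hPo, hPc, hPΩ, hPn⟩ := h𝒞 P hP
  have hq0 : ‖q.1‖ ≠ 0 := norm_ne_zero_iff.2 (hH0 q hq)
  set ν : Pt p := (‖q.1‖⁻¹ : ℝ) • q.1 with hν
  set c : ℝ := ‖q.1‖⁻¹ * q.2 with hc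
  have hν1 : ‖ν‖ = 1 := by rw [hν, norm_smul, norm_inv, norm_norm, inv_mul_cancel₀ hq0]
  have hqν : {x | inner ℝ q.1 x = q.2} = hyperplane ν c := by
    ext x
    simp only [hyperplane, hν, hc, mem_ofPred_eq, inner_smul_left, RCLike.conj_to_real]
    exact (mul_right_inj' (inv_ne_zero hq0)).symm
  rw [hqν] at hqP
  set Γ₀ := ΓD ∩ hyperplane ν c ∩ closure P with hΓ₀
  have hΓ₀m : MeasurableSet Γ₀ :=
    (hΓD.inter (isClosed_hyperplane ν c).measurableSet).inter isClosed_closure.measurableSet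
  obtain ⟨x₀, hx₀P, hx₀⟩ : (P \ hyperplane ν c).Nonempty := by
    rw [nonempty_iff_ne_empty]
    intro h
    exact (hPo.measure_pos volume hPn).ne'
      (measure_mono_null (sdiff_eq_empty.1 h) (volume_hyperplane hν1 c))
  obtain ⟨ρ, hρ, hρP⟩ := Metric.isOpen_iff.1 hPo x₀ hx₀P
  obtain ⟨y₀, hy₀, hy₀pos⟩ := exists_mem_forall_mem_nhdsWithin_pos_measure hqP
  set Γ := Γ₀ ∩ Metric.ball y₀ ρ with hΓdef
  have hΓpos : 0 < surf p Γ :=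
    hy₀pos _ (Filter.inter_mem self_mem_nhdsWithin
      (mem_nhdsWithin_of_mem_nhds (Metric.ball_mem_nhds _ hρ)))
  have hΓm : MeasurableSet Γ := hΓ₀m.inter measurableSet_ball
  have hΓH : Γ ⊆ hyperplane ν c := fun x hx => hx.1.1.2
  set w : Pt p := y₀ - x₀ with hw
  have hνw : inner ℝ ν w ≠ 0 := by
    have h1 : inner ℝ ν y₀ = c := hy₀.1.2
    rw [hw, inner_sub_right, h1, sub_ne_zero]
    exact fun h => hx₀ h.symm
  -- a segment of direction `w` which reaches `Γ` comes from the ball around `x₀`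
  have hseg : ∀ x, ∀ t ∈ Icc (0 : ℝ) 1, x + t • w ∈ Γ →
      ∀ s ∈ Icc (0 : ℝ) 1, x + s • t • w ∈ closure Ω := by
    rintro x t ⟨ht0, ht1⟩ hx s ⟨hs0, hs1⟩
    apply closure_mono hPΩ
    have h1 : x + t • w - w ∈ closure P := by
      apply subset_closure
      apply hρP
      have := hx.2
      rw [Metric.mem_ball, dist_eq_norm] at this ⊢
      rw [hw] at this ⊢
      convert this using 2
      module
    have h2 : x + t • w ∈ closure P := hx.1.2
    have e : x + s • t • w = ((1 - s) * t) • (x + t • w - w) +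
        (1 - (1 - s) * t) • (x + t • w) := by module
    rw [e]
    exact hPc.closure h1 h2 (mul_nonneg (by linarith) ht0)
      (by nlinarith) (by ring)
  have hX : sweep Γ w ⊆ closure Ω := by
    rintro x ⟨t, ht, hx⟩
    simpa using hseg x t ht hx 0 (by simp)
  refine ⟨sweep Γ w, hX, ?_, ‖w‖, norm_nonneg _, fun M hM hC S => ?_⟩
  · refine ENNReal.toReal_pos ?_ (volume_ne_top hΩ.isBounded hX)
    rw [volume_sweep hν1 hΓH hΓm]
    exact mul_ne_zero (by simpa using hνw) hΓpos.ne'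
  · have h := Mesh.volume_inter_sweep_le hM hC hp hΩ hdisj (S := S) (Γ := Γ) (w := w)
      (fun x hx => hx.1.1.1) (fun x hx => hΓΩ hx.1.1.1) hseg
    exact ENNReal.toReal_le_of_le_ofReal
      (mul_nonneg (norm_nonneg _) (Mesh.perimeter_nonneg S)) h

/-- The isoperimetric inequality in its linear form. -/
lemma exists_volume_region_le_perimeter {Ω ΓD ΓN : Set (Pt p)} (hp : 0 < p)
    (hΩ : IsPolytopalDomain Ω)
    (hΓ : frontier Ω = ΓD ∪ ΓN) (hdisj : Disjoint ΓD ΓN) (hΓD : MeasurableSet ΓD)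
    (hpos : 0 < surf p ΓD) :
    ∃ C : ℝ, 0 ≤ C ∧ ∀ M : Mesh p, M.IsAdmissible Ω →
      M.IsCompatible ΓD ΓN → ∀ S : Set M.Cell,
      volume.real (M.region S) ≤ C * M.perimeter ΓD S := by
  obtain ⟨X, hX, hXpos, C, hC, h1⟩ := exists_dirichlet_collar hp hΩ hΓ hdisj hΓD hpos
  obtain ⟨D, hD, h2⟩ := linked_domain hp hΩ
  have hb := hΩ.isBounded
  have hV0 : 0 ≤ volume.real Ω := measureReal_nonneg
  refine ⟨(D + volume.real Ω * C) / volume.real X, by positivity, fun M hM hCo S => ?_⟩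
  have e1 := h1 M hM hCo S
  have e2 := h2 M hM S
  have e3 := Mesh.volume_real_le_add hM hb S hX
  rw [inter_eq_self_of_subset_right (Mesh.region_subset hM S),
    inter_eq_self_of_subset_right (Mesh.region_subset hM Sᶜ)] at e2
  have e4 : volume.real (X ∩ M.region Sᶜ) ≤ volume.real (M.region Sᶜ) :=
    volume_real_mono hb ((Mesh.region_subset hM _).trans subset_closure) inter_subset_right
  have e5 : volume.real (M.region S) ≤ volume.real Ω :=
    volume_real_mono hb subset_closure (Mesh.region_subset hM S)
  have e6 := Mesh.innerPerimeter_le_perimeter (ΓD := ΓD) S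
  have e7 : 0 ≤ M.perimeter ΓD S := Mesh.perimeter_nonneg S
  set a := volume.real (M.region S)
  set q := M.perimeter ΓD S
  have ha : 0 ≤ a := measureReal_nonneg
  rw [div_mul_eq_mul_div, le_div_iff₀ hXpos]
  calc a * volume.real X ≤ a * (C * q + volume.real (M.region Sᶜ)) := by gcongr; linarith
    _ = a * (C * q) + a * volume.real (M.region Sᶜ) := by ring
    _ ≤ volume.real Ω * (C * q) + D * q := by
        exact add_le_add (by gcongr) (e2.trans (by gcongr))
    _ = _ := by ring

/-- The isoperimetric inequality in a convex piece at the scale `r`. -/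
lemma volume_inter_region_le {Ω P : Set (Pt p)} (hp : 0 < p) (hΩ : Bornology.IsBounded Ω)
    (hPo : IsOpen P) (hPc : Convex ℝ P) (hPΩ : P ⊆ Ω) {R : ℝ} (hR0 : 0 ≤ R)
    (hR : ∀ x ∈ P, ∀ y ∈ P, ‖y - x‖ ≤ R) {M : Mesh p} (hM : M.IsAdmissible Ω) {S : Set M.Cell}
    {r : ℝ} (hr0 : 0 < r) (hr1 : r ≤ 1)
    (hr : 2 * volume.real (M.region S) ≤ r ^ p * volume.real P) :
    volume.real (P ∩ M.region S) * volume.real P ≤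
      2 * r * R ^ (p + 1) * volume.real (Metric.ball (0 : Pt p) 1) * M.innerPerimeter S := by
  have hPfin := volume_ne_top hΩ (hPΩ.trans subset_closure)
  have hc : ∀ x ∈ P, ENNReal.ofReal (r ^ p * volume.real P / 2) ≤
      volume (AffineMap.homothety x r '' P ∩ M.region Sᶜ) := by
    intro x hx
    have hsub : AffineMap.homothety x r '' P ⊆ P := by
      rintro _ ⟨y, hy, rfl⟩
      rw [AffineMap.homothety_eq_lineMap]
      exact hPc.lineMap_mem hx hy ⟨hr0.le, hr1⟩
    have h1 := Mesh.volume_real_le_add hM hΩ S (hsub.trans (hPΩ.trans subset_closure))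
    have h2 : volume.real (AffineMap.homothety x r '' P) = r ^ p * volume.real P := by
      rw [Measure.real, Measure.addHaar_image_homothety, ENNReal.toReal_mul,
        ENNReal.toReal_ofReal (abs_nonneg _), finrank_euclideanSpace, Fintype.card_fin,
        abs_of_nonneg (by positivity)]
      rfl
    have h3 : volume.real (AffineMap.homothety x r '' P ∩ M.region S) ≤
        volume.real (M.region S) :=
      volume_real_mono hΩ ((Mesh.region_subset hM _).trans subset_closure) inter_subset_right
    refine ENNReal.ofReal_le_of_le_toReal ?_
    change _ ≤ volume.real _
    linarith
  have h := Mesh.volume_inter_mul_le hM hp hΩ S hPo hPc hPΩ hR hr0 hr1 hc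
  have hq : 0 ≤ M.innerPerimeter S := Mesh.innerPerimeter_nonneg S
  have h2 := ENNReal.toReal_mono (ENNReal.mul_ne_top ENNReal.ofReal_ne_top
    Metric.isBounded_closedBall.measure_lt_top.ne) h
  rw [ENNReal.toReal_mul, ENNReal.toReal_mul, ENNReal.toReal_ofReal (by positivity),
    ENNReal.toReal_ofReal (by positivity), Measure.addHaar_closedBall _ _ (by positivity),
    ENNReal.toReal_mul, ENNReal.toReal_ofReal (by positivity), finrank_euclideanSpace,
    Fintype.card_fin] at h2
  change volume.real (P ∩ M.region S) * _ ≤ _ * (_ * volume.real (Metric.ball (0 : Pt p) 1)) at h2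
  have hrp : (0 : ℝ) < r ^ p := by positivity
  refine le_of_mul_le_mul_left ?_ hrp
  rw [mul_pow] at h2
  calc r ^ p * (volume.real (P ∩ M.region S) * volume.real P)
      = 2 * (volume.real (P ∩ M.region S) * (r ^ p * volume.real P / 2)) := by ring
    _ ≤ 2 * (r * R * M.innerPerimeter S *
        (r ^ p * R ^ p * volume.real (Metric.ball (0 : Pt p) 1))) := by gcongr
    _ = _ := by rw [pow_succ]; ring

/-- The isoperimetric inequality, with the exponents of the dimension `3`; these are not optimal
in smaller dimensions. -/
theorem exists_isoperimetric {Ω ΓD ΓN : Set (Pt p)} (hp : 0 < p) (hp3 : p ≤ 3)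
    (hΩ : IsPolytopalDomain Ω)
    (hΓ : frontier Ω = ΓD ∪ ΓN) (hdisj : Disjoint ΓD ΓN) (hΓD : MeasurableSet ΓD)
    (hpos : 0 < surf p ΓD) :
    ∃ C : ℝ, 0 < C ∧ ∀ M : Mesh p, M.IsAdmissible Ω →
      M.IsCompatible ΓD ΓN → ∀ S : Set M.Cell,
      volume.real (M.region S) ^ 2 ≤ C * M.perimeter ΓD S ^ 3 := by
  obtain ⟨C₀, hC₀, hlin⟩ := exists_volume_region_le_perimeter hp hΩ hΓ hdisj hΓD hpos
  obtain ⟨𝒞, h𝒞, hnull⟩ := hΩ.exists_convex_pieces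
  have hb := hΩ.isBounded
  -- a common lower bound for the volumes of the pieces
  obtain ⟨c₀, hc₀, hc₀P⟩ : ∃ c₀ : ℝ, 0 < c₀ ∧ ∀ P ∈ 𝒞, c₀ ≤ volume.real P := by
    rcases 𝒞.eq_empty_or_nonempty with h | h
    · exact ⟨1, one_pos, by simp [h]⟩
    · obtain ⟨P, hP, hmin⟩ := 𝒞.exists_min_image (fun P => volume.real P) h
      obtain ⟨h1, h2, h3, h4⟩ := h𝒞 P hP
      exact ⟨volume.real P, volume_real_pos hb h3 h1 h4, hmin⟩
  set R := Metric.diam Ω with hRdef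
  have hR0 : 0 ≤ R := Metric.diam_nonneg
  set C₁ : ℝ := (𝒞.card : ℝ) *
    (2 * R ^ (p + 1) * volume.real (Metric.ball (0 : Pt p) 1) / c₀) with hC₁
  have hC₁0 : 0 ≤ C₁ := by positivity
  refine ⟨C₁ ^ 3 * (2 / c₀) + C₀ ^ 3 * (2 / c₀) + 1, by positivity, fun M hM hCo S => ?_⟩
  set a := volume.real (M.region S) with ha
  set q := M.perimeter ΓD S with hq
  have ha0 : 0 ≤ a := measureReal_nonneg
  have hq0 : 0 ≤ q := Mesh.perimeter_nonneg S
  rcases ha0.eq_or_lt with h0 | hapos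
  · rw [← h0, zero_pow two_ne_zero]; positivity
  suffices h : a ^ 3 ≤ (C₁ ^ 3 * (2 / c₀) + C₀ ^ 3 * (2 / c₀) + 1) * q ^ 3 * a by
    refine le_of_mul_le_mul_right ?_ hapos
    calc a ^ 2 * a = a ^ 3 := by ring
      _ ≤ _ := h
  by_cases hbig : c₀ < 2 * a
  · have h1 : a ≤ C₀ * q := hlin M hM hCo S
    calc a ^ 3 ≤ (C₀ * q) ^ 3 := by gcongr
      _ ≤ (C₀ * q) ^ 3 * (2 / c₀ * a) := by
          refine le_mul_of_one_le_right (by positivity) ?_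
          rw [div_mul_eq_mul_div, one_le_div hc₀]; exact hbig.le
      _ = (C₀ ^ 3 * (2 / c₀)) * q ^ 3 * a := by ring
      _ ≤ _ := by
          gcongr
          have : 0 ≤ C₁ ^ 3 * (2 / c₀) := by positivity
          linarith
  · push Not at hbig
    -- the scale `r` is chosen such that `region S` fills at most half of each shrunk piece
    set r : ℝ := (2 * a / c₀) ^ (3⁻¹ : ℝ) with hr
    have h2a : 0 < 2 * a / c₀ := by positivity
    have hr3 : r ^ 3 = 2 * a / c₀ := by
      rw [hr, ← Real.rpow_natCast, ← Real.rpow_mul h2a.le]; norm_num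
    have hr0 : 0 < r := Real.rpow_pos_of_pos h2a _
    have hr1 : r ≤ 1 := Real.rpow_le_one h2a.le ((div_le_one hc₀).2 hbig) (by norm_num)
    have hpiece : ∀ P ∈ 𝒞, volume.real (P ∩ M.region S) ≤
        2 * R ^ (p + 1) * volume.real (Metric.ball (0 : Pt p) 1) / c₀ * (r * q) := by
      intro P hP
      obtain ⟨h1, h2, h3, -⟩ := h𝒞 P hP
      have hrP : 2 * a ≤ r ^ p * volume.real P := by
        calc 2 * a = r ^ 3 * c₀ := by rw [hr3]; field_simp
          _ ≤ r ^ p * volume.real P := by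
              gcongr ?_ * ?_
              · exact pow_le_pow_of_le_one hr0.le hr1 hp3
              · exact hc₀P P hP
      have h := volume_inter_region_le hp hb h1 h2 h3 hR0 (fun x hx y hy => by
        rw [← dist_eq_norm]; exact Metric.dist_le_diam_of_mem hb (h3 hy) (h3 hx)) hM hr0 hr1 hrP
      have hle := Mesh.innerPerimeter_le_perimeter (ΓD := ΓD) S
      rw [div_mul_eq_mul_div, le_div_iff₀ hc₀]
      calc volume.real (P ∩ M.region S) * c₀ ≤ volume.real (P ∩ M.region S) * volume.real P := by
            gcongr; exact hc₀P P hP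
        _ ≤ _ := h
        _ ≤ 2 * r * R ^ (p + 1) * volume.real (Metric.ball (0 : Pt p) 1) * q := by gcongr
        _ = _ := by ring
    have hcover := volume_real_inter_le_sum hb (fun P hP => (h𝒞 P hP).2.2.1) hnull (M.region S)
    rw [inter_eq_self_of_subset_right (Mesh.region_subset hM S)] at hcover
    have h1 : a ≤ C₁ * (r * q) := by
      refine hcover.trans ((Finset.sum_le_sum hpiece).trans_eq ?_)
      rw [Finset.sum_const, nsmul_eq_mul, hC₁]; ring
    calc a ^ 3 ≤ (C₁ * (r * q)) ^ 3 := by gcongr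
      _ = C₁ ^ 3 * r ^ 3 * q ^ 3 := by ring
      _ = (C₁ ^ 3 * (2 / c₀)) * q ^ 3 * a := by rw [hr3]; ring
      _ ≤ _ := by
          gcongr
          have : 0 ≤ C₀ ^ 3 * (2 / c₀) := by positivity
          linarith

/-! ### Regularity of the mesh, coarea inequality and superlevel sets -/

namespace Mesh

variable {M : Mesh p} {Ω ΓD ΓN : Set (Pt p)}

lemma cellMeas_pos (hM : M.IsAdmissible Ω) (hΩ : Bornology.IsBounded Ω) (K : M.Cell) :
    0 < M.cellMeas K :=
  volume_real_pos hΩ (hM.vol_subset K) (hM.vol_isOpen K) (hM.vol_nonempty K)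

lemma faceMeas_pos (hM : M.IsAdmissible Ω) (hΩ : Bornology.IsBounded Ω) (σ : M.Edge) :
    0 < M.faceMeas σ := by
  have h := (hM.face_pos σ).trans_le (measure_mono subset_closure)
  rwa [surf_closure_face hM hΩ, ENNReal.ofReal_pos] at h

lemma tau_pos (hM : M.IsAdmissible Ω) (hΩ : Bornology.IsBounded Ω) (σ : M.Edge) :
    0 < M.tau σ := div_pos (faceMeas_pos hM hΩ σ) (hM.d_pos σ)

lemma d_le_diam (hM : M.IsAdmissible Ω) (hΩ : Bornology.IsBounded Ω) (σ : M.Edge) :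
    M.d σ ≤ Metric.diam Ω := by
  have hcl : ∀ K, closure (M.vol K) ⊆ closure Ω := fun K => closure_mono (hM.vol_subset K)
  rw [← Metric.diam_closure]
  unfold d
  rcases h : M.opp σ with _ | L
  · obtain ⟨y, hy⟩ := hM.face_nonempty σ
    exact (Metric.infDist_le_dist_of_mem hy).trans (Metric.dist_le_diam_of_mem hΩ.closure
      (hcl _ (hM.pt_mem _)) (hcl _ (hM.face_subset (side_mem_edges σ) hy)))
  · exact Metric.dist_le_diam_of_mem hΩ.closure (hcl _ (hM.pt_mem _)) (hcl _ (hM.pt_mem _))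

lemma cone_subset_closure_vol (hM : M.IsAdmissible Ω) {K : M.Cell} {σ : M.Edge}
    (hσ : σ ∈ M.edges K) : cone (M.pt K) (M.face σ) ⊆ closure (M.vol K) := by
  rintro _ ⟨t, ⟨ht0, ht1⟩, y, hy, rfl⟩
  have e : M.pt K + t • (y - M.pt K) = (1 - t) • M.pt K + t • y := by module
  rw [e]
  exact (hM.vol_convex K).closure (hM.pt_mem K) (hM.face_subset hσ hy) (by linarith) ht0.le
    (by ring)

/-- The point `x_K` lies strictly below the faces of `K`. -/
lemma inner_pos_of_regular (hM : M.IsAdmissible Ω) {ξ : ℝ} (hξ : 0 < ξ) (hreg : M.IsRegular ξ)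
    {K : M.Cell} {σ : M.Edge} (hσ : σ ∈ M.edges K) {y : Pt p} (hy : y ∈ M.face σ) :
    0 < ξ * M.d σ ∧ ξ * M.d σ ≤ inner ℝ (M.normal K σ) (y - M.pt K) := by
  have h0 : 0 < ξ * M.d σ := mul_pos hξ (hM.d_pos σ)
  refine ⟨h0, ?_⟩
  have h1 := hreg K σ hσ
  rw [hM.affineSpan_face hσ hy] at h1
  have h2 := h1.trans (infDist_hyperplane_le (hM.normal_norm K σ hσ) _ _)
  rw [← inner_sub_right, abs_of_nonneg] at h2
  · exact h2
  · have := hM.inner_normal_nonpos hσ (hM.pt_mem K) hy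
    rw [← neg_sub, inner_neg_right] at this
    linarith

/-- The cones over the faces of `K` with apex `x_K` do not overlap. -/
lemma disjoint_cone (hM : M.IsAdmissible Ω) {ξ : ℝ} (hξ : 0 < ξ) (hreg : M.IsRegular ξ)
    {K : M.Cell} {σ σ' : M.Edge} (hσ : σ ∈ M.edges K) (hσ' : σ' ∈ M.edges K) (hne : σ ≠ σ') :
    Disjoint (cone (M.pt K) (M.face σ)) (cone (M.pt K) (M.face σ')) := by
  -- the face which is met last by a common ray lies strictly above the other one
  have key : ∀ σ σ', σ ∈ M.edges K → σ' ∈ M.edges K → σ ≠ σ' → ∀ t t' : ℝ, 0 < t → t ≤ t' →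
      ∀ y ∈ M.face σ, ∀ y' ∈ M.face σ',
        M.pt K + t' • (y' - M.pt K) ≠ M.pt K + t • (y - M.pt K) := by
    intro σ σ' hσ hσ' hne t t' ht htt y hy y' hy' heq
    rw [add_right_inj] at heq
    have h1 := (inner_pos_of_regular hM hξ hreg hσ' hy')
    have h2 : 0 < inner ℝ (M.normal K σ') (y' - M.pt K) := h1.1.trans_le h1.2
    have h3 := hM.inner_normal_nonpos hσ' (hM.face_subset hσ hy) hy'
    have h4 : inner ℝ (M.normal K σ') (y - y') =
        inner ℝ (M.normal K σ') (y - M.pt K) - inner ℝ (M.normal K σ') (y' - M.pt K) := by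
      rw [← inner_sub_right]; congr 1; abel
    have h5 : t' * inner ℝ (M.normal K σ') (y' - M.pt K) =
        t * inner ℝ (M.normal K σ') (y - M.pt K) := by
      rw [← inner_smul_right, ← inner_smul_right, heq]
    rcases htt.eq_or_lt with rfl | hlt
    · have : y' - M.pt K = y - M.pt K := smul_right_injective _ ht.ne' heq
      have hyy : y' = y := sub_left_injective this
      exact disjoint_left.1 (hM.face_disjoint σ σ' hne) hy (hyy ▸ hy')
    · rw [h4] at h3
      nlinarith [mul_lt_mul_of_pos_right hlt h2]
  rw [disjoint_left]
  rintro x ⟨t, ht, y, hy, hx⟩ ⟨t', ht', y', hy', hx'⟩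
  rcases le_total t t' with h | h
  · exact key σ σ' hσ hσ' hne t t' ht.1 h y hy y' hy' (hx'.symm.trans hx)
  · exact key σ' σ hσ' hσ hne.symm t' t ht'.1 h y' hy' y hy (hx.symm.trans hx')

/-- The cones over the faces of `K` with apex `x_K` have heights at least `ξ d_σ`, by the regularity
constraint, and fill at most `K`. -/
lemma sum_faceMeas_mul_d_le (hM : M.IsAdmissible Ω) (hΩ : Bornology.IsBounded Ω) {ξ : ℝ}
    (hξ : 0 < ξ) (hreg : M.IsRegular ξ) (K : M.Cell) :
    ∑ σ ∈ M.edges K, M.faceMeas σ * M.d σ ≤ 2 ^ p / ξ * M.cellMeas K := by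
  have hcone : ∀ σ ∈ M.edges K, MeasurableSet (cone (M.pt K) (M.face σ)) ∧
      ξ * (M.faceMeas σ * M.d σ) ≤ 2 ^ p * volume.real (cone (M.pt K) (M.face σ)) := by
    intro σ hσ
    obtain ⟨y, hy⟩ := hM.face_nonempty σ
    obtain ⟨h0, h1⟩ := inner_pos_of_regular hM hξ hreg hσ hy
    obtain ⟨h2, h3⟩ := height_mul_surf_le_volume_cone (x₀ := M.pt K) (hM.normal_norm K σ hσ)
      (h0.trans_le h1) (S := M.face σ) (fun z hz => by
        have := hM.normal_orth K σ hσ z hz y hy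
        rw [← sub_add_sub_cancel z y, inner_add_right, this, zero_add])
      (hM.measurableSet_face σ)
    refine ⟨h2, ?_⟩
    have hfin : volume (cone (M.pt K) (M.face σ)) ≠ ∞ :=
      volume_ne_top hΩ ((cone_subset_closure_vol hM hσ).trans (closure_mono (hM.vol_subset K)))
    have h4 := ENNReal.toReal_mono (ENNReal.mul_ne_top (by simp) hfin) h3
    rw [ENNReal.toReal_mul, ENNReal.toReal_mul, ENNReal.toReal_ofReal (h0.trans_le h1).le,
      ENNReal.toReal_pow, ENNReal.toReal_ofNat] at h4
    refine le_trans ?_ h4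
    calc ξ * (M.faceMeas σ * M.d σ) = ξ * M.d σ * M.faceMeas σ := by ring
      _ ≤ _ := mul_le_mul_of_nonneg_right h1 (faceMeas_nonneg σ)
  have hsum : ∑ σ ∈ M.edges K, volume.real (cone (M.pt K) (M.face σ)) ≤ M.cellMeas K := by
    rw [← measureReal_biUnion_finset
      (fun σ hσ σ' hσ' hne => disjoint_cone hM hξ hreg hσ hσ' hne) (fun σ hσ => (hcone σ hσ).1)
      (fun σ hσ => volume_ne_top hΩ
        ((cone_subset_closure_vol hM hσ).trans (closure_mono (hM.vol_subset K))))]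
    have hsub : (⋃ σ ∈ M.edges K, cone (M.pt K) (M.face σ)) ⊆ closure (M.vol K) :=
      iUnion₂_subset fun σ hσ => cone_subset_closure_vol hM hσ
    have hcl : volume (closure (M.vol K)) ≤ volume (M.vol K) := by
      calc volume (closure (M.vol K)) ≤ volume ((closure (M.vol K) \ M.vol K) ∪ M.vol K) := by
            apply measure_mono; rw [sdiff_union_self]; exact subset_union_left
        _ ≤ _ := (measure_union_le _ _).trans (by rw [hM.volume_closure_vol_diff, zero_add])
    exact ENNReal.toReal_mono (volume_ne_top hΩ ((hM.vol_subset K).trans subset_closure))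
      ((measure_mono hsub).trans hcl)
  rw [div_mul_eq_mul_div, le_div_iff₀ hξ, mul_comm, Finset.mul_sum]
  calc _ ≤ ∑ σ ∈ M.edges K, 2 ^ p * volume.real (cone (M.pt K) (M.face σ)) :=
        Finset.sum_le_sum fun σ hσ => (hcone σ hσ).2
    _ ≤ _ := by rw [← Finset.mul_sum]; gcongr

open Classical in
lemma volume_real_region (hM : M.IsAdmissible Ω) (hp : 0 < p) (hΩ : Bornology.IsBounded Ω)
    (S : Set M.Cell) : volume.real (M.region S) = ∑ K with K ∈ S, M.cellMeas K := by
  have h : M.region S = ⋃ K ∈ Finset.univ.filter (· ∈ S), M.vol K := by simp [region]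
  rw [h, measureReal_biUnion_finset (fun K _ L _ hne => hM.disjoint_vol hp hne)
    (fun K _ => (hM.vol_isOpen K).measurableSet)
    (fun K _ => volume_ne_top hΩ ((hM.vol_subset K).trans subset_closure))]
  rfl

open Classical in
/-- The edges which touch a set `S` of cells have a total `∑ m(σ) d_σ` bounded by the volume of
`S`. -/
lemma sum_touching_le (hM : M.IsAdmissible Ω) (hp : 0 < p) (hΩ : Bornology.IsBounded Ω) {ξ : ℝ}
    (hξ : 0 < ξ) (hreg : M.IsRegular ξ) (S : Set M.Cell) :
    ∑ σ with ∃ K ∈ S, σ ∈ M.edges K, M.faceMeas σ * M.d σ ≤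
      2 ^ p / ξ * volume.real (M.region S) := by
  have hnn : ∀ σ, 0 ≤ M.faceMeas σ * M.d σ := fun σ =>
    mul_nonneg (faceMeas_nonneg σ) (hM.d_pos σ).le
  calc ∑ σ with ∃ K ∈ S, σ ∈ M.edges K, M.faceMeas σ * M.d σ
      ≤ ∑ σ with ∃ K ∈ S, σ ∈ M.edges K, ∑ K with K ∈ S,
          if σ ∈ M.edges K then M.faceMeas σ * M.d σ else 0 := by
        refine Finset.sum_le_sum fun σ hσ => ?_
        obtain ⟨K, hK, hσK⟩ := (Finset.mem_filter.1 hσ).2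
        refine le_trans ?_ (Finset.single_le_sum (a := K) (fun L _ => ?_) (by simpa using hK))
        · rw [if_pos hσK]
        · split_ifs
          exacts [hnn σ, le_rfl]
    _ ≤ ∑ σ, ∑ K with K ∈ S, if σ ∈ M.edges K then M.faceMeas σ * M.d σ else 0 := by
        refine Finset.sum_le_sum_of_subset_of_nonneg (Finset.filter_subset _ _) fun σ _ _ => ?_
        refine Finset.sum_nonneg fun K _ => ?_
        split_ifs
        exacts [hnn σ, le_rfl]
    _ = ∑ K with K ∈ S, ∑ σ ∈ M.edges K, M.faceMeas σ * M.d σ := by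
        rw [Finset.sum_comm]
        refine Finset.sum_congr rfl fun K _ => ?_
        rw [← Finset.sum_filter, Finset.filter_mem_eq_inter, Finset.univ_inter]
    _ ≤ ∑ K with K ∈ S, 2 ^ p / ξ * M.cellMeas K :=
        Finset.sum_le_sum fun K _ => sum_faceMeas_mul_d_le hM hΩ hξ hreg K
    _ = _ := by rw [volume_real_region hM hp hΩ, Finset.mul_sum]

/-- The value of the cell function `w` on the other side of `σ`, seen from `side σ`; it is `0` on
the exterior edges. -/
def oppVal (M : Mesh p) (w : M.Cell → ℝ) (σ : M.Edge) : ℝ :=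
  match M.opp σ with
  | some L => w L
  | none => 0

/-- The interior and the Dirichlet edges. -/
def IsActive (M : Mesh p) (ΓD : Set (Pt p)) (σ : M.Edge) : Prop :=
  M.opp σ ≠ none ∨ M.IsDirichlet ΓD σ

lemma oppVal_some {w : M.Cell → ℝ} {σ : M.Edge} {L : M.Cell} (h : M.opp σ = some L) :
    M.oppVal w σ = w L := by simp [oppVal, h]

lemma oppVal_none {w : M.Cell → ℝ} {σ : M.Edge} (h : M.opp σ = none) :
    M.oppVal w σ = 0 := by simp [oppVal, h]

open Classical in
/-- The coarea inequality: the perimeters of the superlevel sets `{t < w}` add up to the total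
variation of `w`. -/
lemma mul_le_sum_of_le_perimeter {w : M.Cell → ℝ} {T q : ℝ} (hT : 0 ≤ T)
    (hq : ∀ t ∈ Ioo 0 T, q ≤ M.perimeter ΓD {K | t < w K}) :
    T * q ≤ ∑ σ with (M.IsActive ΓD σ ∧ ∃ K ∈ {K | 0 < w K}, σ ∈ M.edges K),
      M.faceMeas σ * |M.oppVal w σ - w (M.side σ)| := by
  set F : Finset M.Edge := Finset.univ.filter
    fun σ => M.IsActive ΓD σ ∧ ∃ K ∈ {K | 0 < w K}, σ ∈ M.edges K with hF
  set I : M.Edge → Set ℝ := fun σ => uIcc (w (M.side σ)) (M.oppVal w σ) with hI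
  have hper : ∀ t, 0 < t → M.perimeter ΓD {K | t < w K} ≤
      ∑ σ ∈ F, (I σ).indicator (fun _ => M.faceMeas σ) t := by
    intro t ht
    have hcond : ∀ σ, ((∃ L, M.opp σ = some L ∧
        ¬(M.side σ ∈ {K | t < w K} ↔ L ∈ {K | t < w K})) ∨
        (M.IsDirichlet ΓD σ ∧ M.side σ ∈ {K | t < w K})) → σ ∈ F ∧ t ∈ I σ := by
      rintro σ (⟨L, hL, hne⟩ | ⟨hD, hs⟩)
      · simp only [mem_ofPred_eq] at hne
        refine ⟨Finset.mem_filter.2 ⟨Finset.mem_univ _, Or.inl (by simp [hL]), ?_⟩, ?_⟩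
        · by_cases h : t < w (M.side σ)
          · exact ⟨_, ht.trans h, side_mem_edges σ⟩
          · have : t < w L := by tauto
            exact ⟨L, ht.trans this, opp_mem_edges hL⟩
        · simp only [hI, oppVal_some hL, mem_uIcc]
          by_cases h : t < w (M.side σ)
          · have : ¬ t < w L := by tauto
            exact Or.inr ⟨not_lt.1 this, h.le⟩
          · have : t < w L := by tauto
            exact Or.inl ⟨not_lt.1 h, this.le⟩
      · refine ⟨Finset.mem_filter.2 ⟨Finset.mem_univ _, Or.inr hD, _, ht.trans hs,
          side_mem_edges σ⟩, ?_⟩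
        simp only [hI, oppVal_none hD.1, mem_uIcc]
        exact Or.inr ⟨ht.le, le_of_lt hs⟩
    calc M.perimeter ΓD {K | t < w K}
        = ∑ σ with ((∃ L, M.opp σ = some L ∧
            ¬(M.side σ ∈ {K | t < w K} ↔ L ∈ {K | t < w K})) ∨
            (M.IsDirichlet ΓD σ ∧ M.side σ ∈ {K | t < w K})),
            (I σ).indicator (fun _ => M.faceMeas σ) t := by
          unfold perimeter
          refine Finset.sum_congr rfl fun σ hσ => ?_
          rw [indicator_of_mem (hcond σ (Finset.mem_filter.1 hσ).2).2]
      _ ≤ _ := by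
          refine Finset.sum_le_sum_of_subset_of_nonneg
            (fun σ hσ => (hcond σ (Finset.mem_filter.1 hσ).2).1) fun σ _ _ => ?_
          exact indicator_nonneg (fun _ _ => faceMeas_nonneg σ) _
  have hint : ∀ σ ∈ F, IntegrableOn ((I σ).indicator (fun _ => M.faceMeas σ)) (Ioo 0 T) := by
    intro σ _
    exact (integrableOn_const (by simp)).indicator measurableSet_uIcc
  calc T * q = ∫ _ in Ioo 0 T, q := by
        rw [setIntegral_const, Real.volume_real_Ioo_of_le hT, sub_zero, smul_eq_mul]
    _ ≤ ∫ t in Ioo 0 T, ∑ σ ∈ F, (I σ).indicator (fun _ => M.faceMeas σ) t := by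
        refine setIntegral_mono_on (integrableOn_const (by simp))
          (integrable_finsetSum _ hint) measurableSet_Ioo fun t ht => ?_
        exact (hq t ht).trans (hper t ht.1)
    _ = ∑ σ ∈ F, ∫ t in Ioo 0 T, (I σ).indicator (fun _ => M.faceMeas σ) t :=
        integral_finsetSum _ hint
    _ ≤ _ := by
        refine Finset.sum_le_sum fun σ _ => ?_
        rw [integral_indicator measurableSet_uIcc, Measure.restrict_restrict measurableSet_uIcc,
          setIntegral_const, smul_eq_mul, mul_comm]
        refine mul_le_mul_of_nonneg_left ?_ (faceMeas_nonneg σ)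
        rw [← Real.volume_real_interval]
        exact measureReal_mono inter_subset_left (by simp)

open Classical in
/-- The superlevel sets of a cell function are controlled by its discrete energy. -/
lemma volume_superlevel_le (hM : M.IsAdmissible Ω) (hp : 0 < p) (hΩ : Bornology.IsBounded Ω)
    {ξ : ℝ} (hξ : 0 < ξ) (hreg : M.IsRegular ξ) {C : ℝ} (hC : 0 < C)
    (hiso : ∀ S : Set M.Cell, volume.real (M.region S) ^ 2 ≤ C * M.perimeter ΓD S ^ 3)
    {w : M.Cell → ℝ} {T : ℝ} (hT : 0 ≤ T) :
    T ^ 6 * volume.real (M.region {K | T ≤ w K}) ^ 4 ≤ C ^ 2 * (2 ^ p / ξ) ^ 3 *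
      (∑ σ with M.IsActive ΓD σ, M.tau σ * (M.oppVal w σ - w (M.side σ)) ^ 2) ^ 3 *
      volume.real (M.region {K | 0 < w K}) ^ 3 := by
  set b := volume.real (M.region {K | T ≤ w K}) with hb
  have hb0 : 0 ≤ b := measureReal_nonneg
  set q : ℝ := (b ^ 2 / C) ^ (3⁻¹ : ℝ) with hq
  have hbC : 0 ≤ b ^ 2 / C := by positivity
  have hq0 : 0 ≤ q := Real.rpow_nonneg hbC _
  have hq3 : q ^ 3 = b ^ 2 / C := by
    rw [hq, ← Real.rpow_natCast, ← Real.rpow_mul hbC]; norm_num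
  have hper : ∀ t ∈ Ioo 0 T, q ≤ M.perimeter ΓD {K | t < w K} := by
    intro t ht
    refine le_of_pow_le_pow_left₀ three_ne_zero (perimeter_nonneg _) ?_
    rw [hq3, div_le_iff₀' hC]
    refine le_trans ?_ (hiso _)
    gcongr
    refine volume_real_mono hΩ ((region_subset hM _).trans subset_closure) ?_
    exact biUnion_subset_biUnion_left fun K (hK : T ≤ w K) => ht.2.trans_le hK
  have h1 := mul_le_sum_of_le_perimeter hT hper
  set E := ∑ σ with M.IsActive ΓD σ, M.tau σ * (M.oppVal w σ - w (M.side σ)) ^ 2 with hE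
  set a := volume.real (M.region {K | 0 < w K}) with ha
  have hκ : 0 < 2 ^ p / ξ := by positivity
  set κ : ℝ := 2 ^ p / ξ
  have hτ : ∀ σ, 0 ≤ M.tau σ * (M.oppVal w σ - w (M.side σ)) ^ 2 := fun σ =>
    mul_nonneg (tau_pos hM hΩ σ).le (sq_nonneg _)
  have hmd : ∀ σ, 0 ≤ M.faceMeas σ * M.d σ := fun σ =>
    mul_nonneg (faceMeas_nonneg σ) (hM.d_pos σ).le
  have hE0 : 0 ≤ E := Finset.sum_nonneg fun σ _ => hτ σ
  have h2 : (T * q) ^ 2 ≤ E * (κ * a) := by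
    refine (pow_le_pow_left₀ (by positivity) h1 2).trans ?_
    refine (Finset.sum_sq_le_sum_mul_sum_of_sq_le_mul _ (fun σ _ => hτ σ) (fun σ _ => hmd σ)
      (fun σ _ => ?_)).trans ?_
    · refine le_of_eq ?_
      rw [mul_pow, sq_abs, tau]
      field_simp [(hM.d_pos σ).ne']
    · refine mul_le_mul ?_ ?_ (Finset.sum_nonneg fun σ _ => hmd σ) hE0
      · exact Finset.sum_le_sum_of_subset_of_nonneg
          (Finset.monotone_filter_right _ fun σ _ h => h.1) fun σ _ _ => hτ σ
      · refine le_trans (Finset.sum_le_sum_of_subset_of_nonneg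
          (Finset.monotone_filter_right _ fun σ _ h => h.2) fun σ _ _ => hmd σ)
          (sum_touching_le hM hp hΩ hξ hreg _)
  have h3 : ((T * q) ^ 2) ^ 3 ≤ (E * (κ * a)) ^ 3 := pow_le_pow_left₀ (sq_nonneg _) h2 3
  calc T ^ 6 * b ^ 4 = C ^ 2 * (T ^ 6 * (b ^ 2 / C) ^ 2) := by field_simp
    _ = C ^ 2 * ((T * q) ^ 2) ^ 3 := by rw [← hq3]; ring
    _ ≤ C ^ 2 * (E * (κ * a)) ^ 3 := by gcongr
    _ = _ := by ring

end Mesh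

/-! ### Fluxes, discrete integration by parts and nonnegativity -/

lemma norm_le_linftyNorm {Ω : Set (Pt p)} (hΩ : IsPolytopalDomain Ω) {U : Pt p → Pt p}
    (hU : ContinuousOn U (closure Ω)) :
    ∀ x ∈ closure Ω, ‖U x‖ ≤ linftyNorm Ω U := by
  have hcomp : IsCompact (closure Ω) := hΩ.isBounded.isCompact_closure
  obtain ⟨R, hR⟩ := hcomp.exists_bound_of_continuousOn hU
  have hfin : eLpNorm U ∞ (volume.restrict Ω) ≠ ∞ := by
    rw [eLpNorm_exponent_top]
    refine ((eLpNormEssSup_le_of_ae_bound (C := R) ?_).trans_lt ENNReal.ofReal_lt_top).ne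
    exact (ae_restrict_iff' hΩ.isOpen.measurableSet).2
      (Filter.Eventually.of_forall fun x hx => hR x (subset_closure hx))
  have hae : ∀ᵐ x ∂(volume.restrict Ω), ‖U x‖ ≤ linftyNorm Ω U := by
    filter_upwards [ae_le_eLpNormEssSup (f := U) (μ := volume.restrict Ω)] with x hx
    rw [← eLpNorm_exponent_top] at hx
    have := ENNReal.toReal_mono hfin hx
    rwa [toReal_enorm] at this
  have hsub : Ω ⊆ closure {x ∈ Ω | ‖U x‖ ≤ linftyNorm Ω U} := by
    intro x hx
    rw [mem_closure_iff]
    intro o ho hxo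
    by_contra hne
    refine ((ho.inter hΩ.isOpen).measure_pos volume ⟨x, hxo, hx⟩).ne' ?_
    rw [ae_restrict_iff' hΩ.isOpen.measurableSet] at hae
    refine measure_mono_null ?_ hae
    rintro y ⟨hyo, hyΩ⟩ h
    exact hne ⟨y, hyo, hyΩ, h hyΩ⟩
  intro x hx
  have hcl : closure Ω = closure {x ∈ Ω | ‖U x‖ ≤ linftyNorm Ω U} :=
    Subset.antisymm (closure_minimal hsub isClosed_closure) (closure_mono (sep_subset _ _))
  rw [hcl] at hx hU
  exact le_on_closure (f := fun x => ‖U x‖) (g := fun _ => linftyNorm Ω U) (fun y hy => hy.2)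
    hU.norm continuousOn_const hx

lemma ae_abs_le_linftyNorm {Ω : Set (Pt p)} {f : Pt p → ℝ}
    (hf : MemLp f ∞ (volume.restrict Ω)) :
    ∀ᵐ x ∂(volume.restrict Ω), ‖f x‖ ≤ linftyNorm Ω f := by
  filter_upwards [ae_le_eLpNormEssSup (f := f) (μ := volume.restrict Ω)] with x hx
  rw [← eLpNorm_exponent_top] at hx
  have := ENNReal.toReal_mono hf.2.ne hx
  rwa [toReal_enorm] at this

/-- This holds also for non-integrable functions, whose mean value is `0`. -/
lemma abs_average_le {α : Type*} [MeasurableSpace α] {μ : Measure α} {f : α → ℝ} {C : ℝ}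
    (hC : 0 ≤ C) (hf : ∀ᵐ x ∂μ, ‖f x‖ ≤ C) : |⨍ x, f x ∂μ| ≤ C := by
  by_cases hμ : μ univ = ∞
  · simpa [average_eq, Measure.real, hμ] using hC
  have : IsFiniteMeasure μ := ⟨lt_top_iff_ne_top.2 hμ⟩
  rw [average_eq, smul_eq_mul, abs_mul, abs_inv, abs_of_nonneg measureReal_nonneg]
  have h : |∫ x, f x ∂μ| ≤ C * μ.real univ := norm_integral_le_of_norm_le_const hf
  rcases (measureReal_nonneg (μ := μ) (s := univ)).eq_or_lt with h0 | h0
  · rw [← h0]; simpa using hC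
  · rw [inv_mul_le_iff₀ h0, mul_comm]; exact h

lemma linftyNorm_nonneg {F : Type*} [NormedAddCommGroup F] (Ω : Set (Pt p)) (g : Pt p → F) :
    0 ≤ linftyNorm Ω g := ENNReal.toReal_nonneg

lemma sq_log_sub_log_le {u v : ℝ} (hv : 0 < v) (huv : v ≤ u) :
    (Real.log u - Real.log v) ^ 2 ≤ (u - v) ^ 2 / (u * v) := by
  have hu : 0 < u := hv.trans_le huv
  set z := Real.log u - Real.log v with hz
  have hz0 : 0 ≤ z / 2 := by
    have := Real.log_le_log hv huv
    rw [hz]; linarith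
  have he : Real.exp (z / 2) ^ 2 = u / v := by
    rw [← Real.exp_nat_mul, hz, ← Real.log_div hu.ne' hv.ne']
    convert Real.exp_log (div_pos hu hv) using 2
    push_cast; ring
  have hem : Real.exp (-(z / 2)) ^ 2 = v / u := by
    rw [Real.exp_neg, inv_pow, he, inv_div]
  have hprod : Real.exp (z / 2) * Real.exp (-(z / 2)) = 1 := by
    rw [← Real.exp_add, add_neg_cancel, Real.exp_zero]
  have h1 := pow_le_pow_left₀ hz0 (Real.self_le_sinh_iff.2 hz0) 2
  rw [Real.sinh_eq] at h1
  calc z ^ 2 = 4 * (z / 2) ^ 2 := by ring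
    _ ≤ 4 * ((Real.exp (z / 2) - Real.exp (-(z / 2))) / 2) ^ 2 := by gcongr
    _ = Real.exp (z / 2) ^ 2 + Real.exp (-(z / 2)) ^ 2 -
        2 * (Real.exp (z / 2) * Real.exp (-(z / 2))) := by ring
    _ = (u - v) ^ 2 / (u * v) := by
        rw [he, hem, hprod]; field_simp; ring

/-- The flux through an edge, tested with `a / (1 + a)` where `a = (v - C)⁺`: the diffusive part
dominates the square of the jump of `log (1 + a)`, up to the convective part. -/
lemma flux_mul_ge {Bp Bm s β x y C : ℝ} (hs : Bp - Bm = -s) (hβ : 0 < β) (hp : β ≤ Bp)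
    (hm : β ≤ Bm) (hx : 0 ≤ x) (hy : 0 ≤ y) (hC2 : C ≤ 2) :
    β / 2 * (Real.log (1 + max (y - C) 0) - Real.log (1 + max (x - C) 0)) ^ 2 - 2 * s ^ 2 / β ≤
      (Bm * x - Bp * y) * (max (x - C) 0 / (1 + max (x - C) 0) -
        max (y - C) 0 / (1 + max (y - C) 0)) := by
  wlog hxy : y ≤ x generalizing Bp Bm s x y
  · have h := this (Bp := Bm) (Bm := Bp) (s := -s) (x := y) (y := x) (by linarith) hm hp hy hx
      (le_of_not_ge hxy)
    calc _ = _ := by rw [neg_sq s]; ring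
      _ ≤ _ := h
      _ = _ := by ring
  set a := max (x - C) 0 with ha
  set b := max (y - C) 0 with hb
  have ha0 : 0 ≤ a := le_max_right _ _
  have hb0 : 0 ≤ b := le_max_right _ _
  have hba : b ≤ a := max_le_max_right _ (by linarith)
  have hab : a - b ≤ x - y := by
    have : a ≤ (x - y) + b := max_le (by linarith [le_max_left (y - C) 0]) (by linarith)
    linarith
  have hyb : y ≤ 2 * (1 + b) := by linarith [le_max_left (y - C) 0]
  set e := (a - b) / (1 + a) with he
  set D := (a - b) ^ 2 / ((1 + a) * (1 + b)) with hD
  have he0 : 0 ≤ e := div_nonneg (by linarith) (by linarith)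
  have hlog : (Real.log (1 + b) - Real.log (1 + a)) ^ 2 ≤ D := by
    have h := sq_log_sub_log_le (u := 1 + a) (v := 1 + b) (by linarith) (by linarith)
    rw [add_sub_add_left_eq_sub] at h
    calc _ = (Real.log (1 + a) - Real.log (1 + b)) ^ 2 := by ring
      _ ≤ _ := h
  have heD : e ^ 2 ≤ D := by
    rw [he, div_pow, hD]
    exact div_le_div_of_nonneg_left (sq_nonneg _) (by positivity) (by nlinarith)
  have hφ : a / (1 + a) - b / (1 + b) = (a - b) / ((1 + a) * (1 + b)) := by
    field_simp; ring
  have hφ0 : 0 ≤ (a - b) / ((1 + a) * (1 + b)) := div_nonneg (by linarith) (by positivity)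
  have h1 : β * D ≤ Bm * (x - y) * ((a - b) / ((1 + a) * (1 + b))) := by
    calc β * D = β * (a - b) * ((a - b) / ((1 + a) * (1 + b))) := by rw [hD]; ring
      _ ≤ _ := by gcongr; linarith
  have h2 : |s * y * ((a - b) / ((1 + a) * (1 + b)))| ≤ 2 * |s| * e := by
    rw [abs_mul, abs_mul, abs_of_nonneg hy, abs_of_nonneg hφ0]
    calc |s| * y * ((a - b) / ((1 + a) * (1 + b)))
        ≤ |s| * (2 * (1 + b)) * ((a - b) / ((1 + a) * (1 + b))) := by gcongr
      _ = 2 * |s| * e := by rw [he]; field_simp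
  have h3 : 2 * |s| * e ≤ β / 2 * e ^ 2 + 2 * s ^ 2 / β := by
    have h4 : β / 2 * e ^ 2 + 2 * s ^ 2 / β - 2 * |s| * e = (β * e - 2 * |s|) ^ 2 / (2 * β) := by
      rw [← sq_abs s]; field_simp; ring
    have h5 : 0 ≤ (β * e - 2 * |s|) ^ 2 / (2 * β) := by positivity
    linarith
  have h6 : β / 2 * (Real.log (1 + b) - Real.log (1 + a)) ^ 2 ≤ β / 2 * D := by gcongr
  have h7 : β / 2 * e ^ 2 ≤ β / 2 * D := by gcongr
  rw [hφ]
  have h8 : (Bm * x - Bp * y) * ((a - b) / ((1 + a) * (1 + b))) =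
      Bm * (x - y) * ((a - b) / ((1 + a) * (1 + b))) +
        s * y * ((a - b) / ((1 + a) * (1 + b))) := by
    rw [← add_mul]; congr 1; linear_combination -y * hs
  have h9 := neg_abs_le (s * y * ((a - b) / ((1 + a) * (1 + b))))
  rw [h8]
  linarith

namespace Mesh

variable {M : Mesh p} {Ω ΓD ΓN : Set (Pt p)} {U : Pt p → Pt p} {b f vD : Pt p → ℝ} {B : ℝ → ℝ}
  {v : M.Cell → ℝ}

lemma sum_sum_edges (hM : M.IsAdmissible Ω) (g : M.Cell → M.Edge → ℝ) :
    ∑ K, ∑ σ ∈ M.edges K, g K σ =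
      ∑ σ, (g (M.side σ) σ + M.oppVal (fun K => g K σ) σ) := by
  classical
  calc ∑ K, ∑ σ ∈ M.edges K, g K σ
      = ∑ K, ∑ σ, if σ ∈ M.edges K then g K σ else 0 := by
        refine Finset.sum_congr rfl fun K _ => ?_
        rw [← Finset.sum_filter, Finset.filter_mem_eq_inter, Finset.univ_inter]
    _ = ∑ σ, ∑ K, if σ ∈ M.edges K then g K σ else 0 := Finset.sum_comm
    _ = _ := by
        refine Finset.sum_congr rfl fun σ _ => ?_
        rcases h : M.opp σ with _ | L
        · rw [oppVal_none h, add_zero]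
          simp [mem_edges, h]
        · rw [oppVal_some h]
          have hne := (hM.interior_edge σ L h).1
          have : ∀ K, (if σ ∈ M.edges K then g K σ else 0) =
              (if M.side σ = K then g K σ else 0) + if L = K then g K σ else 0 := by
            intro K
            by_cases h1 : M.side σ = K
            · have h2 : L ≠ K := h1 ▸ hne
              simp [mem_edges, h, h1, h2]
            · simp [mem_edges, h, h1]
          simp [this, Finset.sum_add_distrib]

lemma normalVel_opp (hM : M.IsAdmissible Ω) (hp : 0 < p) {σ : M.Edge} {L : M.Cell}
    (h : M.opp σ = some L) : M.normalVel U L σ = -M.normalVel U (M.side σ) σ := by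
  unfold normalVel
  rw [hM.normal_opp hp h]
  simp only [inner_neg_right, average_eq, integral_neg, smul_neg]

lemma flux_side {σ : M.Edge} (hσ : ¬ M.IsNeumann ΓN σ) :
    M.flux ΓN U vD B v (M.side σ) σ = M.tau σ *
      (B (-(M.normalVel U (M.side σ) σ * M.d σ)) * v (M.side σ) -
        B (M.normalVel U (M.side σ) σ * M.d σ) * M.otherVal vD v (M.side σ) σ) := by
  unfold flux
  rw [if_neg hσ]

lemma otherVal_some {σ : M.Edge} {L : M.Cell} (h : M.opp σ = some L) :
    M.otherVal vD v (M.side σ) σ = v L := by simp [otherVal, h]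

lemma otherVal_none {K : M.Cell} {σ : M.Edge} (h : M.opp σ = none) :
    M.otherVal vD v K σ = M.faceAvg vD σ := by simp [otherVal, h]

lemma not_isNeumann_of_opp {σ : M.Edge} {L : M.Cell} (h : M.opp σ = some L) :
    ¬ M.IsNeumann ΓN σ := fun hN => by
  have := hN.1
  rw [h] at this
  cases this

lemma not_isNeumann_of_isActive (hM : M.IsAdmissible Ω) (hdisj : Disjoint ΓD ΓN) {σ : M.Edge}
    (hσ : M.IsActive ΓD σ) : ¬ M.IsNeumann ΓN σ := by
  intro hN
  rcases hσ with h | h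
  · exact h hN.1
  · obtain ⟨y, hy⟩ := hM.face_nonempty σ
    exact disjoint_left.1 hdisj (h.2 hy) (hN.2 hy)

/-- The scheme is conservative. -/
lemma flux_opp (hM : M.IsAdmissible Ω) (hp : 0 < p) {σ : M.Edge} {L : M.Cell}
    (h : M.opp σ = some L) :
    M.flux ΓN U vD B v L σ = -M.flux ΓN U vD B v (M.side σ) σ := by
  have hne := (hM.interior_edge σ L h).1
  rw [flux_side (not_isNeumann_of_opp h), otherVal_some h]
  unfold flux
  rw [if_neg (not_isNeumann_of_opp h), normalVel_opp hM hp h]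
  simp only [otherVal, h, if_neg hne]
  rw [neg_mul, neg_neg]
  ring

open Classical in
/-- Discrete integration by parts: the scheme tested with a cell function `φ`, extended by `0` to
the Dirichlet edges. -/
lemma IsSolution.sum_flux_mul (hv : M.IsSolution ΓN U b f vD B v) (hM : M.IsAdmissible Ω)
    (hC : M.IsCompatible ΓD ΓN) (hp : 0 < p) (φ : M.Cell → ℝ) :
    ∑ σ with M.IsActive ΓD σ, M.flux ΓN U vD B v (M.side σ) σ * (φ (M.side σ) - M.oppVal φ σ) =
      ∑ K, φ K * (M.cellMeas K * (M.cellAvg f K - M.cellAvg b K * v K)) := by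
  have h1 : ∑ K, φ K * (M.cellMeas K * (M.cellAvg f K - M.cellAvg b K * v K)) =
      ∑ K, ∑ σ ∈ M.edges K, φ K * M.flux ΓN U vD B v K σ := by
    refine Finset.sum_congr rfl fun K _ => ?_
    rw [← Finset.mul_sum]
    congr 1
    linarith [hv K]
  rw [h1, sum_sum_edges hM, Finset.sum_filter]
  refine Finset.sum_congr rfl fun σ _ => ?_
  rcases h : M.opp σ with _ | L
  · rw [oppVal_none h, oppVal_none h]
    split_ifs with hA
    · ring
    · have hN : M.IsNeumann ΓN σ := (hC σ h).resolve_left fun hD => hA (Or.inr hD)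
      unfold flux
      rw [if_pos hN]; simp
  · rw [oppVal_some h, oppVal_some h, flux_opp hM hp h]
    have hA : M.IsActive ΓD σ := Or.inl (by simp [h])
    rw [if_pos hA]
    ring

lemma cellAvg_nonneg (hM : M.IsAdmissible Ω)
    (hb : ∀ᵐ x ∂(volume.restrict Ω), 0 ≤ b x) (K : M.Cell) : 0 ≤ M.cellAvg b K := by
  unfold cellAvg
  rw [average_eq, smul_eq_mul]
  refine mul_nonneg (inv_nonneg.2 measureReal_nonneg) (integral_nonneg_of_ae ?_)
  exact ae_restrict_of_ae_restrict_of_subset (hM.vol_subset K) hb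

lemma cellAvg_le_linftyNorm (hM : M.IsAdmissible Ω)
    (hf : MemLp f ∞ (volume.restrict Ω)) (K : M.Cell) : M.cellAvg f K ≤ linftyNorm Ω f :=
  (le_abs_self _).trans (abs_average_le (linftyNorm_nonneg Ω f)
    (ae_restrict_of_ae_restrict_of_subset (hM.vol_subset K) (ae_abs_le_linftyNorm hf)))

lemma abs_normalVel_le (hM : M.IsAdmissible Ω) (hΩ : IsPolytopalDomain Ω)
    (hU : ContinuousOn U (closure Ω)) {K : M.Cell} {σ : M.Edge} (hσ : σ ∈ M.edges K) :
    |M.normalVel U K σ| ≤ linftyNorm Ω U := by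
  refine abs_average_le (linftyNorm_nonneg Ω U) ?_
  refine (ae_restrict_iff' (hM.measurableSet_face σ)).2 (Filter.Eventually.of_forall fun x hx => ?_)
  have h1 := norm_inner_le_norm (𝕜 := ℝ) (U x) (M.normal K σ)
  rw [hM.normal_norm K σ hσ, mul_one] at h1
  exact h1.trans (norm_le_linftyNorm hΩ hU x
    (closure_mono (hM.vol_subset K) (hM.face_subset hσ hx)))

/-- The solution is nonnegative: the set of the cells with negative values has no perimeter. -/
theorem IsSolution.nonneg (hv : M.IsSolution ΓN U b f vD B v) (hM : M.IsAdmissible Ω)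
    (hC : M.IsCompatible ΓD ΓN) (hp : 0 < p) (hΩ : IsPolytopalDomain Ω) (hdisj : Disjoint ΓD ΓN)
    {c : ℝ}
    (hiso : ∀ S : Set M.Cell, volume.real (M.region S) ^ 2 ≤ c * M.perimeter ΓD S ^ 3)
    (hB : IsSchemeFunction B) (hb : ∀ᵐ x ∂(volume.restrict Ω), 0 ≤ b x)
    (hf : ∀ K, 0 ≤ M.cellAvg f K)
    (hvD : ∀ σ, M.IsDirichlet ΓD σ → M.faceAvg vD σ ∈ Icc (0 : ℝ) 1) : ∀ K, 0 ≤ v K := by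
  classical
  set N : Set M.Cell := {K | v K < 0} with hN
  set φ : M.Cell → ℝ := fun K => if v K < 0 then 1 else 0 with hφ
  have hsum := hv.sum_flux_mul hM hC hp φ
  have hright : 0 ≤ ∑ K, φ K * (M.cellMeas K * (M.cellAvg f K - M.cellAvg b K * v K)) := by
    refine Finset.sum_nonneg fun K _ => ?_
    by_cases h : v K < 0
    · have h1 := cellAvg_nonneg hM hb K
      have h2 := (cellMeas_pos hM hΩ.isBounded K).le
      have h3 : M.cellAvg b K * v K ≤ 0 := mul_nonpos_of_nonneg_of_nonpos h1 h.le
      rw [hφ]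
      simp only [h, if_true, one_mul]
      exact mul_nonneg h2 (by linarith [hf K])
    · simp [hφ, h]
  rw [← hsum] at hright
  have hterm : ∀ σ, M.IsActive ΓD σ →
      M.flux ΓN U vD B v (M.side σ) σ * (φ (M.side σ) - M.oppVal φ σ) ≤ 0 ∧
      (((∃ L, M.opp σ = some L ∧ ¬(M.side σ ∈ N ↔ L ∈ N)) ∨
        (M.IsDirichlet ΓD σ ∧ M.side σ ∈ N)) →
      M.flux ΓN U vD B v (M.side σ) σ * (φ (M.side σ) - M.oppVal φ σ) < 0) := by
    intro σ hσ
    have hτ := tau_pos hM hΩ.isBounded σ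
    rw [flux_side (not_isNeumann_of_isActive hM hdisj hσ)]
    have hB1 := hB.pos (-(M.normalVel U (M.side σ) σ * M.d σ))
    have hB2 := hB.pos (M.normalVel U (M.side σ) σ * M.d σ)
    set x := v (M.side σ) with hx
    -- a jump from a negative to a nonnegative value gives a strictly negative flux
    have hneg : ∀ y, x < 0 → 0 ≤ y → M.tau σ * (B (-(M.normalVel U (M.side σ) σ * M.d σ)) * x -
        B (M.normalVel U (M.side σ) σ * M.d σ) * y) < 0 := fun y h1 h2 =>
      mul_neg_of_pos_of_neg hτ (by nlinarith [mul_neg_of_pos_of_neg hB1 h1, mul_nonneg hB2.le h2])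
    have hpos : ∀ y, 0 ≤ x → y < 0 → 0 < M.tau σ *
        (B (-(M.normalVel U (M.side σ) σ * M.d σ)) * x -
        B (M.normalVel U (M.side σ) σ * M.d σ) * y) := fun y h1 h2 =>
      mul_pos hτ (by nlinarith [mul_neg_of_pos_of_neg hB2 h2, mul_nonneg hB1.le h1])
    rcases h : M.opp σ with _ | L
    · have hD : M.IsDirichlet ΓD σ := hσ.resolve_left fun h' => h' h
      rw [oppVal_none h, otherVal_none h, sub_zero]
      by_cases hx0 : x < 0
      · have := hneg _ hx0 (hvD σ hD).1
        simp only [hφ, ← hx, hx0, if_true, mul_one]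
        exact ⟨this.le, fun _ => this⟩
      · simp only [hφ, ← hx, hx0, if_false, mul_zero]
        refine ⟨le_rfl, ?_⟩
        rintro (⟨L, hL, -⟩ | ⟨-, h'⟩)
        · cases hL
        · exact absurd h' hx0
    · rw [oppVal_some h, otherVal_some h]
      by_cases hx0 : x < 0 <;> by_cases hy0 : v L < 0
      · simp only [hφ, ← hx, hx0, hy0, if_true, sub_self, mul_zero]
        refine ⟨le_rfl, ?_⟩
        rintro (⟨L', hL', h'⟩ | ⟨⟨h', -⟩, -⟩)
        · obtain rfl : L = L' := by simpa using hL'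
          exact absurd (iff_of_true hx0 hy0) h'
        · rw [h] at h'; cases h'
      · have := hneg _ hx0 (not_lt.1 hy0)
        simp only [hφ, ← hx, hx0, hy0, if_true, if_false, sub_zero, mul_one]
        exact ⟨this.le, fun _ => this⟩
      · have := hpos _ (not_lt.1 hx0) hy0
        simp only [hφ, ← hx, hx0, hy0, if_true, if_false, zero_sub, mul_neg, mul_one]
        exact ⟨by linarith, fun _ => by linarith⟩
      · simp only [hφ, ← hx, hx0, hy0, if_false, sub_self, mul_zero]
        refine ⟨le_rfl, ?_⟩
        rintro (⟨L', hL', h'⟩ | ⟨⟨h', -⟩, -⟩)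
        · obtain rfl : L = L' := by simpa using hL'
          exact absurd (iff_of_false hx0 hy0) h'
        · rw [h] at h'; cases h'
  have hzero := (Finset.sum_eq_zero_iff_of_nonpos fun σ hσ =>
    (hterm σ (Finset.mem_filter.1 hσ).2).1).1
    (le_antisymm (Finset.sum_nonpos fun σ hσ => (hterm σ (Finset.mem_filter.1 hσ).2).1) hright)
  have hper : M.perimeter ΓD N = 0 := by
    unfold perimeter
    rw [Finset.filter_eq_empty_iff.2, Finset.sum_empty]
    intro σ _ hσ
    have hA : M.IsActive ΓD σ := by
      rcases hσ with ⟨L, hL, -⟩ | ⟨hD, -⟩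
      · exact Or.inl (by simp [hL])
      · exact Or.inr hD
    exact ((hterm σ hA).2 hσ).ne (hzero σ (Finset.mem_filter.2 ⟨Finset.mem_univ _, hA⟩))
  have hvol := hiso N
  rw [hper, zero_pow three_ne_zero, mul_zero] at hvol
  have hvol0 : volume.real (M.region N) = 0 :=
    pow_eq_zero_iff two_ne_zero |>.1 (le_antisymm hvol (sq_nonneg _))
  intro K
  by_contra hK
  have hKN : M.vol K ⊆ M.region N := subset_biUnion_of_mem (u := fun K => M.vol K)
    (show K ∈ N from not_le.1 hK)
  have h1 := cellMeas_pos hM hΩ.isBounded K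
  have h2 := volume_real_mono hΩ.isBounded ((region_subset hM N).trans subset_closure) hKN
  rw [hvol0] at h2
  exact absurd h2 (not_le.2 h1)

end Mesh

/-! ### The energy estimate and De Giorgi's iteration -/

lemma bddBelow_image_schemeFunction {B : ℝ → ℝ} (hB : IsSchemeFunction B) (g : ℝ → ℝ)
    (I : Set ℝ) : BddBelow ((fun x => B (g x)) '' I) :=
  ⟨0, by rintro _ ⟨x, -, rfl⟩; exact (hB.pos _).le⟩

lemma beta_pos (Ω : Set (Pt p)) (U : Pt p → Pt p) {B : ℝ → ℝ} (hB : IsSchemeFunction B) :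
    0 < beta Ω U B := by
  obtain ⟨C, hC⟩ := hB.lipschitz
  have hn := linftyNorm_nonneg Ω U
  obtain ⟨x, -, hx⟩ := (isCompact_Icc.image (f := fun x => B (Metric.diam Ω * x))
    (hC.continuous.comp (by fun_prop))).sInf_mem
    ((nonempty_Icc.2 (by linarith : -linftyNorm Ω U ≤ linftyNorm Ω U)).image _)
  rw [beta, ← hx]
  exact hB.pos _

lemma beta_le_one (Ω : Set (Pt p)) (U : Pt p → Pt p) {B : ℝ → ℝ} (hB : IsSchemeFunction B) :
    beta Ω U B ≤ 1 := by
  have hn := linftyNorm_nonneg Ω U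
  exact csInf_le (bddBelow_image_schemeFunction hB _ _) ⟨0, ⟨by linarith, hn⟩, by simp [hB.zero]⟩

lemma beta_le (Ω : Set (Pt p)) (U : Pt p → Pt p) {B : ℝ → ℝ} (hB : IsSchemeFunction B)
    {u d : ℝ} (hu : |u| ≤ linftyNorm Ω U) (hd : 0 < d) (hdΩ : d ≤ Metric.diam Ω) :
    beta Ω U B ≤ B (u * d) := by
  have hΩ : 0 < Metric.diam Ω := hd.trans_le hdΩ
  refine csInf_le (bddBelow_image_schemeFunction hB _ _) ⟨u * d / Metric.diam Ω, ?_, ?_⟩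
  · refine abs_le.1 (le_trans ?_ hu)
    rw [abs_div, abs_mul, abs_of_pos hd, abs_of_pos hΩ, div_le_iff₀ hΩ]
    gcongr
  · simp only
    rw [mul_div_cancel₀ _ hΩ.ne']

lemma one_le_threshold {m : ℕ} (hm : 1 ≤ m) : 1 ≤ Mesh.threshold m := by
  have h : (2 : ℝ) ≤ 2 ^ m := le_self_pow₀ one_le_two (by omega)
  have h2 : ((2 : ℝ) ^ m)⁻¹ ≤ 2⁻¹ := inv_anti₀ two_pos h
  unfold Mesh.threshold
  linarith

lemma threshold_lt_two (m : ℕ) : Mesh.threshold m < 2 := by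
  have h : (0 : ℝ) < (2 ^ m)⁻¹ := by positivity
  unfold Mesh.threshold
  linarith

lemma threshold_succ (m : ℕ) : Mesh.threshold (m + 1) = Mesh.threshold m + (2 ^ m)⁻¹ := by
  unfold Mesh.threshold
  rw [pow_succ, mul_inv]
  ring

lemma half_pow_le_log (m : ℕ) : (1 / 2 : ℝ) ^ (m + 1) ≤ Real.log (1 + (2 ^ m)⁻¹) := by
  have h0 : (0 : ℝ) < (2 ^ m)⁻¹ := by positivity
  have h1 : ((2 : ℝ) ^ m)⁻¹ ≤ 1 := inv_le_one_of_one_le₀ (one_le_pow₀ one_le_two)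
  have h2 := Real.one_sub_inv_le_log_of_pos (by linarith : (0 : ℝ) < 1 + (2 ^ m)⁻¹)
  refine le_trans ?_ h2
  rw [pow_succ, one_div, inv_pow]
  set x : ℝ := (2 ^ m)⁻¹
  have h3 : 1 - (1 + x)⁻¹ = x / (1 + x) := by field_simp; ring
  rw [h3, le_div_iff₀ (by linarith)]
  nlinarith

/-- The nonlinear recursion of De Giorgi's method: the measures `a m` of the superlevel sets decay
geometrically, provided that the first energy `e 1` is small. -/
lemma le_geometric_of_recursion {a e : ℕ → ℝ} (ha : ∀ m, 0 ≤ a m) (he : ∀ m, 0 ≤ e m)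
    {β Z A G V η θ : ℝ} (hβ : 0 < β) (hZ : 0 ≤ Z) (hA : 0 ≤ A) (hG : 0 ≤ G) (hθ0 : 0 ≤ θ)
    (henergy : ∀ m ≥ 1, β ^ 2 * e m ≤ G * Z * a m)
    (hlevel : ∀ m ≥ 1, a (m + 1) ^ 4 ≤ 64 ^ (m + 1) * A * e m ^ 3 * a m ^ 3)
    (hV : a 1 ≤ V) (hsmall : e 1 * Z ^ 2 ≤ η * β ^ 4)
    (hη : 64 ^ 2 * A * V ^ 3 * η ^ 3 ≤ θ ^ 2) (hθ : A * G ^ 3 * 64 ^ 3 * 8 ^ 4 * θ ≤ 1) (j : ℕ) :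
    a (j + 2) ≤ a 2 * (1 / 8) ^ j := by
  have hV0 : 0 ≤ V := (ha 1).trans hV
  have he1 := he 1
  have ha2 := ha 2
  have hstart : Z ^ 3 * a 2 ^ 2 ≤ θ * β ^ 6 := by
    refine le_of_sq_le_sq ?_ (by positivity)
    calc (Z ^ 3 * a 2 ^ 2) ^ 2 = Z ^ 6 * a (1 + 1) ^ 4 := by ring
      _ ≤ Z ^ 6 * (64 ^ (1 + 1) * A * e 1 ^ 3 * a 1 ^ 3) := by
          gcongr; exact hlevel 1 le_rfl
      _ ≤ Z ^ 6 * (64 ^ (1 + 1) * A * e 1 ^ 3 * V ^ 3) := by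
          gcongr; exact ha 1
      _ = 64 ^ 2 * A * V ^ 3 * (e 1 * Z ^ 2) ^ 3 := by ring
      _ ≤ 64 ^ 2 * A * V ^ 3 * (η * β ^ 4) ^ 3 := by gcongr
      _ = 64 ^ 2 * A * V ^ 3 * η ^ 3 * β ^ 12 := by ring
      _ ≤ θ ^ 2 * β ^ 12 := by gcongr
      _ = (θ * β ^ 6) ^ 2 := by ring
  induction j with
  | zero => simp
  | succ j ih =>
    have haj := ha (j + 2)
    have hej := he (j + 2)
    refine le_of_pow_le_pow_left₀ four_ne_zero (by positivity) ?_
    have hβ6 : 0 < β ^ 6 := by positivity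
    refine le_of_mul_le_mul_left ?_ hβ6
    calc β ^ 6 * a (j + 1 + 2) ^ 4
        ≤ β ^ 6 * (64 ^ (j + 2 + 1) * A * e (j + 2) ^ 3 * a (j + 2) ^ 3) := by
          gcongr
          exact hlevel (j + 2) (by omega)
      _ = 64 ^ (j + 3) * A * (β ^ 2 * e (j + 2)) ^ 3 * a (j + 2) ^ 3 := by ring
      _ ≤ 64 ^ (j + 3) * A * (G * Z * a (j + 2)) ^ 3 * a (j + 2) ^ 3 := by
          have h3 := pow_le_pow_left₀ (by positivity) (henergy (j + 2) (by omega)) 3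
          gcongr ?_ * _
          exact mul_le_mul_of_nonneg_left h3 (by positivity)
      _ = 64 ^ (j + 3) * A * G ^ 3 * Z ^ 3 * a (j + 2) ^ 6 := by ring
      _ ≤ 64 ^ (j + 3) * A * G ^ 3 * Z ^ 3 * (a 2 * (1 / 8) ^ j) ^ 6 := by gcongr
      _ = A * G ^ 3 * 64 ^ 3 * 8 ^ 4 * (Z ^ 3 * a 2 ^ 2) * (a 2 * (1 / 8) ^ (j + 1)) ^ 4 := by
          have h64 : (64 : ℝ) ^ (j + 3) = 64 ^ 3 * 64 ^ j := by ring
          have hj : (64 : ℝ) ^ j * (1 / 8) ^ j * (1 / 8) ^ j = 1 := by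
            rw [← mul_pow, ← mul_pow]; norm_num
          rw [h64, pow_succ (1 / 8 : ℝ) j]
          linear_combination (64 ^ 3 * A * G ^ 3 * Z ^ 3 * a 2 ^ 6 * ((1 / 8) ^ j) ^ 4) * hj
      _ ≤ A * G ^ 3 * 64 ^ 3 * 8 ^ 4 * (θ * β ^ 6) * (a 2 * (1 / 8) ^ (j + 1)) ^ 4 := by gcongr
      _ = (A * G ^ 3 * 64 ^ 3 * 8 ^ 4 * θ) * (β ^ 6 * (a 2 * (1 / 8) ^ (j + 1)) ^ 4) := by ring
      _ ≤ 1 * (β ^ 6 * (a 2 * (1 / 8) ^ (j + 1)) ^ 4) := by gcongr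
      _ = _ := one_mul _

namespace Mesh

variable {M : Mesh p} {Ω ΓD ΓN : Set (Pt p)} {U : Pt p → Pt p} {b f vD : Pt p → ℝ} {B : ℝ → ℝ}
  {v : M.Cell → ℝ}

/-- Truncation at a level `C ≥ 1` removes the Dirichlet data. -/
lemma oppVal_truncation (hvD : ∀ σ, M.IsDirichlet ΓD σ → M.faceAvg vD σ ∈ Icc (0 : ℝ) 1)
    {C : ℝ} (hC : 1 ≤ C) {g : ℝ → ℝ} (hg : g 0 = 0) {σ : M.Edge} (hσ : M.IsActive ΓD σ) :
    M.oppVal (fun K => g (max (v K - C) 0)) σ =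
      g (max (M.otherVal vD v (M.side σ) σ - C) 0) := by
  rcases h : M.opp σ with _ | L
  · have hD := hvD σ (hσ.resolve_left fun h' => h' h)
    rw [oppVal_none h, otherVal_none h, max_eq_right (by linarith [hD.2]), hg]
  · rw [oppVal_some h, otherVal_some h]

open Classical in
lemma energy_eq (hvD : ∀ σ, M.IsDirichlet ΓD σ → M.faceAvg vD σ ∈ Icc (0 : ℝ) 1)
    {m : ℕ} (hm : 1 ≤ m) :
    M.energy ΓD vD v m = ∑ σ with M.IsActive ΓD σ, M.tau σ *
      (M.oppVal (fun K => Real.log (1 + max (v K - threshold m) 0)) σ -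
        Real.log (1 + max (v (M.side σ) - threshold m) 0)) ^ 2 := by
  unfold energy
  refine Finset.sum_congr
    (by ext σ; simp only [Finset.mem_filter, Finset.mem_univ, true_and]; rfl) fun σ hσ => ?_
  rw [oppVal_truncation (g := fun x => Real.log (1 + x)) hvD (one_le_threshold hm) (by simp)
    (Finset.mem_filter.1 hσ).2]

/-- The energy estimate. The scheme is tested with `φ = a / (1 + a)`, `a = (v - C_m)⁺`; this
controls the energy of `log (1 + a)`. -/
lemma IsSolution.energy_le (hv : M.IsSolution ΓN U b f vD B v) (hM : M.IsAdmissible Ω)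
    (hCo : M.IsCompatible ΓD ΓN) (hp : 0 < p) (hΩ : IsPolytopalDomain Ω) (hdisj : Disjoint ΓD ΓN)
    {ξ : ℝ} (hξ : 0 < ξ) (hreg : M.IsRegular ξ) (hU : ContinuousOn U (closure Ω))
    (hB : IsSchemeFunction B) (hb : ∀ᵐ x ∂(volume.restrict Ω), 0 ≤ b x)
    (hf : MemLp f ∞ (volume.restrict Ω))
    (hvD : ∀ σ, M.IsDirichlet ΓD σ → M.faceAvg vD σ ∈ Icc (0 : ℝ) 1) (hv0 : ∀ K, 0 ≤ v K)
    {m : ℕ} (hm : 1 ≤ m) :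
    beta Ω U B ^ 2 * M.energy ΓD vD v m ≤ (4 * (2 ^ p / ξ) + 2) *
      (linftyNorm Ω U ^ 2 + linftyNorm Ω f) *
      volume.real (M.region {K | threshold m < v K}) := by
  classical
  have hb' := hΩ.isBounded
  rw [energy_eq hvD hm]
  set C := threshold m with hC
  have hC1 : 1 ≤ C := one_le_threshold hm
  have hC2 : C ≤ 2 := (threshold_lt_two m).le
  set β := beta Ω U B with hβdef
  have hβ : 0 < β := beta_pos Ω U hB
  have hβ1 : β ≤ 1 := beta_le_one Ω U hB
  set nU := linftyNorm Ω U with hnU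
  set nf := linftyNorm Ω f with hnf
  have hnf0 : 0 ≤ nf := linftyNorm_nonneg Ω f
  set A : Set M.Cell := {K | C < v K} with hA
  set κ : ℝ := 2 ^ p / ξ with hκ
  have hκ0 : 0 ≤ κ := by positivity
  set φ : M.Cell → ℝ := fun K => max (v K - C) 0 / (1 + max (v K - C) 0) with hφ
  set w : M.Cell → ℝ := fun K => Real.log (1 + max (v K - C) 0) with hw
  have hvol := volume_real_region hM hp hb' A
  set V := volume.real (M.region A) with hVdef
  have hV0 : 0 ≤ V := measureReal_nonneg
  have hsum := hv.sum_flux_mul hM hCo hp φ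
  have hright : ∑ K, φ K * (M.cellMeas K * (M.cellAvg f K - M.cellAvg b K * v K)) ≤ nf * V := by
    rw [hvol, Finset.mul_sum, Finset.sum_filter]
    refine Finset.sum_le_sum fun K _ => ?_
    have hm0 := (cellMeas_pos hM hb' K).le
    by_cases hK : C < v K
    · rw [if_pos (show K ∈ A from hK)]
      have h0 : 0 ≤ max (v K - C) 0 := le_max_right _ _
      have hφ0 : 0 ≤ φ K := div_nonneg h0 (by linarith)
      have hφ1 : φ K ≤ 1 := (div_le_one (by linarith)).2 (by linarith)
      have h1 : M.cellAvg f K - M.cellAvg b K * v K ≤ nf := by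
        have := mul_nonneg (cellAvg_nonneg hM hb K) (hv0 K)
        linarith [cellAvg_le_linftyNorm hM hf K]
      calc φ K * (M.cellMeas K * (M.cellAvg f K - M.cellAvg b K * v K))
          ≤ φ K * (M.cellMeas K * nf) := by gcongr
        _ ≤ 1 * (M.cellMeas K * nf) := by gcongr
        _ = _ := by ring
    · rw [if_neg (show K ∉ A from hK)]
      have : max (v K - C) 0 = 0 := max_eq_right (by linarith)
      simp [hφ, this]
  have hterm : ∀ σ, M.IsActive ΓD σ →
      M.tau σ * (β / 2 * (M.oppVal w σ - w (M.side σ)) ^ 2) -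
        (if ∃ K ∈ A, σ ∈ M.edges K then 2 * nU ^ 2 / β * (M.faceMeas σ * M.d σ) else 0) ≤
      M.flux ΓN U vD B v (M.side σ) σ * (φ (M.side σ) - M.oppVal φ σ) := by
    intro σ hσ
    have hτ := tau_pos hM hb' σ
    have hd := hM.d_pos σ
    by_cases ht : ∃ K ∈ A, σ ∈ M.edges K
    · rw [if_pos ht, oppVal_truncation (g := fun x => Real.log (1 + x)) hvD hC1 (by simp) hσ,
        oppVal_truncation (g := fun x => x / (1 + x)) hvD hC1 (by simp) hσ,
        flux_side (not_isNeumann_of_isActive hM hdisj hσ)]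
      set u := M.normalVel U (M.side σ) σ with hu
      set y := M.otherVal vD v (M.side σ) σ with hy
      have hy0 : 0 ≤ y := by
        rcases h : M.opp σ with _ | L
        · rw [hy, otherVal_none h]; exact (hvD σ (hσ.resolve_left fun h' => h' h)).1
        · rw [hy, otherVal_some h]; exact hv0 L
      have hun : |u| ≤ nU := abs_normalVel_le hM hΩ hU (side_mem_edges σ)
      have hdd := d_le_diam hM hb' σ
      have h1 : β ≤ B (u * M.d σ) := beta_le Ω U hB hun hd hdd
      have h2 : β ≤ B (-(u * M.d σ)) := by
        rw [← neg_mul]; exact beta_le Ω U hB (by rwa [abs_neg]) hd hdd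
      have h3 := flux_mul_ge (hB.sub_neg (u * M.d σ)) hβ h1 h2 (hv0 (M.side σ)) hy0 hC2
      have h4 : M.tau σ * (2 * (u * M.d σ) ^ 2 / β) ≤
          2 * nU ^ 2 / β * (M.faceMeas σ * M.d σ) := by
        have h5 : u ^ 2 ≤ nU ^ 2 := sq_le_sq' (abs_le.1 hun).1 (abs_le.1 hun).2
        calc M.tau σ * (2 * (u * M.d σ) ^ 2 / β)
            = 2 * u ^ 2 / β * (M.faceMeas σ * M.d σ) := by rw [tau]; field_simp
          _ ≤ _ := by
              have := mul_nonneg (faceMeas_nonneg σ) hd.le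
              gcongr
      have h6 := mul_le_mul_of_nonneg_left h3 hτ.le
      rw [mul_sub, ← mul_assoc (M.tau σ) (_ - _) (_ - _)] at h6
      exact (sub_le_sub_left h4 _).trans h6
    · have hnot : ∀ K, σ ∈ M.edges K → max (v K - C) 0 = 0 := fun K hK => by
        have : ¬ C < v K := fun h => ht ⟨K, h, hK⟩
        exact max_eq_right (by linarith)
      have hs := hnot _ (side_mem_edges σ)
      have hopp : ∀ g : ℝ → ℝ, g 0 = 0 → M.oppVal (fun K => g (max (v K - C) 0)) σ = 0 := by
        intro g hg
        rcases h : M.opp σ with _ | L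
        · exact oppVal_none h
        · rw [oppVal_some h, hnot L (opp_mem_edges h), hg]
      rw [if_neg ht, hopp (fun x => Real.log (1 + x)) (by simp),
        hopp (fun x => x / (1 + x)) (by simp)]
      simp [hφ, hw, hs]
  have htouch : ∑ σ with M.IsActive ΓD σ,
      (if ∃ K ∈ A, σ ∈ M.edges K then 2 * nU ^ 2 / β * (M.faceMeas σ * M.d σ) else 0) ≤
      2 * nU ^ 2 / β * (κ * V) := by
    have hnn : ∀ σ, 0 ≤ 2 * nU ^ 2 / β * (M.faceMeas σ * M.d σ) := fun σ =>
      mul_nonneg (by positivity) (mul_nonneg (faceMeas_nonneg σ) (hM.d_pos σ).le)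
    calc _ ≤ ∑ σ, (if ∃ K ∈ A, σ ∈ M.edges K then
          2 * nU ^ 2 / β * (M.faceMeas σ * M.d σ) else 0) := by
          refine Finset.sum_le_sum_of_subset_of_nonneg (Finset.filter_subset _ _) fun σ _ _ => ?_
          split_ifs
          exacts [hnn σ, le_rfl]
      _ = 2 * nU ^ 2 / β * ∑ σ with ∃ K ∈ A, σ ∈ M.edges K, M.faceMeas σ * M.d σ := by
          rw [← Finset.sum_filter, Finset.mul_sum]
      _ ≤ _ := by
          gcongr
          exact sum_touching_le hM hp hb' hξ hreg A
  have hmain := Finset.sum_le_sum fun σ (hσ : σ ∈ Finset.univ.filter (M.IsActive ΓD)) =>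
    hterm σ (Finset.mem_filter.1 hσ).2
  rw [Finset.sum_sub_distrib, hsum] at hmain
  set E := ∑ σ with M.IsActive ΓD σ, M.tau σ * (M.oppVal w σ - w (M.side σ)) ^ 2 with hE
  have hEeq : ∑ σ with M.IsActive ΓD σ,
      M.tau σ * (β / 2 * (M.oppVal w σ - w (M.side σ)) ^ 2) = β / 2 * E := by
    rw [hE, Finset.mul_sum]
    exact Finset.sum_congr rfl fun σ _ => by ring
  rw [hEeq] at hmain
  have h1 : β / 2 * E ≤ 2 * nU ^ 2 / β * (κ * V) + nf * V := by linarith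
  calc β ^ 2 * E = 2 * β * (β / 2 * E) := by ring
    _ ≤ 2 * β * (2 * nU ^ 2 / β * (κ * V) + nf * V) := by gcongr
    _ = 4 * κ * nU ^ 2 * V + 2 * β * nf * V := by field_simp; ring
    _ ≤ 4 * κ * nU ^ 2 * V + 2 * 1 * nf * V := by gcongr
    _ ≤ 4 * κ * nU ^ 2 * V + 2 * 1 * nf * V + (2 * nU ^ 2 * V + 4 * κ * nf * V) :=
        le_add_of_nonneg_right (by positivity)
    _ = _ := by ring

/-- Passing to the next truncation level. -/
lemma volume_region_succ_le (hM : M.IsAdmissible Ω) (hp : 0 < p) (hΩ : Bornology.IsBounded Ω)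
    {ξ : ℝ} (hξ : 0 < ξ) (hreg : M.IsRegular ξ) {C : ℝ} (hC : 0 < C)
    (hiso : ∀ S : Set M.Cell, volume.real (M.region S) ^ 2 ≤ C * M.perimeter ΓD S ^ 3)
    (hvD : ∀ σ, M.IsDirichlet ΓD σ → M.faceAvg vD σ ∈ Icc (0 : ℝ) 1) {m : ℕ} (hm : 1 ≤ m) :
    volume.real (M.region {K | threshold (m + 1) < v K}) ^ 4 ≤
      64 ^ (m + 1) * (C ^ 2 * (2 ^ p / ξ) ^ 3) * M.energy ΓD vD v m ^ 3 *
        volume.real (M.region {K | threshold m < v K}) ^ 3 := by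
  classical
  rw [energy_eq hvD hm]
  set w : M.Cell → ℝ := fun K => Real.log (1 + max (v K - threshold m) 0) with hw
  set T : ℝ := Real.log (1 + (2 ^ m)⁻¹) with hT
  have hTlow : (1 / 2 : ℝ) ^ (m + 1) ≤ T := half_pow_le_log m
  have hT0 : 0 ≤ T := le_trans (by positivity) hTlow
  have h := volume_superlevel_le hM hp hΩ hξ hreg hC hiso (w := w) hT0
  have hpos : {K | 0 < w K} = {K | threshold m < v K} := by
    ext K
    simp only [hw, mem_ofPred_eq]
    constructor
    · intro h
      by_contra hK
      rw [max_eq_right (by linarith)] at h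
      simp at h
    · intro h
      exact Real.log_pos (by linarith [le_max_left (v K - threshold m) 0])
  have hsub : volume.real (M.region {K | threshold (m + 1) < v K}) ≤
      volume.real (M.region {K | T ≤ w K}) := by
    refine volume_real_mono hΩ ((region_subset hM _).trans subset_closure) ?_
    refine biUnion_subset_biUnion_left fun K (hK : threshold (m + 1) < v K) => ?_
    rw [threshold_succ] at hK
    refine Real.log_le_log (by positivity) ?_
    linarith [le_max_left (v K - threshold m) 0]
  rw [hpos] at h
  have h64 : (64 : ℝ) ^ (m + 1) * ((1 / 2) ^ (m + 1)) ^ 6 = 1 := by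
    rw [← pow_mul, mul_comm (m + 1) 6, pow_mul, ← mul_pow]; norm_num
  calc volume.real (M.region {K | threshold (m + 1) < v K}) ^ 4
      ≤ volume.real (M.region {K | T ≤ w K}) ^ 4 := by gcongr
    _ = 64 ^ (m + 1) * (((1 / 2) ^ (m + 1)) ^ 6 * volume.real (M.region {K | T ≤ w K}) ^ 4) := by
        rw [← mul_assoc, h64, one_mul]
    _ ≤ 64 ^ (m + 1) * (T ^ 6 * volume.real (M.region {K | T ≤ w K}) ^ 4) := by gcongr
    _ ≤ _ := mul_le_mul_of_nonneg_left h (by positivity)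
    _ = _ := by ring

lemma energy_nonneg (hM : M.IsAdmissible Ω) (hΩ : Bornology.IsBounded Ω) (m : ℕ) :
    0 ≤ M.energy ΓD vD v m :=
  Finset.sum_nonneg fun σ _ => mul_nonneg (tau_pos hM hΩ σ).le (sq_nonneg _)

end Mesh

end TPFA

theorem proposition2 (p : ℕ) (hp : p = 2 ∨ p = 3)
    (Ω ΓD ΓN : Set (EuclideanSpace ℝ (Fin p))) (hΩ : TPFA.IsPolytopalDomain Ω)
    (hΓ : frontier Ω = ΓD ∪ ΓN) (hdisj : Disjoint ΓD ΓN) (hΓD : MeasurableSet ΓD)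
    (hΓDpos : 0 < TPFA.surf p ΓD) (ξ : ℝ) (hξ : 0 < ξ) :
    ∃ η : ℝ, 0 < η ∧
      ∀ (M : TPFA.Mesh p), M.IsAdmissible Ω → M.IsCompatible ΓD ΓN → M.IsRegular ξ →
      ∀ (U : EuclideanSpace ℝ (Fin p) → EuclideanSpace ℝ (Fin p))
        (b f vD : EuclideanSpace ℝ (Fin p) → ℝ) (B : ℝ → ℝ) (v : M.Cell → ℝ),
        ContinuousOn U (closure Ω) →
        MemLp b ∞ (volume.restrict Ω) →
        (∀ᵐ x ∂(volume.restrict Ω), 0 ≤ b x) →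
        MemLp f ∞ (volume.restrict Ω) →
        MemLp vD ∞ ((TPFA.surf p).restrict ΓD) →
        TPFA.IsSchemeFunction B →
        M.IsSolution ΓN U b f vD B v →
        (∀ K, 0 ≤ M.cellAvg f K) →
        (∀ σ, M.IsDirichlet ΓD σ → M.faceAvg vD σ ∈ Set.Icc (0 : ℝ) 1) →
        (∀ K, 0 ≤ v K) ∧
        (M.energy ΓD vD v 1 * (TPFA.linftyNorm Ω U ^ 2 + TPFA.linftyNorm Ω f) ^ 2
            ≤ η * TPFA.beta Ω U B ^ 4 →
          ∀ K, v K ≤ 2) := by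
  have hp0 : 0 < p := by omega
  have hb' := hΩ.isBounded
  obtain ⟨C, hC, hiso⟩ := TPFA.exists_isoperimetric hp0 (by omega) hΩ hΓ hdisj hΓD hΓDpos
  set A : ℝ := C ^ 2 * (2 ^ p / ξ) ^ 3 with hA
  set G : ℝ := 4 * (2 ^ p / ξ) + 2 with hG
  set V : ℝ := volume.real Ω with hV
  have hA0 : 0 < A := by positivity
  have hG0 : 0 < G := by positivity
  have hV0 : 0 ≤ V := measureReal_nonneg
  -- `θ` bounds `Z³ |{v > C_2}|² / β⁶`, the quantity which has to be small for the recursion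
  set θ : ℝ := (A * G ^ 3 * 64 ^ 3 * 8 ^ 4)⁻¹ with hθ
  have hθ0 : 0 < θ := by positivity
  set η : ℝ := min 1 (θ ^ 2 / (64 ^ 2 * A * V ^ 3 + 1)) with hη
  have hη0 : 0 < η := lt_min one_pos (by positivity)
  have hηθ : 64 ^ 2 * A * V ^ 3 * η ^ 3 ≤ θ ^ 2 := by
    have h1 : η ^ 3 ≤ η := pow_le_of_le_one hη0.le (min_le_left _ _) three_ne_zero
    have h2 : η * (64 ^ 2 * A * V ^ 3 + 1) ≤ θ ^ 2 :=
      (le_div_iff₀ (by positivity)).1 (min_le_right _ _)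
    calc 64 ^ 2 * A * V ^ 3 * η ^ 3 ≤ 64 ^ 2 * A * V ^ 3 * η := by gcongr
      _ ≤ θ ^ 2 := by linarith
  refine ⟨η, hη0, ?_⟩
  intro M hM hCo hreg U b f vD B v hU _ hb hf _ hB hv hf0 hvD
  have hv0 := hv.nonneg hM hCo hp0 hΩ hdisj (hiso M hM hCo) hB hb hf0 hvD
  refine ⟨hv0, fun hsmall K => ?_⟩
  set a : ℕ → ℝ := fun m => volume.real (M.region {K | TPFA.Mesh.threshold m < v K}) with ha
  have hdecay := TPFA.le_geometric_of_recursion (a := a) (e := M.energy ΓD vD v)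
    (fun m => measureReal_nonneg) (TPFA.Mesh.energy_nonneg hM hb')
    (TPFA.beta_pos Ω U hB) (Z := TPFA.linftyNorm Ω U ^ 2 + TPFA.linftyNorm Ω f)
    (add_nonneg (sq_nonneg _) (TPFA.linftyNorm_nonneg Ω f)) hA0.le hG0.le hθ0.le
    (fun m hm => hv.energy_le hM hCo hp0 hΩ hdisj hξ hreg hU hB hb hf hvD hv0 hm)
    (fun m hm => TPFA.Mesh.volume_region_succ_le hM hp0 hb' hξ hreg hC (hiso M hM hCo) hvD hm)
    (TPFA.volume_real_mono hb' subset_closure (TPFA.Mesh.region_subset hM _)) hsmall hηθ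
    (mul_inv_cancel₀ (by positivity)).le
  -- a cell with `v K > 2` would belong to all superlevel sets
  by_contra hK
  have hlow : ∀ j, M.cellMeas K ≤ a 2 * (1 / 8) ^ j := fun j => by
    refine le_trans ?_ (hdecay j)
    refine TPFA.volume_real_mono hb' ((TPFA.Mesh.region_subset hM _).trans subset_closure) ?_
    exact Set.subset_biUnion_of_mem (u := fun K => M.vol K)
      (show K ∈ {K | TPFA.Mesh.threshold (j + 2) < v K} from
        (TPFA.threshold_lt_two _).trans (not_le.1 hK))
  have hlim : Filter.Tendsto (fun j : ℕ => a 2 * (1 / 8 : ℝ) ^ j) Filter.atTop (nhds (a 2 * 0)) :=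
    (tendsto_pow_atTop_nhds_zero_of_lt_one (by norm_num) (by norm_num)).const_mul _
  have h0 := ge_of_tendsto' hlim hlow
  rw [mul_zero] at h0
  exact absurd h0 (not_le.2 (TPFA.Mesh.cellMeas_pos hM hb' K))
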